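/- Let $\mathbb H=\{q_0+q_1 i+q_2 j+q_3 k: q_0,\dots,q_3\in\mathbb R\}$ be the commutative quaternions ($i^2=k^2=-1$, $j^2=1$, $ij=ji=k$, $jk=kj=i$, $ki=ik=-j$), with $\operatorname{Re} q=q_0$. Let $\|x\|^2$ be the sum of the squares of the $4n$ real components of $x\in\mathbb H^n$, and let $\mathbf S^n=\{x\in\mathbb H^n:\|x\|=1\}$; the uniform distribution on $\mathbf S^n$ is that of the real unit sphere of $\mathbb R^{4n}$. For $d\ge 2$, $n_1,\dots,n_d\ge 1$ and a tensor $\mathcal F\in\mathbb H^{n_1\times\cdots\times n_d}$, consider $$(F)\qquad v^*(F)=\max\Big\{\operatorname{Re}F(x^1,\dots,x^d): x^k\in\mathbf S^{n_k}\Big\},\qquad F(x^1,\dots,x^d)=\sum_{i_1,\dots,i_d}\mathcal F_{i_1\cdots i_d}x^1_{i_1}\cdots x^d_{i_d}.$$ For $\gamma>0$ call $c>0$ admissible if, for all $n\ge2$ with $\gamma\ln n<n$, all $a\in\mathbb H^n$, and $\xi$ uniform on $\mathbf S^n$, $$\operatorname{Prob}\Big\{\operatorname{Re}(a^\top\xi)\ge\sqrt{\tfrac{\gamma\ln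 n}{n}}\,\|a\|\Big\}\ge\frac{c}{n^{4.5\gamma}\sqrt{\ln n}}.$$ **Algorithm 1** (parameters $\epsilon,\gamma,c$). Repeat the following round independently $$R=\max\Big\{1,\Big\lceil \ln\tfrac1\epsilon\cdot c^{-(d-2)}\prod_{k=1}^{d-2}n_k^{4.5\gamma}\sqrt{\ln n_k}\Big\rceil\Big\}$$ times: sample $\xi^k$ independently and uniformly on $\mathbf S^{n_k}$ for $k\le d-2$, and let $(\xi^{d-1},\xi^d)\in\mathbf S^{n_{d-1}}\times\mathbf S^{n_d}$ be an exact maximizer of $\operatorname{Re}F(\xi^1,\dots,\xi^{d-2},x^{d-1},x^d)$. Return a tuple with the largest objective value among the $R$ rounds. **Theorem.** For every $\gamma>0$ an admissible constant exists. For every $\gamma>0$, every admissible $c$, all $d\ge2$, all $n_1,\dots,n_d\ge1$ with $\gamma\ln n_k<n_k$ for $k=1,\dots,d-2$, every $\mathcal F$ and every $\epsilon>0$, the point $(y^1,\dots,y^d)$ returned by Algorithm 1 is, with probability at least $1-\epsilon$, feasible for $(F)$ and satisfies $$\operatorname{Re}F(y^1,\dots,y^d)\ \ge\ \gamma^{\frac{d-2}{2}}\Big(\prod_{k=1}^{d-2}\sqrt{\frac{\ln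 n_k}{n_k}}\Big)\,v^*(F),$$ whichever exact maximizers and ties are chosen. Moreover, Algorithm 1 runs in polynomial time: one program (independent of all parameters), on a randomized real random-access machine, receives $d,n_1,\dots,n_d,\mathcal F,\epsilon,\gamma,c$, carries out Algorithm 1 (so that its output has the above guarantee), and halts, for every outcome of the random draws, within $p\big(d+\prod_{k=1}^d n_k+\max\{0,\lceil\ln\frac1\epsilon\rceil\}\big)$ steps, where $p$ is a polynomial depending only on $\gamma$ and $c$. The machine performs real arithmetic, comparisons, $\exp$, $\ln$, index arithmetic, memory accesses and draws of independent standard normal variates in one step each; it extracts the largest real root of a polynomial at a cost proportional to the number of coefficients, and rounds a real number up to a natural number at a cost proportional to the result. -/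

import Mathlib

open MeasureTheory ProbabilityTheory

noncomputable section

/-! ## Commutative quaternions -/

/-- A commutative quaternion `re + imI i + imJ j + imK k`. -/
@[ext]
structure CQuat where
  re : ℝ
  imI : ℝ
  imJ : ℝ
  imK : ℝ

namespace CQuat

instance : Zero CQuat := ⟨⟨0, 0, 0, 0⟩⟩
instance : One CQuat := ⟨⟨1, 0, 0, 0⟩⟩
instance : Add CQuat := ⟨fun p q => ⟨p.re + q.re, p.imI + q.imI, p.imJ + q.imJ, p.imK + q.imK⟩⟩
instance : Neg CQuat := ⟨fun p => ⟨-p.re, -p.imI, -p.imJ, -p.imK⟩⟩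

/-- The product determined by `i² = k² = -1`, `j² = 1`, `ij = ji = k`, `jk = kj = i`,
`ki = ik = -j`. -/
instance : Mul CQuat := ⟨fun p q =>
  ⟨p.re * q.re - p.imI * q.imI + p.imJ * q.imJ - p.imK * q.imK,
   p.re * q.imI + p.imI * q.re + p.imJ * q.imK + p.imK * q.imJ,
   p.re * q.imJ + p.imJ * q.re - p.imI * q.imK - p.imK * q.imI,
   p.re * q.imK + p.imK * q.re + p.imI * q.imJ + p.imJ * q.imI⟩⟩

@[simp] theorem zero_re : (0 : CQuat).re = 0 := rfl
@[simp] theorem zero_imI : (0 : CQuat).imI = 0 := rfl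
@[simp] theorem zero_imJ : (0 : CQuat).imJ = 0 := rfl
@[simp] theorem zero_imK : (0 : CQuat).imK = 0 := rfl
@[simp] theorem one_re : (1 : CQuat).re = 1 := rfl
@[simp] theorem one_imI : (1 : CQuat).imI = 0 := rfl
@[simp] theorem one_imJ : (1 : CQuat).imJ = 0 := rfl
@[simp] theorem one_imK : (1 : CQuat).imK = 0 := rfl
@[simp] theorem add_re (p q : CQuat) : (p + q).re = p.re + q.re := rfl
@[simp] theorem add_imI (p q : CQuat) : (p + q).imI = p.imI + q.imI := rfl
@[simp] theorem add_imJ (p q : CQuat) : (p + q).imJ = p.imJ + q.imJ := rfl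
@[simp] theorem add_imK (p q : CQuat) : (p + q).imK = p.imK + q.imK := rfl
@[simp] theorem neg_re (p : CQuat) : (-p).re = -p.re := rfl
@[simp] theorem neg_imI (p : CQuat) : (-p).imI = -p.imI := rfl
@[simp] theorem neg_imJ (p : CQuat) : (-p).imJ = -p.imJ := rfl
@[simp] theorem neg_imK (p : CQuat) : (-p).imK = -p.imK := rfl
@[simp] theorem mul_re (p q : CQuat) :
    (p * q).re = p.re * q.re - p.imI * q.imI + p.imJ * q.imJ - p.imK * q.imK := rfl
@[simp] theorem mul_imI (p q : CQuat) :
    (p * q).imI = p.re * q.imI + p.imI * q.re + p.imJ * q.imK + p.imK * q.imJ := rfl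
@[simp] theorem mul_imJ (p q : CQuat) :
    (p * q).imJ = p.re * q.imJ + p.imJ * q.re - p.imI * q.imK - p.imK * q.imI := rfl
@[simp] theorem mul_imK (p q : CQuat) :
    (p * q).imK = p.re * q.imK + p.imK * q.re + p.imI * q.imJ + p.imJ * q.imI := rfl

instance : CommRing CQuat where
  add_assoc p q r := by ext <;> simp <;> ring
  zero_add p := by ext <;> simp
  add_zero p := by ext <;> simp
  add_comm p q := by ext <;> simp <;> ring
  neg_add_cancel p := by ext <;> simp
  mul_assoc p q r := by ext <;> simp <;> ring
  one_mul p := by ext <;> simp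
  mul_one p := by ext <;> simp
  zero_mul p := by ext <;> simp
  mul_zero p := by ext <;> simp
  left_distrib p q r := by ext <;> simp <;> ring
  right_distrib p q r := by ext <;> simp <;> ring
  mul_comm p q := by ext <;> simp <;> ring
  nsmul := nsmulRec
  zsmul := zsmulRec

/-- The four real components of a commutative quaternion. -/
def coord (q : CQuat) : Fin 4 → ℝ := ![q.re, q.imI, q.imJ, q.imK]

instance : MeasurableSpace CQuat := MeasurableSpace.comap coord inferInstance

end CQuat

/-- The norm of a commutative quaternion vector. -/
def hnorm {n : ℕ} (x : Fin n → CQuat) : ℝ :=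
  Real.sqrt (∑ i, ((x i).re ^ 2 + (x i).imI ^ 2 + (x i).imJ ^ 2 + (x i).imK ^ 2))

/-- The commutative quaternion unit sphere in dimension `n`. -/
def hsphere (n : ℕ) : Set (Fin n → CQuat) := {x | hnorm x = 1}

/-- The commutative quaternion vector with the given real components. -/
def ofRealVec {n : ℕ} (v : EuclideanSpace ℝ (Fin 4 × Fin n)) : Fin n → CQuat :=
  fun i => ⟨v (0, i), v (1, i), v (2, i), v (3, i)⟩

/-- The uniform distribution on the commutative quaternion unit sphere: the normalized surface
measure of the unit sphere of the `4n`-dimensional Euclidean space of real components. -/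
def uniformSphere (n : ℕ) : Measure (Fin n → CQuat) :=
  (ProbabilityTheory.cond
    (volume : Measure (EuclideanSpace ℝ (Fin 4 × Fin n))).toSphere Set.univ).map
      (fun v => ofRealVec v.1)

/-! ## The multilinear optimization problem

The order of the tensor is `d = m + 2`. -/

/-- Tuples `(x^1, …, x^d)` of commutative quaternion vectors. -/
abbrev Blocks {d : ℕ} (n : Fin d → ℕ) : Type := (k : Fin d) → Fin (n k) → CQuat

/-- Commutative quaternion tensors of size `n_1 × ⋯ × n_d`. -/
abbrev HTensor {d : ℕ} (n : Fin d → ℕ) : Type := ((k : Fin d) → Fin (n k)) → CQuat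

/-- The multilinear form of a tensor. -/
def form {d : ℕ} {n : Fin d → ℕ} (F : HTensor n) (x : Blocks n) : CQuat :=
  ∑ i : (k : Fin d) → Fin (n k), F i * ∏ k, x k (i k)

/-- The feasible set of the problem: all blocks have unit norm. -/
def feasible {d : ℕ} (n : Fin d → ℕ) : Set (Blocks n) := {x | ∀ k, x k ∈ hsphere (n k)}

/-- The optimal value of the problem of maximizing the real part of the form. -/
def optValue {d : ℕ} {n : Fin d → ℕ} (F : HTensor n) : ℝ :=
  sSup ((fun x => (form F x).re) '' feasible n)

/-- `c` is an admissible value of the constant `c(γ)` of the probability inequality for the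
uniform distribution on the sphere. It is this constant which enters the number of repetitions. -/
def AdmissibleConstant (γ c : ℝ) : Prop :=
  0 < c ∧ ∀ n : ℕ, 2 ≤ n → γ * Real.log n < n → ∀ a : Fin n → CQuat,
    ENNReal.ofReal (c / ((n : ℝ) ^ (9 / 2 * γ) * Real.sqrt (Real.log n))) ≤
      uniformSphere n {x | Real.sqrt (γ * Real.log n / n) * hnorm a ≤ (∑ i, a i * x i).re}

/-- The approximation ratio `γ^((d-2)/2) ∏_{k ≤ d-2} √(ln n_k / n_k)`. -/
def ratio (γ : ℝ) {m : ℕ} (n : Fin (m + 2) → ℕ) : ℝ :=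
  γ ^ ((m : ℝ) / 2) *
    ∏ k : Fin m, Real.sqrt (Real.log (n (k.castAdd 2)) / (n (k.castAdd 2) : ℝ))

/-! ## The randomized algorithm -/

/-- The number of repetitions (rounded up, and at least one). -/
def repetitions (γ c ε : ℝ) {m : ℕ} (n : Fin (m + 2) → ℕ) : ℕ :=
  max 1 ⌈Real.log (1 / ε) * (1 / c ^ m) *
    ∏ k : Fin m, ((n (k.castAdd 2) : ℝ) ^ (9 / 2 * γ) *
      Real.sqrt (Real.log (n (k.castAdd 2))))⌉₊

/-- The feasible set of the bilinear problem left when the first `d - 2` blocks are `ξ`. -/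
def bilinearFeasible {m : ℕ} {n : Fin (m + 2) → ℕ} (ξ : Blocks fun k : Fin m => n (k.castAdd 2)) :
    Set (Blocks n) :=
  {z | (∀ k : Fin m, z (k.castAdd 2) = ξ k) ∧
    ∀ j : Fin 2, z (Fin.natAdd m j) ∈ hsphere (n (Fin.natAdd m j))}

/-- One round: the first `d - 2` blocks of `z` are the samples `ξ`, and the last two blocks form an
exact solution of the remaining bilinear problem. -/
def IsRoundResult {m : ℕ} {n : Fin (m + 2) → ℕ} (F : HTensor n)
    (ξ : Blocks fun k : Fin m => n (k.castAdd 2)) (z : Blocks n) : Prop :=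
  z ∈ bilinearFeasible ξ ∧ IsMaxOn (fun x => (form F x).re) (bilinearFeasible ξ) z

/-- `y` is a possible result of the algorithm run for `R` rounds with samples `ξ r` in round `r`:
a round result with the largest objective value. -/
def IsAlgorithmResult {m : ℕ} {n : Fin (m + 2) → ℕ} (F : HTensor n) {R : ℕ}
    (ξ : Fin R → Blocks fun k : Fin m => n (k.castAdd 2)) (y : Blocks n) : Prop :=
  ∃ z : Fin R → Blocks n, (∀ r, IsRoundResult F (ξ r) (z r)) ∧
    ∃ r, y = z r ∧ ∀ r', (form F (z r')).re ≤ (form F (z r)).re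

/-- The samples of all rounds are independent and uniform on the respective spheres. -/
def IsUniformSample {Ω : Type*} [MeasurableSpace Ω] (P : Measure Ω) {m : ℕ}
    {n : Fin m → ℕ} {R : ℕ} (ξ : Ω → Fin R → Blocks n) : Prop :=
  (∀ r k, HasLaw (fun ω => ξ ω r k) (uniformSphere (n k)) P) ∧
    iIndepFun (fun (i : Fin R × Fin m) (ω : Ω) => ξ ω i.1 i.2) P

/-! ## Randomized real random-access machine

Structured programs with finitely many instructions, acting on arrays of natural numbers (indices,
sizes, counters) and two-dimensional arrays of real numbers. Arithmetic operations, comparisons,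
`exp`, `log`, memory accesses and the drawing of a standard normal variate take one step each.
Extracting the largest real root of a polynomial takes as many steps as it has coefficients. The
conversion of a real number to a counter is charged by the size of the result, as if it were done by
counting. All loops are bounded on entry, so that programs always halt. -/

namespace RealRAM

/-- Index expressions; `arr a i` is the entry `i` of the array of natural numbers number `a`. -/
inductive NExpr where
  | const (v : ℕ)
  | arr (a : ℕ) (i : NExpr)
  | add (e f : NExpr)
  | sub (e f : NExpr)
  | mul (e f : NExpr)

/-- Real expressions; `arr a i j` is the entry `(i, j)` of the array of real numbers number `a`. -/
inductive RExpr where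
  | ofNat (e : NExpr)
  | arr (a : ℕ) (i j : NExpr)
  | add (e f : RExpr)
  | sub (e f : RExpr)
  | mul (e f : RExpr)
  | div (e f : RExpr)
  | exp (e : RExpr)
  | log (e : RExpr)

/-- Programs. -/
inductive Prog where
  | skip
  | seq (p q : Prog)
  /-- `a[i] := e` -/
  | setNat (a : ℕ) (i e : NExpr)
  /-- `a[i, j] := e` -/
  | setReal (a : ℕ) (i j : NExpr) (e : RExpr)
  /-- `a[i, j] :=` a fresh standard normal variate -/
  | gauss (a : ℕ) (i j : NExpr)
  /-- `a[i, j] :=` the largest real root of `∑_{t < len} b[row, t] X^t` -/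
  | root (a : ℕ) (i j : NExpr) (b : ℕ) (row len : NExpr)
  /-- `a[i] := ⌈e⌉` -/
  | ceil (a : ℕ) (i : NExpr) (e : RExpr)
  | ifNat (e f : NExpr) (p q : Prog)
  | ifReal (e f : RExpr) (p q : Prog)
  /-- `for v[0] = 0, …, e - 1 do p` -/
  | loop (v : ℕ) (e : NExpr) (p : Prog)

/-- Memory contents, number of variates drawn, and number of steps taken. -/
structure Store where
  nat : ℕ → ℕ → ℕ
  real : ℕ → ℕ → ℕ → ℝ
  drawn : ℕ
  time : ℕ

namespace Store

def setNat (s : Store) (a i v : ℕ) : Store :=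
  { s with nat := fun a' i' => if a' = a ∧ i' = i then v else s.nat a' i' }

def setReal (s : Store) (a i j : ℕ) (v : ℝ) : Store :=
  { s with real := fun a' i' j' => if a' = a ∧ i' = i ∧ j' = j then v else s.real a' i' j' }

/-- Advance the clock by `t` steps. -/
def tick (s : Store) (t : ℕ) : Store := { s with time := s.time + t }

end Store

def NExpr.eval (s : Store) : NExpr → ℕ
  | .const v => v
  | .arr a i => s.nat a (i.eval s)
  | .add e f => e.eval s + f.eval s
  | .sub e f => e.eval s - f.eval s
  | .mul e f => e.eval s * f.eval s

/-- The number of steps for evaluating an expression. -/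
def NExpr.cost : NExpr → ℕ
  | .const _ => 1
  | .arr _ i => i.cost + 1
  | .add e f => e.cost + f.cost + 1
  | .sub e f => e.cost + f.cost + 1
  | .mul e f => e.cost + f.cost + 1

def RExpr.eval (s : Store) : RExpr → ℝ
  | .ofNat e => (e.eval s : ℝ)
  | .arr a i j => s.real a (i.eval s) (j.eval s)
  | .add e f => e.eval s + f.eval s
  | .sub e f => e.eval s - f.eval s
  | .mul e f => e.eval s * f.eval s
  | .div e f => e.eval s / f.eval s
  | .exp e => Real.exp (e.eval s)
  | .log e => Real.log (e.eval s)

/-- The number of steps for evaluating an expression. -/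
def RExpr.cost : RExpr → ℕ
  | .ofNat e => e.cost + 1
  | .arr _ i j => i.cost + j.cost + 1
  | .add e f => e.cost + f.cost + 1
  | .sub e f => e.cost + f.cost + 1
  | .mul e f => e.cost + f.cost + 1
  | .div e f => e.cost + f.cost + 1
  | .exp e => e.cost + 1
  | .log e => e.cost + 1

/-- The largest real root of `∑_{t < len} b t X^t`; it is `0` if there is no largest root. -/
def largestRoot (len : ℕ) (b : ℕ → ℝ) : ℝ :=
  sSup {x : ℝ | ∑ t ∈ Finset.range len, b t * x ^ t = 0}

open Classical in
/-- Execution of a program; `ω` is the sequence of standard normal variates. -/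
def exec (ω : ℕ → ℝ) : Prog → Store → Store
  | .skip, s => s
  | .seq p q, s => exec ω q (exec ω p s)
  | .setNat a i e, s => (s.setNat a (i.eval s) (e.eval s)).tick (i.cost + e.cost + 1)
  | .setReal a i j e, s =>
      (s.setReal a (i.eval s) (j.eval s) (e.eval s)).tick (i.cost + j.cost + e.cost + 1)
  | .gauss a i j, s =>
      { (s.setReal a (i.eval s) (j.eval s) (ω s.drawn)).tick (i.cost + j.cost + 1) with
        drawn := s.drawn + 1 }
  | .root a i j b row len, s =>
      (s.setReal a (i.eval s) (j.eval s)
        (largestRoot (len.eval s) (s.real b (row.eval s)))).tick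
          (i.cost + j.cost + row.cost + len.cost + len.eval s + 1)
  | .ceil a i e, s =>
      (s.setNat a (i.eval s) ⌈e.eval s⌉₊).tick (i.cost + e.cost + ⌈e.eval s⌉₊ + 1)
  | .ifNat e f p q, s =>
      if e.eval s ≤ f.eval s then exec ω p (s.tick (e.cost + f.cost + 1))
      else exec ω q (s.tick (e.cost + f.cost + 1))
  | .ifReal e f p q, s =>
      if e.eval s ≤ f.eval s then exec ω p (s.tick (e.cost + f.cost + 1))
      else exec ω q (s.tick (e.cost + f.cost + 1))
  | .loop v e p, s =>
      (List.range (e.eval s)).foldl (fun s' t => exec ω p ((s'.setNat v 0 t).tick 1))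
        (s.tick (e.cost + 1))

/-- The initial store. The natural number array `0` holds `d = m + 2`, the array `1` the sizes
`n_1, …, n_d`. The real array `0` holds `ε, γ, c`, the array `1` the four components of the tensor
entries, listed in mixed radix order. Everything else is `0`. -/
def input {m : ℕ} {n : Fin (m + 2) → ℕ} (F : HTensor n) (ε γ c : ℝ) : Store where
  nat a i :=
    if a = 0 ∧ i = 0 then m + 2
    else if a = 1 then (if h : i < m + 2 then n ⟨i, h⟩ else 0)
    else 0
  real a i j :=
    if a = 0 ∧ i = 0 then (if j = 0 then ε else if j = 1 then γ else if j = 2 then c else 0)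
    else if a = 1 then
      (if h : i < ∏ k, n k then
        (if hj : j < 4 then (F (finPiFinEquiv.symm ⟨i, h⟩)).coord ⟨j, hj⟩ else 0)
      else 0)
    else 0
  drawn := 0
  time := 0

/-- The result is read off the real array `2`: its row `k` holds the components of the block `k`. -/
def output {d : ℕ} (n : Fin d → ℕ) (s : Store) : Blocks n := fun k i =>
  ⟨s.real 2 k (4 * i), s.real 2 k (4 * i + 1), s.real 2 k (4 * i + 2), s.real 2 k (4 * i + 3)⟩

end RealRAM

/-- The law of an infinite sequence of independent standard normal variates. -/
def normalSequence : Measure (ℕ → ℝ) := Measure.infinitePi fun _ => gaussianReal 0 1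

end

/-! Guarantee. Fix an optimal tuple `x`. With all other blocks frozen, the objective is a real
linear form `Re (aᵀ v)` in block `k`, and its value at the unit vector `x k` is at most `‖a‖`
(`re_sum_mul_le`). Admissibility therefore says that a uniform sample in place of `x k` keeps at
least the fraction `√(γ ln n_k / n_k)` of that value with probability at least `c / (n_k^(4.5γ) √(ln
n_k))`. Replacing the first `d - 2` blocks of `x` one at a time and integrating coordinate by
coordinate multiplies both the fractions and the probabilities (`prod_le_pi_measure`,
`successBound_le`). The exact bilinear solver of a round does at least as well as the last two
blocks of `x`, so a round succeeds with probability at least some `θ`. The number of rounds is at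
least `ln (1/ε) / θ`, so all of them fail with probability at most `(1 - θ)^R ≤ exp (-θ R) ≤ ε`. If
some sampled block has size one, the ratio is zero and it is enough that exactly solved rounds have
nonnegative value.

Admissible constants. A normalized Gaussian vector is uniform on the sphere
(`map_stdGaussian_normalize`), so a cap becomes a cone. In an orthonormal basis whose first vector
is the direction of the cap, the cone contains the event that the first coordinate is at least `s`
while the squares of the others sum to at most `5n`. By independence and Markov's inequality this
event has probability at least one fifth of the Gaussian tail at `s`. For large `n` one has `s² ≤
7.5 γ ln n`, and the exponent `4.5` leaves room for the lower-order terms; the remaining finitely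
many `n` only shrink the constant.

The program. In real coordinates the bilinear problem is to maximize `u ⬝ B v` over unit vectors,
and the optimum is the square root of the largest eigenvalue `λ` of `A = Bᵀ B`. Traces of powers of
`A` give its characteristic polynomial by Newton's identities, its largest root is `λ`
(`Matrix.IsHermitian.largestRoot_spec`), and projecting away the columns of `λ - A` one by one
leaves the orthogonal projection to the eigenspace (`projMat_kernel`). A normalized nonzero column
is `v`, and `u` is `B v` normalized (`bilinear_max`). Hence the output is a correct result of the
algorithm for every sequence of variates (`exec_program`). Probability enters only through the
samples: distinct blocks use distinct variates, so they are independent and uniform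
(`isUniformSample_samples`).

Running time. Loop bounds are read from arrays which the loops never modify, so each program has a
polynomial cost bound computed from its syntax (`exec_time_le`). The number of rounds is polynomial
even though it contains `c^(-(d-2))`: a block of size one makes the product vanish, and for size at
least two each factor, including `1/c`, is at most a fixed power of `n_k`. The product of these
powers is a power of `∏ n_k`, which is part of the input size. -/

noncomputable section

namespace RealRAM

/-! ## Frame rules and costs -/

/-- The arrays of natural numbers which a program may modify. -/
def Prog.natWrites : Prog → List ℕ
  | .skip => []
  | .seq p q => p.natWrites ++ q.natWrites
  | .setNat a _ _ => [a]
  | .setReal _ _ _ _ => []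
  | .gauss _ _ _ => []
  | .root _ _ _ _ _ _ => []
  | .ceil a _ _ => [a]
  | .ifNat _ _ p q => p.natWrites ++ q.natWrites
  | .ifReal _ _ p q => p.natWrites ++ q.natWrites
  | .loop v _ p => v :: p.natWrites

/-- The arrays of real numbers which a program may modify. -/
def Prog.realWrites : Prog → List ℕ
  | .skip => []
  | .seq p q => p.realWrites ++ q.realWrites
  | .setNat _ _ _ => []
  | .setReal a _ _ _ => [a]
  | .gauss a _ _ => [a]
  | .root a _ _ _ _ _ => [a]
  | .ceil _ _ _ => []
  | .ifNat _ _ p q => p.realWrites ++ q.realWrites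
  | .ifReal _ _ p q => p.realWrites ++ q.realWrites
  | .loop _ _ p => p.realWrites

/-- The program draws no random numbers. -/
def Prog.gaussFree : Prog → Bool
  | .skip => true
  | .seq p q => p.gaussFree && q.gaussFree
  | .setNat _ _ _ => true
  | .setReal _ _ _ _ => true
  | .gauss _ _ _ => false
  | .root _ _ _ _ _ _ => true
  | .ceil _ _ _ => true
  | .ifNat _ _ p q => p.gaussFree && q.gaussFree
  | .ifReal _ _ p q => p.gaussFree && q.gaussFree
  | .loop _ _ p => p.gaussFree

theorem foldl_range_induction {σ : Type*} (f : σ → ℕ → σ) (s : σ) (n : ℕ) (I : ℕ → σ → Prop)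
    (h0 : I 0 s) (hs : ∀ t < n, ∀ s', I t s' → I (t + 1) (f s' t)) :
    I n ((List.range n).foldl f s) := by
  have key : ∀ k ≤ n, I k ((List.range k).foldl f s) := by
    intro k
    induction k with
    | zero => intro _; simpa using h0
    | succ k ih =>
      intro hk
      rw [List.range_succ, List.foldl_append]
      exact hs k hk _ (ih (by omega))
  exact key n le_rfl

/-- Frame rule: each instruction names the array it writes, and a loop also writes its counter. For
a concrete program the side condition is decidable, which is how most uses discharge it. -/
theorem exec_nat_of_notMem (ω : ℕ → ℝ) (p : Prog) (s : Store) (a : ℕ) (h : a ∉ p.natWrites) :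
    (exec ω p s).nat a = s.nat a := by
  induction p generalizing s with
  | skip => rfl
  | seq p q ihp ihq =>
    simp only [Prog.natWrites, List.mem_append, not_or] at h
    simp only [exec]
    rw [ihq _ h.2, ihp _ h.1]
  | setNat b i e =>
    simp only [Prog.natWrites, List.mem_singleton] at h
    funext i'
    simp [exec, Store.setNat, Store.tick, h]
  | setReal => rfl
  | gauss => rfl
  | root => rfl
  | ceil b i e =>
    simp only [Prog.natWrites, List.mem_singleton] at h
    funext i'
    simp [exec, Store.setNat, Store.tick, h]
  | ifNat e f p q ihp ihq =>
    simp only [Prog.natWrites, List.mem_append, not_or] at h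
    simp only [exec]
    split
    · rw [ihp _ h.1]; rfl
    · rw [ihq _ h.2]; rfl
  | ifReal e f p q ihp ihq =>
    simp only [Prog.natWrites, List.mem_append, not_or] at h
    simp only [exec]
    split
    · rw [ihp _ h.1]; rfl
    · rw [ihq _ h.2]; rfl
  | loop v e p ih =>
    simp only [Prog.natWrites, List.mem_cons, not_or] at h
    simp only [exec]
    refine foldl_range_induction _ _ _ (fun _ s' => Store.nat s' a = s.nat a) rfl ?_
    intro t _ s' hs'
    rw [ih _ h.2, ← hs']
    funext i'
    simp [Store.setNat, Store.tick, h.1]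

theorem exec_real_of_notMem (ω : ℕ → ℝ) (p : Prog) (s : Store) (a : ℕ) (h : a ∉ p.realWrites) :
    (exec ω p s).real a = s.real a := by
  induction p generalizing s with
  | skip => rfl
  | seq p q ihp ihq =>
    simp only [Prog.realWrites, List.mem_append, not_or] at h
    simp only [exec]
    rw [ihq _ h.2, ihp _ h.1]
  | setNat b i e => rfl
  | setReal b i j e =>
    simp only [Prog.realWrites, List.mem_singleton] at h
    funext i' j'
    simp [exec, Store.setReal, Store.tick, h]
  | gauss b i j =>
    simp only [Prog.realWrites, List.mem_singleton] at h
    funext i' j'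
    simp [exec, Store.setReal, Store.tick, h]
  | root b =>
    simp only [Prog.realWrites, List.mem_singleton] at h
    funext i' j'
    simp [exec, Store.setReal, Store.tick, h]
  | ceil b i e => rfl
  | ifNat e f p q ihp ihq =>
    simp only [Prog.realWrites, List.mem_append, not_or] at h
    simp only [exec]
    split
    · rw [ihp _ h.1]; rfl
    · rw [ihq _ h.2]; rfl
  | ifReal e f p q ihp ihq =>
    simp only [Prog.realWrites, List.mem_append, not_or] at h
    simp only [exec]
    split
    · rw [ihp _ h.1]; rfl
    · rw [ihq _ h.2]; rfl
  | loop v e p ih =>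
    simp only [Prog.realWrites] at h
    simp only [exec]
    refine foldl_range_induction _ _ _ (fun _ s' => Store.real s' a = s.real a) rfl ?_
    intro t _ s' hs'
    rw [ih _ h, ← hs']
    rfl

theorem exec_drawn_of_gaussFree (ω : ℕ → ℝ) (p : Prog) (s : Store) (h : p.gaussFree = true) :
    (exec ω p s).drawn = s.drawn := by
  induction p generalizing s with
  | skip => rfl
  | seq p q ihp ihq =>
    simp only [Prog.gaussFree, Bool.and_eq_true] at h
    simp only [exec]
    rw [ihq _ h.2, ihp _ h.1]
  | setNat b i e => rfl
  | setReal b i j e => rfl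
  | gauss b i j => simp [Prog.gaussFree] at h
  | root b => rfl
  | ceil b i e => rfl
  | ifNat e f p q ihp ihq =>
    simp only [Prog.gaussFree, Bool.and_eq_true] at h
    simp only [exec]
    split
    · rw [ihp _ h.1]; rfl
    · rw [ihq _ h.2]; rfl
  | ifReal e f p q ihp ihq =>
    simp only [Prog.gaussFree, Bool.and_eq_true] at h
    simp only [exec]
    split
    · rw [ihp _ h.1]; rfl
    · rw [ihq _ h.2]; rfl
  | loop v e p ih =>
    simp only [Prog.gaussFree] at h
    simp only [exec]
    refine foldl_range_induction _ _ _ (fun _ s' => Store.drawn s' = s.drawn) rfl ?_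
    intro t _ s' hs'
    rw [ih _ h, ← hs']
    rfl

/-- Loop rule: besides the invariant, the body may assume that only arrays written by the loop have
changed. -/
theorem loop_induction (ω : ℕ → ℝ) (v : ℕ) (e : NExpr) (p : Prog) (s : Store)
    (I : ℕ → Store → Prop) (h0 : I 0 (s.tick (e.cost + 1)))
    (hs : ∀ t < e.eval s, ∀ s' : Store,
      (∀ a, a ≠ v → a ∉ p.natWrites → s'.nat a = s.nat a) →
      (∀ a, a ∉ p.realWrites → s'.real a = s.real a) →
      s'.nat v 0 = t → I t s' →
      I (t + 1) (exec ω p s'))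
    (hI : ∀ t s' w k, I t s' → I t ((s'.setNat v 0 w).tick k)) :
    I (e.eval s) (exec ω (.loop v e p) s) := by
  -- The frame facts are carried as part of the invariant. The counter is set and the clock advanced
  -- before each run of the body, which is why `I` must be insensitive to both.
  have key := foldl_range_induction
    (fun s' t => exec ω p ((s'.setNat v 0 t).tick 1)) (s.tick (e.cost + 1)) (e.eval s)
    (fun t s' => (∀ a, a ≠ v → a ∉ p.natWrites → s'.nat a = s.nat a) ∧
      (∀ a, a ∉ p.realWrites → s'.real a = s.real a) ∧ I t s')
    ⟨fun _ _ _ => rfl, fun _ _ => rfl, h0⟩ ?_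
  · exact key.2.2
  · rintro t ht s' ⟨hn, hr, hI'⟩
    have hn' : ∀ a, a ≠ v → a ∉ p.natWrites → ((s'.setNat v 0 t).tick 1).nat a = s.nat a := by
      intro a ha hp
      rw [← hn a ha hp]
      funext i
      simp [Store.setNat, Store.tick, ha]
    refine ⟨fun a ha hp => ?_, fun a hp => ?_, ?_⟩
    · rw [exec_nat_of_notMem _ _ _ _ hp, hn' a ha hp]
    · rw [exec_real_of_notMem _ _ _ _ hp]
      exact hr a hp
    · exact hs t ht _ hn' hr (by simp [Store.setNat, Store.tick]) (hI _ _ _ _ hI')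


theorem NExpr.eval_congr {s s' : Store} (e : NExpr) (h : s'.nat = s.nat) : e.eval s' = e.eval s := by
  induction e with
  | const v => rfl
  | arr a i ih => simp only [NExpr.eval, ih, h]
  | add e f ihe ihf => simp only [NExpr.eval, ihe, ihf]
  | sub e f ihe ihf => simp only [NExpr.eval, ihe, ihf]
  | mul e f ihe ihf => simp only [NExpr.eval, ihe, ihf]

/-! ## Summation and tabulation -/

/-- `acc := ∑_{t < e} f`, where the summation index is `v[0]` for array number `12`, and the
accumulator is the real array `20`. -/
def accumulate (e : NExpr) (f : RExpr) : Prog :=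
  .seq (.setReal 20 (.const 0) (.const 0) (.ofNat (.const 0)))
    (.loop 12 e (.setReal 20 (.const 0) (.const 0) (.add (.arr 20 (.const 0) (.const 0)) f)))

/-- Only the summation index and the accumulator change between iterations, so the summand need only
be known in stores that agree with `s` elsewhere. -/
theorem exec_accumulate (ω : ℕ → ℝ) (e : NExpr) (f : RExpr) (s : Store) (g : ℕ → ℝ)
    (hf : ∀ t < e.eval s, ∀ s' : Store, (∀ b, b ≠ 12 → s'.nat b = s.nat b) →
      (∀ b, b ≠ 20 → s'.real b = s.real b) → s'.nat 12 0 = t → f.eval s' = g t) :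
    (exec ω (accumulate e f) s).real 20 0 0 = ∑ t ∈ Finset.range (e.eval s), g t := by
  unfold accumulate
  set s₁ := exec ω (.setReal 20 (.const 0) (.const 0) (.ofNat (.const 0))) s with hs₁
  have he : e.eval s₁ = e.eval s := NExpr.eval_congr e rfl
  have key := loop_induction ω 12 e
    (.setReal 20 (.const 0) (.const 0) (.add (.arr 20 (.const 0) (.const 0)) f)) s₁
    (fun t s' => s'.real 20 0 0 = ∑ u ∈ Finset.range t, g u)
    (by simp [hs₁, exec, Store.setReal, Store.tick, NExpr.eval, RExpr.eval]) ?_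
    (fun _ _ _ _ h => h)
  · rw [he] at key
    exact key
  · intro t ht s' hn hr hv hI
    rw [he] at ht
    have := hf t ht s'
      (fun b hb => (hn b hb (by simp [Prog.natWrites])).trans rfl)
      (fun b hb => by
        rw [hr b (by simpa [Prog.realWrites] using hb), hs₁]
        exact exec_real_of_notMem _ _ _ _ (by simpa [Prog.realWrites] using hb)) hv
    simp [exec, Store.setReal, Store.tick, NExpr.eval, RExpr.eval, Finset.sum_range_succ, hI, this]

/-- `a[i, j] := ∑_{t < e₃} f` for `p < e₁`, `q < e₂`, where `p`, `q`, `t` are the entries `0` of the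
arrays of natural numbers `10`, `11`, `12`. -/
def fill (a : ℕ) (e₁ e₂ i j e₃ : NExpr) (f : RExpr) : Prog :=
  .loop 10 e₁ (.loop 11 e₂
    (.seq (accumulate e₃ f) (.setReal a i j (.arr 20 (.const 0) (.const 0)))))

/-- `s'` differs from `s` only in the array `a` and the scratch arrays used by `fill`, and `p`, `q`
are the current values of the loop counters. -/
structure FillState (s : Store) (a p q : ℕ) (s' : Store) : Prop where
  nat : ∀ b, b ≠ 10 → b ≠ 11 → b ≠ 12 → s'.nat b = s.nat b
  real : ∀ b, b ≠ a → b ≠ 20 → s'.real b = s.real b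
  nat_p : s'.nat 10 0 = p
  nat_q : s'.nat 11 0 = q

/-- The workhorse for all array computations. Distinct pairs have distinct target cells (`hinj`), so
a value once written survives. The last premise of `hf` says that a cell which is not the target of
another pair still has its old content. This lets `f` read from the array being filled: the current
cell itself when updating in place, or cells outside the target region. The inner bound may depend
on `p`, as needed for copying blocks of different sizes. -/
theorem exec_fill (ω : ℕ → ℝ) (a : ℕ) (e₁ e₂ i j e₃ : NExpr) (f : RExpr) (s : Store)
    (n₁ : ℕ) (n₂ : ℕ → ℕ) (n₃ I J : ℕ → ℕ → ℕ) (g : ℕ → ℕ → ℕ → ℝ) (ha : a ≠ 20)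
    (h₁ : e₁.eval s = n₁)
    (h₂ : ∀ p < n₁, ∀ q s', FillState s a p q s' → e₂.eval s' = n₂ p)
    (h₃ : ∀ p < n₁, ∀ q < n₂ p, ∀ s', FillState s a p q s' →
      e₃.eval s' = n₃ p q ∧ i.eval s' = I p q ∧ j.eval s' = J p q)
    (hinj : ∀ p < n₁, ∀ q < n₂ p, ∀ p' < n₁, ∀ q' < n₂ p',
      I p q = I p' q' → J p q = J p' q' → p = p' ∧ q = q')
    (hf : ∀ p < n₁, ∀ q < n₂ p, ∀ t < n₃ p q, ∀ s', FillState s a p q s' → s'.nat 12 0 = t →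
      (∀ x y, (∀ p' < n₁, ∀ q' < n₂ p', (p' ≠ p ∨ q' ≠ q) → ¬ (I p' q' = x ∧ J p' q' = y)) →
        s'.real a x y = s.real a x y) →
      f.eval s' = g p q t) :
    (∀ p < n₁, ∀ q < n₂ p, (exec ω (fill a e₁ e₂ i j e₃ f) s).real a (I p q) (J p q) =
      ∑ t ∈ Finset.range (n₃ p q), g p q t) ∧
    (∀ x y, (∀ p < n₁, ∀ q < n₂ p, ¬ (I p q = x ∧ J p q = y)) →
      (exec ω (fill a e₁ e₂ i j e₃ f) s).real a x y = s.real a x y) := by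
  -- `D` is the set of pairs already processed: an initial segment of the lexicographic order, first
  -- by full rows, then within the current row.
  let Inv : (ℕ → ℕ → Prop) → Store → Prop := fun D s' =>
    (∀ p < n₁, ∀ q < n₂ p, D p q →
      s'.real a (I p q) (J p q) = ∑ t ∈ Finset.range (n₃ p q), g p q t) ∧
    (∀ x y, (∀ p < n₁, ∀ q < n₂ p, D p q → ¬ (I p q = x ∧ J p q = y)) →
      s'.real a x y = s.real a x y)
  have key := loop_induction ω 10 e₁ (.loop 11 e₂
    (.seq (accumulate e₃ f) (.setReal a i j (.arr 20 (.const 0) (.const 0))))) s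
    (fun P s' => Inv (fun p _ => p < P) s') ?_ ?_ (fun _ _ _ _ h => h)
  · rw [h₁] at key
    exact ⟨fun p hp q hq => key.1 p hp q hq hp,
      fun x y h => key.2 x y fun p hp q hq _ => h p hp q hq⟩
  · exact ⟨fun p _ q _ h => absurd h (Nat.not_lt_zero _), fun _ _ _ => rfl⟩
  intro P hP s₁ hn₁ hr₁ hv₁ hI₁
  rw [h₁] at hP
  simp only [Prog.natWrites, Prog.realWrites, accumulate, List.nil_append, List.append_nil,
    List.cons_append, List.mem_cons, List.not_mem_nil, or_false, not_or] at hn₁ hr₁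
  have he₂ : e₂.eval s₁ = n₂ P := h₂ P hP (s₁.nat 11 0) s₁
    ⟨fun b h10 h11 h12 => hn₁ b h10 ⟨h11, h12⟩, fun b hb hb' => hr₁ b ⟨hb', hb', hb⟩, hv₁, rfl⟩
  have key₂ := loop_induction ω 11 e₂
    (.seq (accumulate e₃ f) (.setReal a i j (.arr 20 (.const 0) (.const 0)))) s₁
    (fun Q s' => Inv (fun p q => p < P ∨ (p = P ∧ q < Q)) s') ?_ ?_ (fun _ _ _ _ h => h)
  · rw [he₂] at key₂
    refine ⟨fun p hp q hq hpP => key₂.1 p hp q hq ?_, fun x y h => key₂.2 x y fun p hp q hq hD => ?_⟩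
    · rcases Nat.lt_succ_iff_lt_or_eq.mp hpP with h | h
      · exact Or.inl h
      · subst h; exact Or.inr ⟨rfl, hq⟩
    · exact h p hp q hq (by omega)
  · refine ⟨fun p hp q hq hD => hI₁.1 p hp q hq (by omega),
      fun x y h => hI₁.2 x y fun p hp q hq hD => h p hp q hq (Or.inl hD)⟩
  intro Q hQ s₂ hn₂ hr₂ hv₂ hI₂
  rw [he₂] at hQ
  simp only [Prog.natWrites, Prog.realWrites, accumulate, List.nil_append, List.append_nil,
    List.cons_append, List.mem_cons, List.not_mem_nil, or_false, not_or] at hn₂ hr₂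
  have hFS : FillState s a P Q s₂ :=
    ⟨fun b h10 h11 h12 => (hn₂ b h11 h12).trans (hn₁ b h10 ⟨h11, h12⟩),
      fun b hb hb' => (hr₂ b ⟨hb', hb', hb⟩).trans (hr₁ b ⟨hb', hb', hb⟩),
      by rw [hn₂ 10 (by norm_num) (by norm_num), hv₁], hv₂⟩
  obtain ⟨he₃, hi, hj⟩ := h₃ P hP Q hQ s₂ hFS
  have hacc := exec_accumulate ω e₃ f s₂ (g P Q) (by
    intro t ht s₃ hn₃ hr₃ hv₃
    rw [he₃] at ht
    refine hf P hP Q hQ t ht s₃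
      ⟨fun b h10 h11 h12 => (hn₃ b h12).trans (hFS.nat b h10 h11 h12),
        fun b hb hb' => (hr₃ b hb').trans (hFS.real b hb hb'),
        by rw [hn₃ 10 (by norm_num), hFS.nat_p], by rw [hn₃ 11 (by norm_num), hFS.nat_q]⟩ hv₃ ?_
    intro x y hxy
    rw [hr₃ a ha]
    refine hI₂.2 x y fun p hp q hq hD => hxy p hp q hq ?_
    omega)
  rw [he₃] at hacc
  set s₃ := exec ω (accumulate e₃ f) s₂ with hs₃
  have hn₃ : ∀ b, b ≠ 12 → s₃.nat b = s₂.nat b := fun b hb =>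
    exec_nat_of_notMem _ _ _ _ (by simpa [accumulate, Prog.natWrites] using hb)
  have hr₃ : ∀ b, b ≠ 20 → s₃.real b = s₂.real b := fun b hb =>
    exec_real_of_notMem _ _ _ _ (by simpa [accumulate, Prog.realWrites] using hb)
  have hFS₃ : FillState s a P Q s₃ :=
    ⟨fun b h10 h11 h12 => (hn₃ b h12).trans (hFS.nat b h10 h11 h12),
        fun b hb hb' => (hr₃ b hb').trans (hFS.real b hb hb'),
        by rw [hn₃ 10 (by norm_num), hFS.nat_p], by rw [hn₃ 11 (by norm_num), hFS.nat_q]⟩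
  obtain ⟨-, hi₃, hj₃⟩ := h₃ P hP Q hQ s₃ hFS₃
  have hfin : ∀ x y, (exec ω (.seq (accumulate e₃ f)
      (.setReal a i j (.arr 20 (.const 0) (.const 0)))) s₂).real a x y =
      if x = I P Q ∧ y = J P Q then ∑ t ∈ Finset.range (n₃ P Q), g P Q t else s₂.real a x y := by
    intro x y
    simp only [exec, ← hs₃, Store.setReal, Store.tick, RExpr.eval, NExpr.eval, hi₃, hj₃, hacc,
      hr₃ a ha, true_and]
  refine ⟨fun p hp q hq hD => ?_, fun x y h => ?_⟩
  · rw [hfin]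
    split_ifs with hc
    · obtain ⟨rfl, rfl⟩ := hinj p hp q hq P hP Q hQ hc.1 hc.2
      rfl
    · refine hI₂.1 p hp q hq ?_
      rcases hD with h | ⟨h, h'⟩
      · exact Or.inl h
      · rcases Nat.lt_succ_iff_lt_or_eq.mp h' with h'' | h''
        · exact Or.inr ⟨h, h''⟩
        · subst h h''; exact absurd ⟨rfl, rfl⟩ hc
  · rw [hfin, if_neg]
    · exact hI₂.2 x y fun p hp q hq hD => h p hp q hq (by omega)
    · rintro ⟨rfl, rfl⟩
      exact h P hP Q hQ (Or.inr ⟨rfl, by omega⟩) ⟨rfl, rfl⟩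

end RealRAM

namespace RealRAM

/-! ## Cost polynomials -/

/-- A bound for the value of an expression in terms of a bound for the arrays it reads. -/
def NExpr.bound : NExpr → Polynomial ℕ
  | .const v => Polynomial.C v
  | .arr _ _ => Polynomial.X
  | .add e f => e.bound + f.bound
  | .sub e _ => e.bound
  | .mul e f => e.bound * f.bound

/-- The arrays whose entries determine the value of an expression. -/
def NExpr.heads : NExpr → List ℕ
  | .const _ => []
  | .arr a _ => [a]
  | .add e f => e.heads ++ f.heads
  | .sub e _ => e.heads
  | .mul e f => e.heads ++ f.heads

/-- Truncated subtraction can only decrease, so the subtrahend counts neither for `bound` nor for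
`heads`. An array read is bounded by `X` whatever its index. -/
theorem NExpr.eval_le_bound (s : Store) (X : ℕ) (e : NExpr)
    (h : ∀ a ∈ e.heads, ∀ i, s.nat a i ≤ X) : e.eval s ≤ e.bound.eval X := by
  induction e with
  | const v => simp [NExpr.eval, NExpr.bound]
  | arr a i _ => simpa [NExpr.eval, NExpr.bound] using h a (by simp [NExpr.heads]) _
  | add e f ihe ihf =>
    simp only [NExpr.heads, List.mem_append] at h
    simp only [NExpr.eval, NExpr.bound, Polynomial.eval_add]
    exact Nat.add_le_add (ihe fun a ha => h a (Or.inl ha)) (ihf fun a ha => h a (Or.inr ha))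
  | sub e f ihe ihf =>
    simp only [NExpr.eval, NExpr.bound]
    exact (Nat.sub_le _ _).trans (ihe h)
  | mul e f ihe ihf =>
    simp only [NExpr.heads, List.mem_append] at h
    simp only [NExpr.eval, NExpr.bound, Polynomial.eval_mul]
    exact Nat.mul_le_mul (ihe fun a ha => h a (Or.inl ha)) (ihf fun a ha => h a (Or.inr ha))

/-- The arrays whose entries determine loop bounds and polynomial lengths. -/
def Prog.heads : Prog → List ℕ
  | .skip => []
  | .seq p q => p.heads ++ q.heads
  | .setNat _ _ _ => []
  | .setReal _ _ _ _ => []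
  | .gauss _ _ _ => []
  | .root _ _ _ _ _ len => len.heads
  | .ceil _ _ _ => []
  | .ifNat _ _ p q => p.heads ++ q.heads
  | .ifReal _ _ p q => p.heads ++ q.heads
  | .loop _ e p => e.heads ++ p.heads

/-- The program does not round real numbers. -/
def Prog.ceilFree : Prog → Bool
  | .skip => true
  | .seq p q => p.ceilFree && q.ceilFree
  | .setNat _ _ _ => true
  | .setReal _ _ _ _ => true
  | .gauss _ _ _ => true
  | .root _ _ _ _ _ _ => true
  | .ceil _ _ _ => false
  | .ifNat _ _ p q => p.ceilFree && q.ceilFree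
  | .ifReal _ _ p q => p.ceilFree && q.ceilFree
  | .loop _ _ p => p.ceilFree

open Polynomial in
/-- A polynomial bound for the number of steps, in terms of a bound for the entries of the arrays
which determine loop bounds. -/
def Prog.costBound : Prog → Polynomial ℕ
  | .skip => 0
  | .seq p q => p.costBound + q.costBound
  | .setNat _ i e => C (i.cost + e.cost + 1)
  | .setReal _ i j e => C (i.cost + j.cost + e.cost + 1)
  | .gauss _ i j => C (i.cost + j.cost + 1)
  | .root _ i j _ row len => C (i.cost + j.cost + row.cost + len.cost + 1) + len.bound
  | .ceil _ _ _ => 0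
  | .ifNat e f p q => C (e.cost + f.cost + 1) + p.costBound + q.costBound
  | .ifReal e f p q => C (e.cost + f.cost + 1) + p.costBound + q.costBound
  | .loop _ e p => C (e.cost + 1) + e.bound * (1 + p.costBound)

/-- The arrays that control loop lengths and root extractions are never written by `p`, so the bound
`X` valid at the start is valid at every nested loop. Rounding is excluded because its cost depends
on a real value. -/
theorem exec_time_le (ω : ℕ → ℝ) (X : ℕ) (p : Prog) (s : Store) (hc : p.ceilFree = true)
    (h : ∀ a ∈ p.heads, a ∉ p.natWrites ∧ ∀ i, s.nat a i ≤ X) :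
    (exec ω p s).time ≤ s.time + p.costBound.eval X := by
  induction p generalizing s with
  | skip => simp [exec]
  | seq p q ihp ihq =>
    simp only [Prog.ceilFree, Bool.and_eq_true] at hc
    simp only [Prog.heads, Prog.natWrites, List.mem_append, not_or] at h
    have h1 := ihp s hc.1 fun a ha => ⟨(h a (Or.inl ha)).1.1, (h a (Or.inl ha)).2⟩
    have h2 := ihq (exec ω p s) hc.2 fun a ha => ⟨(h a (Or.inr ha)).1.2, fun i => by
      rw [exec_nat_of_notMem _ _ _ _ (h a (Or.inr ha)).1.1]
      exact (h a (Or.inr ha)).2 i⟩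
    simp only [exec, Prog.costBound, Polynomial.eval_add]
    omega
  | setNat => simp [exec, Store.setNat, Store.tick, Prog.costBound]
  | setReal => simp [exec, Store.setReal, Store.tick, Prog.costBound]
  | gauss => simp [exec, Store.setReal, Store.tick, Prog.costBound]
  | root b i j c row len =>
    have := NExpr.eval_le_bound s X len fun a ha => (h a ha).2
    simp only [exec, Store.setReal, Store.tick, Prog.costBound, Polynomial.eval_add,
      Polynomial.eval_C]
    omega
  | ceil => simp [Prog.ceilFree] at hc
  | ifNat e f p q ihp ihq =>
    simp only [Prog.ceilFree, Bool.and_eq_true] at hc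
    simp only [Prog.heads, Prog.natWrites, List.mem_append, not_or] at h
    simp only [exec, Prog.costBound, Polynomial.eval_add, Polynomial.eval_C]
    split
    · have := ihp (s.tick (e.cost + f.cost + 1)) hc.1 fun a ha =>
        ⟨(h a (Or.inl ha)).1.1, (h a (Or.inl ha)).2⟩
      simp only [Store.tick] at this ⊢
      omega
    · have := ihq (s.tick (e.cost + f.cost + 1)) hc.2 fun a ha =>
        ⟨(h a (Or.inr ha)).1.2, (h a (Or.inr ha)).2⟩
      simp only [Store.tick] at this ⊢
      omega
  | ifReal e f p q ihp ihq =>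
    simp only [Prog.ceilFree, Bool.and_eq_true] at hc
    simp only [Prog.heads, Prog.natWrites, List.mem_append, not_or] at h
    simp only [exec, Prog.costBound, Polynomial.eval_add, Polynomial.eval_C]
    split
    · have := ihp (s.tick (e.cost + f.cost + 1)) hc.1 fun a ha =>
        ⟨(h a (Or.inl ha)).1.1, (h a (Or.inl ha)).2⟩
      simp only [Store.tick] at this ⊢
      omega
    · have := ihq (s.tick (e.cost + f.cost + 1)) hc.2 fun a ha =>
        ⟨(h a (Or.inr ha)).1.2, (h a (Or.inr ha)).2⟩
      simp only [Store.tick] at this ⊢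
      omega
  | loop v e p ih =>
    simp only [Prog.ceilFree] at hc
    simp only [Prog.heads, Prog.natWrites, List.mem_append, List.mem_cons, not_or] at h
    have he := NExpr.eval_le_bound s X e fun a ha => (h a (Or.inl ha)).2
    have key := foldl_range_induction
      (fun s' t => exec ω p ((s'.setNat v 0 t).tick 1)) (s.tick (e.cost + 1)) (e.eval s)
      (fun t s' => (∀ a ∈ p.heads, Store.nat s' a = s.nat a) ∧
        Store.time s' ≤ s.time + (e.cost + 1) + t * (1 + p.costBound.eval X))
      ⟨fun _ _ => rfl, by simp [Store.tick]⟩ ?_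
    · have := Nat.mul_le_mul_right (1 + p.costBound.eval X) he
      have h2 := key.2
      simp only [exec, Prog.costBound, Polynomial.eval_add, Polynomial.eval_C, Polynomial.eval_mul,
        Polynomial.eval_one]
      omega
    · rintro t _ s' ⟨hn, ht⟩
      have hn' : ∀ a ∈ p.heads, ((s'.setNat v 0 t).tick 1).nat a = s.nat a := by
        intro a ha
        rw [← hn a ha]
        funext i
        simp [Store.setNat, Store.tick, (h a (Or.inr ha)).1.1]
      refine ⟨fun a ha => ?_, ?_⟩
      · rw [exec_nat_of_notMem _ _ _ _ (h a (Or.inr ha)).1.2, hn' a ha]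
      · have := ih ((s'.setNat v 0 t).tick 1) hc fun a ha =>
          ⟨(h a (Or.inr ha)).1.2, fun i => by rw [hn' a ha]; exact (h a (Or.inr ha)).2 i⟩
        simp only [Store.setNat, Store.tick] at this ⊢
        rw [Nat.add_mul, Nat.one_mul]
        omega

/-! ## The program -/

namespace Alg

/-- The order of the tensor. -/
abbrev ord : NExpr := .arr 0 (.const 0)
/-- The number of sampled blocks. -/
abbrev samp : NExpr := .sub ord (.const 2)
/-- The size of a block. -/
abbrev size (k : NExpr) : NExpr := .arr 1 k
/-- The real dimension of a block. -/
abbrev dim (k : NExpr) : NExpr := .mul (.const 4) (size k)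
/-- The number of tensor entries. -/
abbrev total : NExpr := .arr 2 (.const 0)
/-- The number of rounds. -/
abbrev rounds : NExpr := .arr 3 (.const 0)
/-- The first counter of `fill`. -/
abbrev P : NExpr := .arr 10 (.const 0)
/-- The second counter of `fill`. -/
abbrev Q : NExpr := .arr 11 (.const 0)
/-- The summation index of `fill`. -/
abbrev T : NExpr := .arr 12 (.const 0)
/-- The counter of the outer loops over blocks. -/
abbrev K : NExpr := .arr 13 (.const 0)
/-- The counter of the outer loops over components. -/
abbrev J : NExpr := .arr 14 (.const 0)
/-- The penultimate block. -/
abbrev left : NExpr := samp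
/-- The last block. -/
abbrev right : NExpr := .add samp (.const 1)
/-- An entry `[0, 0]` of a real array. -/
abbrev cell (a : ℕ) : RExpr := .arr a (.const 0) (.const 0)
/-- The Kronecker symbol. -/
abbrev delta (i j : NExpr) : RExpr := .ofNat (.sub (.const 1) (.add (.sub i j) (.sub j i)))
/-- The square root of a positive number. -/
abbrev sqrt (e : RExpr) : RExpr := .exp (.div (.log e) (.ofNat (.const 2)))

/-- Array `7`: squared norm of the sample. Array `5`, row `k`: the normalized sample. -/
def sampleBlock : Prog :=
  .seq (.setReal 7 (.const 0) (.const 0) (.ofNat (.const 0)))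
  (.seq (.loop 14 (dim K) (.seq (.gauss 5 K J)
    (.setReal 7 (.const 0) (.const 0) (.add (cell 7) (.mul (.arr 5 K J) (.arr 5 K J))))))
  (fill 5 (.const 1) (dim K) K Q (.const 1) (.div (.arr 5 K Q) (sqrt (cell 7)))))

/-- The component `b` of the entry `T` of block `K`. -/
abbrev vecComp (b : ℕ) : RExpr := .arr 5 K (.add (.mul (.const 4) T) (.const b))
/-- The component `b` of a tensor entry after contraction with the first `K` blocks. -/
abbrev tensorComp (b : ℕ) : RExpr :=
  .arr 1 (.add T (.mul (size K) P)) (.add (.mul (.const 4) K) (.const b))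

/-- One component of the contraction with block `K`. -/
def contractComp (c : ℕ) (e : RExpr) : Prog :=
  fill 1 total (.const 1) P (.add (.mul (.const 4) (.add K (.const 1))) (.const c)) (size K) e

/-- Contraction with block `K`. -/
def contractBlock : Prog :=
  .seq (contractComp 0 (.sub (.add (.sub (.mul (vecComp 0) (tensorComp 0))
      (.mul (vecComp 1) (tensorComp 1))) (.mul (vecComp 2) (tensorComp 2)))
      (.mul (vecComp 3) (tensorComp 3))))
  (.seq (contractComp 1 (.add (.add (.add (.mul (vecComp 0) (tensorComp 1))
      (.mul (vecComp 1) (tensorComp 0))) (.mul (vecComp 2) (tensorComp 3)))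
      (.mul (vecComp 3) (tensorComp 2))))
  (.seq (contractComp 2 (.sub (.sub (.add (.mul (vecComp 0) (tensorComp 2))
      (.mul (vecComp 2) (tensorComp 0))) (.mul (vecComp 1) (tensorComp 3)))
      (.mul (vecComp 3) (tensorComp 1))))
  (contractComp 3 (.add (.add (.add (.mul (vecComp 0) (tensorComp 3))
      (.mul (vecComp 3) (tensorComp 0))) (.mul (vecComp 1) (tensorComp 2)))
      (.mul (vecComp 2) (tensorComp 1))))))

/-- Sampling and contraction of the first `d - 2` blocks. -/
def contractAll : Prog := .loop 13 samp (.seq sampleBlock contractBlock)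

/-- Array `8`: the real matrix of the remaining bilinear form. -/
def bilinear : Prog :=
  fill 8 (dim left) (dim right) P Q (.const 4)
    (.mul (.arr 1 (.add (.arr 4 P) (.mul (size left) (.arr 4 Q))) (.add (.mul (.const 4) samp) T))
      (.arr 6 T (.add (.mul (.const 4) (.arr 5 P)) (.arr 5 Q))))

/-- Array `9`: the Gram matrix of the columns. -/
def gram : Prog :=
  fill 9 (dim right) (dim right) P Q (dim left) (.mul (.arr 8 T P) (.arr 8 T Q))

/-- The next power of the Gram matrix. -/
def powerStep : Prog :=
  fill 10 (dim right) (dim right)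
    P (.add (.mul (dim right) (.add J (.const 1))) Q) (dim right)
    (.mul (.arr 10 P (.add (.mul (dim right) J) T)) (.arr 9 T Q))

/-- Array `10`: the powers of the Gram matrix, next to each other. -/
def powers : Prog :=
  .seq (fill 10 (dim right) (dim right) P Q (.const 1) (delta P Q)) (.loop 14 (dim right) powerStep)

/-- Array `11`: the traces of the powers. -/
def traces : Prog :=
  fill 11 (.const 1) (.add (dim right) (.const 1)) (.const 0) Q (dim right)
    (.arr 10 T (.add (.mul (dim right) Q) T))

/-- The next coefficient of the characteristic polynomial, by Newton's identities. -/
def coeffStep : Prog :=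
  .seq (accumulate (.sub (dim right) (.sub (dim right) (.add J (.const 1))))
      (.mul (.arr 12 (.const 0) (.add (.sub (dim right) J) T))
        (.arr 11 (.const 0) (.add T (.const 1)))))
    (.setReal 12 (.const 0) (.sub (dim right) (.add J (.const 1)))
      (.div (.sub (.ofNat (.const 0)) (cell 20)) (.ofNat (.add J (.const 1)))))

/-- Array `12`: the coefficients of the characteristic polynomial. -/
def coeffs : Prog :=
  .seq (.setReal 12 (.const 0) (dim right) (.ofNat (.const 1))) (.loop 14 (dim right) coeffStep)

/-- Array `13`: the largest eigenvalue. -/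
def eigenvalue : Prog :=
  .root 13 (.const 0) (.const 0) 12 (.const 0) (.add (dim right) (.const 1))

/-- One step of the orthogonal projection to the eigenspace: column `J` of `λ - A`. -/
def projectStep : Prog :=
  .seq (fill 15 (.const 1) (dim right) (.const 0) Q (dim right)
    (.mul (.arr 14 Q T) (.sub (.mul (cell 13) (delta T J)) (.arr 9 T J))))
  (.seq (fill 16 (.const 1) (.const 1) (.const 0) (.const 0) (dim right)
    (.mul (.arr 15 (.const 0) T) (.arr 15 (.const 0) T)))
  (.ifReal (cell 16) (.ofNat (.const 0)) .skip
    (fill 14 (dim right) (dim right) P Q (.const 1)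
      (.sub (.arr 14 P Q) (.div (.mul (.arr 15 (.const 0) P) (.arr 15 (.const 0) Q)) (cell 16))))))

/-- Array `14`: the orthogonal projection to the eigenspace. -/
def project : Prog :=
  .seq (fill 14 (dim right) (dim right) P Q (.const 1) (delta P Q))
    (.loop 14 (dim right) projectStep)

/-- A nonzero column of the projection. -/
def pick : Prog :=
  .loop 14 (dim right) (.ifReal (.arr 14 J J) (.ofNat (.const 0)) .skip
    (.setNat 6 (.const 0) J))

/-- The last block. -/
def rightVec : Prog :=
  fill 5 (.const 1) (dim right) right Q (.const 1)
    (.div (.arr 14 Q (.arr 6 (.const 0)))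
      (sqrt (.arr 14 (.arr 6 (.const 0)) (.arr 6 (.const 0)))))

/-- Array `17`: the image of the last block. Array `18`: its squared norm. -/
def image : Prog :=
  .seq (fill 17 (.const 1) (dim left) (.const 0) Q (dim right)
    (.mul (.arr 8 Q T) (.arr 5 right T)))
  (fill 18 (.const 1) (.const 1) (.const 0) (.const 0) (dim left)
    (.mul (.arr 17 (.const 0) T) (.arr 17 (.const 0) T)))

/-- The penultimate block. -/
def leftVec : Prog :=
  .ifReal (cell 18) (.ofNat (.const 0))
    (fill 5 (.const 1) (dim left) left Q (.const 1) (delta Q (.const 0)))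
    (fill 5 (.const 1) (dim left) left Q (.const 1) (.div (.arr 17 (.const 0) Q) (sqrt (cell 18))))

/-- Array `19`: the objective value. -/
def value : Prog :=
  fill 19 (.const 1) (.const 1) (.const 0) (.const 0) (dim left)
    (.mul (.arr 5 left T) (.arr 17 (.const 0) T))

/-- Keep the best tuple so far in array `2`, its value in array `4`. -/
def update : Prog :=
  .ifReal (cell 19) (cell 4) .skip
    (.seq (.setReal 4 (.const 0) (.const 0) (cell 19))
      (fill 2 ord (dim P) P Q (.const 1) (.arr 5 P Q)))

/-- Exact solution of the bilinear problem. -/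
def solve : Prog :=
  .seq bilinear (.seq gram (.seq powers (.seq traces (.seq coeffs (.seq eigenvalue (.seq project
    (.seq pick (.seq rightVec (.seq image (.seq leftVec value))))))))))

/-- One round. -/
def round : Prog := .seq contractAll (.seq solve update)

/-- The number of tensor entries. -/
def product : Prog :=
  .seq (.setNat 2 (.const 0) (.const 1)) (.loop 13 ord (.setNat 2 (.const 0) (.mul total (size K))))

/-- Array `3`: the number of rounds before rounding. -/
def roundsReal : Prog :=
  .seq (.setReal 3 (.const 0) (.const 0)
    (.log (.div (.ofNat (.const 1)) (.arr 0 (.const 0) (.const 0)))))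
  (.loop 13 samp (.ifNat (size K) (.const 1)
    (.setReal 3 (.const 0) (.const 0) (.ofNat (.const 0)))
    (.setReal 3 (.const 0) (.const 0) (.mul (cell 3)
      (.mul (.div (.ofNat (.const 1)) (.arr 0 (.const 0) (.const 2)))
      (.mul (.exp (.mul (.log (.ofNat (size K)))
        (.mul (.div (.ofNat (.const 9)) (.ofNat (.const 2))) (.arr 0 (.const 0) (.const 1)))))
      (sqrt (.log (.ofNat (size K))))))))))

/-- The number of rounds. -/
def roundsNat : Prog :=
  .seq (.ceil 3 (.const 0) (cell 3))
    (.ifNat rounds (.const 0) (.setNat 3 (.const 0) (.const 1)) .skip)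

/-- Arrays `4` and `5`: quotients and remainders modulo four. -/
def divisions : Prog :=
  .loop 13 total (.loop 14 (.const 4)
    (.seq (.setNat 4 (.add (.mul (.const 4) K) J) K) (.setNat 5 (.add (.mul (.const 4) K) J) J)))

/-- `6[c, b] := v` -/
abbrev setTable (c b : ℕ) (v : RExpr) : Prog := .setReal 6 (.const c) (.const b) v

/-- Array `6`: the real parts of the products of three units. -/
def unitTable : Prog :=
  .seq (setTable 0 0 (.ofNat (.const 1)))
  (.seq (setTable 1 1 (.sub (.ofNat (.const 0)) (.ofNat (.const 1))))
  (.seq (setTable 2 2 (.ofNat (.const 1)))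
  (.seq (setTable 3 3 (.sub (.ofNat (.const 0)) (.ofNat (.const 1))))
  (.seq (setTable 1 4 (.sub (.ofNat (.const 0)) (.ofNat (.const 1))))
  (.seq (setTable 0 5 (.sub (.ofNat (.const 0)) (.ofNat (.const 1))))
  (.seq (setTable 3 6 (.sub (.ofNat (.const 0)) (.ofNat (.const 1))))
  (.seq (setTable 2 7 (.sub (.ofNat (.const 0)) (.ofNat (.const 1))))
  (.seq (setTable 2 8 (.ofNat (.const 1)))
  (.seq (setTable 3 9 (.sub (.ofNat (.const 0)) (.ofNat (.const 1))))
  (.seq (setTable 0 10 (.ofNat (.const 1)))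
  (.seq (setTable 1 11 (.sub (.ofNat (.const 0)) (.ofNat (.const 1))))
  (.seq (setTable 3 12 (.sub (.ofNat (.const 0)) (.ofNat (.const 1))))
  (.seq (setTable 2 13 (.sub (.ofNat (.const 0)) (.ofNat (.const 1))))
  (.seq (setTable 1 14 (.sub (.ofNat (.const 0)) (.ofNat (.const 1))))
  (setTable 0 15 (.sub (.ofNat (.const 0)) (.ofNat (.const 1))))))))))))))))))

/-- Everything after the number of rounds has been determined. -/
def mainPart : Prog :=
  .seq divisions (.seq unitTable
    (.seq (.setReal 4 (.const 0) (.const 0) (.sub (.ofNat (.const 0)) (.ofNat (.const 1))))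
      (.loop 15 rounds round)))

/-- The randomized algorithm. -/
def program : Prog := .seq product (.seq roundsReal (.seq roundsNat mainPart))

end Alg

end RealRAM

/-! ### Correctness of sampling and contraction -/

/-- The commutative quaternion with components `f (4 i), …, f (4 i + 3)`. -/
def quatAt (f : ℕ → ℝ) (i : ℕ) : CQuat := ⟨f (4 * i), f (4 * i + 1), f (4 * i + 2), f (4 * i + 3)⟩

namespace CQuat

@[simp] theorem sum_re {ι : Type*} (s : Finset ι) (f : ι → CQuat) :
    (∑ i ∈ s, f i).re = ∑ i ∈ s, (f i).re := by
  classical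
  induction s using Finset.induction_on with
  | empty => rfl
  | insert a s ha ih => rw [Finset.sum_insert ha, Finset.sum_insert ha, add_re, ih]

@[simp] theorem sum_imI {ι : Type*} (s : Finset ι) (f : ι → CQuat) :
    (∑ i ∈ s, f i).imI = ∑ i ∈ s, (f i).imI := by
  classical
  induction s using Finset.induction_on with
  | empty => rfl
  | insert a s ha ih => rw [Finset.sum_insert ha, Finset.sum_insert ha, add_imI, ih]

@[simp] theorem sum_imJ {ι : Type*} (s : Finset ι) (f : ι → CQuat) :
    (∑ i ∈ s, f i).imJ = ∑ i ∈ s, (f i).imJ := by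
  classical
  induction s using Finset.induction_on with
  | empty => rfl
  | insert a s ha ih => rw [Finset.sum_insert ha, Finset.sum_insert ha, add_imJ, ih]

@[simp] theorem sum_imK {ι : Type*} (s : Finset ι) (f : ι → CQuat) :
    (∑ i ∈ s, f i).imK = ∑ i ∈ s, (f i).imK := by
  classical
  induction s using Finset.induction_on with
  | empty => rfl
  | insert a s ha ih => rw [Finset.sum_insert ha, Finset.sum_insert ha, add_imK, ih]

end CQuat

namespace RealRAM
namespace Alg

/-- The arrays which describe the format of the input. -/
structure Format (m tot : ℕ) (sz : ℕ → ℕ) (s : Store) : Prop where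
  ord : s.nat 0 0 = m + 2
  size : ∀ k, s.nat 1 k = sz k
  total : s.nat 2 0 = tot

theorem Format.of_nat_eq {m tot : ℕ} {sz : ℕ → ℕ} {s s' : Store} (h : Format m tot sz s)
    (h' : ∀ a < 3, s'.nat a = s.nat a) : Format m tot sz s' :=
  ⟨by rw [h' 0 (by norm_num), h.ord], fun k => by rw [h' 1 (by norm_num), h.size],
    by rw [h' 2 (by norm_num), h.total]⟩

theorem Format.exec {m tot : ℕ} {sz : ℕ → ℕ} {s : Store} (h : Format m tot sz s) (ω : ℕ → ℝ) (p : Prog)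
    (hp : ∀ a < 3, a ∉ p.natWrites) : Format m tot sz (exec ω p s) :=
  h.of_nat_eq fun a ha => exec_nat_of_notMem _ _ _ _ (hp a ha)

variable {m tot : ℕ} {sz : ℕ → ℕ} {s : Store}

/-- The machine computes square roots as `exp (log x / 2)`. The statement keeps this form, so the
null event of a zero sample needs no special treatment here. -/
theorem exec_sampleBlock (ω : ℕ → ℝ) (h : Format m tot sz s) (k : ℕ) (hk : s.nat 13 0 = k) :
    (exec ω sampleBlock s).drawn = s.drawn + 4 * sz k ∧
    (∀ p < 4 * sz k, (exec ω sampleBlock s).real 5 k p = ω (s.drawn + p) /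
      Real.exp (Real.log (∑ p ∈ Finset.range (4 * sz k), ω (s.drawn + p) ^ 2) / 2)) ∧
    ∀ x ≠ k, (exec ω sampleBlock s).real 5 x = s.real 5 x := by
  unfold sampleBlock
  rw [exec, exec]
  set s₁ := exec ω (.setReal 7 (.const 0) (.const 0) (.ofNat (.const 0))) s with hs₁
  have hdim : (dim K).eval s₁ = 4 * sz k := by
    simp [NExpr.eval, hs₁, exec, Store.setReal, Store.tick, hk, h.size]
  have key := loop_induction ω 14 (dim K) (.seq (.gauss 5 K J)
    (.setReal 7 (.const 0) (.const 0) (.add (cell 7) (.mul (.arr 5 K J) (.arr 5 K J))))) s₁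
    (fun t s' => s'.drawn = s.drawn + t ∧ (∀ p < t, s'.real 5 k p = ω (s.drawn + p)) ∧
      (∀ x ≠ k, s'.real 5 x = s.real 5 x) ∧
      s'.real 7 0 0 = ∑ p ∈ Finset.range t, ω (s.drawn + p) ^ 2) ?_ ?_ (fun _ _ _ _ h => h)
  · rw [hdim] at key
    set s₂ := exec ω (.loop 14 (dim K) (.seq (.gauss 5 K J)
      (.setReal 7 (.const 0) (.const 0) (.add (cell 7) (.mul (.arr 5 K J) (.arr 5 K J)))))) s₁
      with hs₂
    have hn : ∀ a, a ≠ 14 → s₂.nat a = s.nat a := fun a ha =>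
      exec_nat_of_notMem _ _ _ _ (by simpa [Prog.natWrites] using ha)
    obtain ⟨hd, hg, hx, h7⟩ := key
    obtain ⟨f1, f2⟩ := exec_fill ω 5 (.const 1) (dim K) K Q (.const 1)
      (.div (.arr 5 K Q) (sqrt (cell 7))) s₂ 1 (fun _ => 4 * sz k) (fun _ _ => 1) (fun _ _ => k)
      (fun _ q => q) (fun _ q _ => ω (s.drawn + q) /
      Real.exp (Real.log (∑ p ∈ Finset.range (4 * sz k), ω (s.drawn + p) ^ 2) / 2))
      (by norm_num) rfl
      (fun p _ q s' h' => by simp [NExpr.eval, h'.nat, hn, hk, h.size])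
      (fun p _ q _ s' h' => by simp [NExpr.eval, h'.nat, hn, hk, h'.nat_q])
      (fun p hp q _ p' hp' q' _ _ h' => ⟨by omega, h'⟩)
      (fun p hp q hq t _ s' h' ht hu => by
        -- Normalization is in place: entry `q` of row `k` is the target of the current pair only,
        -- so it still holds the raw variate.
        have := hu k q (fun p' hp' q' _ hne hc => by omega)
        simp [NExpr.eval, RExpr.eval, h'.nat, hn, hk, h'.nat_q, this, hg q hq, h'.real, h7])
    refine ⟨?_, fun p hp => ?_, fun x hx' => ?_⟩
    · rw [exec_drawn_of_gaussFree _ _ _ (by decide), hd]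
    · simpa using f1 0 (by norm_num) p hp
    · funext y
      rw [f2 x y (fun p hp q hq hc => hx' hc.1.symm), hx x hx']
  · simp [hs₁, exec, Store.setReal, Store.tick, RExpr.eval, NExpr.eval]
  · intro t ht s' hn hr hv hI
    obtain ⟨hd, hg, hx, h7⟩ := hI
    have h13 : s'.nat 13 0 = k := by
      rw [hn 13 (by norm_num) (by simp [Prog.natWrites])]; exact hk
    refine ⟨?_, ?_, ?_, ?_⟩
    · simp [exec, Store.setReal, Store.tick, hd, add_assoc]
    · intro p hp
      simp only [exec, Store.setReal, Store.tick, NExpr.eval, h13, hv, hd]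
      by_cases hpt : p = t
      · subst hpt; simp
      · simp [hpt, hg p (by omega)]
    · intro x hxk
      funext y
      simp [exec, Store.setReal, Store.tick, NExpr.eval, h13, hxk, hx x hxk]
    · simp [exec, Store.setReal, Store.tick, NExpr.eval, RExpr.eval, h13, hv, hd, h7,
        Finset.sum_range_succ, sq]

/-- Level `k` of the contraction occupies columns `4k, …, 4k+3` of array `1`. The routine reads that
level and writes one column of level `k + 1`, so reads and writes do not meet. Rows beyond `tot` are
never written. -/
theorem exec_contractComp (ω : ℕ → ℝ) (h : Format m tot sz s) (k : ℕ) (hk : s.nat 13 0 = k)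
    (c : ℕ) (e : RExpr) (g : ℕ → ℕ → ℝ)
    (hg : ∀ t i, ∀ s' : Store, (∀ b < 4, (vecComp b).eval s' = s.real 5 k (4 * i + b)) →
      (∀ b < 4, (tensorComp b).eval s' = s.real 1 (i + sz k * t) (4 * k + b)) → e.eval s' = g t i) :
    (∀ t < tot, (exec ω (contractComp c e) s).real 1 t (4 * (k + 1) + c) =
      ∑ i ∈ Finset.range (sz k), g t i) ∧
    (∀ x y, (tot ≤ x ∨ y ≠ 4 * (k + 1) + c) →
      (exec ω (contractComp c e) s).real 1 x y = s.real 1 x y) := by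
  obtain ⟨f1, f2⟩ := exec_fill ω 1 total (.const 1) P
    (.add (.mul (.const 4) (.add K (.const 1))) (.const c)) (size K) e s tot (fun _ => 1)
    (fun _ _ => sz k) (fun p _ => p) (fun _ _ => 4 * (k + 1) + c) (fun p _ t => g p t)
    (by norm_num) (by simp [NExpr.eval, h.total])
    (fun p _ q s' h' => by simp [NExpr.eval])
    (fun p _ q _ s' h' => by simp [NExpr.eval, h'.nat, hk, h.size, h'.nat_p])
    (fun p hp q hq p' hp' q' hq' h' _ => ⟨h', by omega⟩)
    (fun p hp q hq t _ s' h' ht hu => by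
      refine hg p t s' (fun b hb => ?_) (fun b hb => ?_)
      · simp [NExpr.eval, RExpr.eval, h'.nat, h'.real, hk, ht]
      · have := hu (t + sz k * p) (4 * k + b) (fun p' _ q' _ _ hc => by omega)
        simp [NExpr.eval, RExpr.eval, h'.nat, hk, ht, h.size, h'.nat_p, this])
  exact ⟨fun t ht => f1 t ht 0 (by norm_num), fun x y hxy => f2 x y fun p hp q _ hc => by omega⟩

/-- The four expressions are the components of the quaternion product. Each pass touches only its
own column of level `k + 1`, so the later passes still see level `k` as it was in `s`. -/
theorem exec_contractBlock (ω : ℕ → ℝ) (h : Format m tot sz s) (k : ℕ) (hk : s.nat 13 0 = k) :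
    (∀ t < tot, quatAt ((exec ω contractBlock s).real 1 t) (k + 1) =
      ∑ i ∈ Finset.range (sz k), quatAt (s.real 5 k) i * quatAt (s.real 1 (i + sz k * t)) k) ∧
    (∀ x y, (tot ≤ x ∨ y < 4 * (k + 1)) →
      (exec ω contractBlock s).real 1 x y = s.real 1 x y) := by
  unfold contractBlock
  rw [exec, exec, exec]
  have step : ∀ (s' : Store) (c : ℕ) (e : RExpr),
      (Format m tot sz s' ∧ s'.nat 13 0 = k ∧ s'.real 5 = s.real 5) →
      (Format m tot sz (exec ω (contractComp c e) s') ∧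
        (exec ω (contractComp c e) s').nat 13 0 = k ∧
        (exec ω (contractComp c e) s').real 5 = s.real 5) := by
    rintro s' c e ⟨h1, h2, h3⟩
    have hw : (contractComp c e).natWrites = [10, 11, 12] := rfl
    have hr : (contractComp c e).realWrites = [20, 20, 1] := rfl
    refine ⟨h1.exec ω _ (fun a ha => ?_), ?_, ?_⟩
    · rw [hw]; simp; omega
    · rw [exec_nat_of_notMem _ _ _ _ (by rw [hw]; simp), h2]
    · rw [exec_real_of_notMem _ _ _ _ (by rw [hr]; simp), h3]
  have hc₀ : Format m tot sz s ∧ s.nat 13 0 = k ∧ s.real 5 = s.real 5 := ⟨h, hk, rfl⟩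
  generalize he0 : (RExpr.sub (.add (.sub (.mul (vecComp 0) (tensorComp 0))
      (.mul (vecComp 1) (tensorComp 1))) (.mul (vecComp 2) (tensorComp 2)))
      (.mul (vecComp 3) (tensorComp 3))) = e0
  generalize he1 : (RExpr.add (.add (.add (.mul (vecComp 0) (tensorComp 1))
      (.mul (vecComp 1) (tensorComp 0))) (.mul (vecComp 2) (tensorComp 3)))
      (.mul (vecComp 3) (tensorComp 2))) = e1
  generalize he2 : (RExpr.sub (.sub (.add (.mul (vecComp 0) (tensorComp 2))
      (.mul (vecComp 2) (tensorComp 0))) (.mul (vecComp 1) (tensorComp 3)))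
      (.mul (vecComp 3) (tensorComp 1))) = e2
  generalize he3 : (RExpr.add (.add (.add (.mul (vecComp 0) (tensorComp 3))
      (.mul (vecComp 3) (tensorComp 0))) (.mul (vecComp 1) (tensorComp 2)))
      (.mul (vecComp 2) (tensorComp 1))) = e3
  set s₁ := exec ω (contractComp 0 e0) s with hs₁
  set s₂ := exec ω (contractComp 1 e1) s₁ with hs₂
  set s₃ := exec ω (contractComp 2 e2) s₂ with hs₃
  have hc₁ := step s 0 e0 hc₀
  rw [← hs₁] at hc₁
  have hc₂ := step s₁ 1 e1 hc₁
  rw [← hs₂] at hc₂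
  have hc₃ := step s₂ 2 e2 hc₂
  rw [← hs₃] at hc₃
  obtain ⟨a0, b0⟩ := exec_contractComp ω h k hk 0 e0
    (fun t i => (quatAt (s.real 5 k) i * quatAt (s.real 1 (i + sz k * t)) k).re)
    (fun t i s' hv ht => by
      rw [← he0]
      simp only [RExpr.eval] at hv ht ⊢
      rw [hv 0 (by norm_num), hv 1 (by norm_num), hv 2 (by norm_num), hv 3 (by norm_num),
        ht 0 (by norm_num), ht 1 (by norm_num), ht 2 (by norm_num), ht 3 (by norm_num)]
      simp [quatAt])
  rw [← hs₁] at a0 b0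
  obtain ⟨a1, b1⟩ := exec_contractComp ω hc₁.1 k hc₁.2.1 1 e1
    (fun t i => (quatAt (s.real 5 k) i * quatAt (s.real 1 (i + sz k * t)) k).imI)
    (fun t i s' hv ht => by
      rw [← he1]
      simp only [RExpr.eval] at hv ht ⊢
      rw [hv 0 (by norm_num), hv 1 (by norm_num), hv 2 (by norm_num), hv 3 (by norm_num),
        ht 0 (by norm_num), ht 1 (by norm_num), ht 2 (by norm_num), ht 3 (by norm_num)]
      simp only [hc₁.2.2]
      rw [b0 _ _ (Or.inr (by omega)), b0 _ _ (Or.inr (by omega)), b0 _ _ (Or.inr (by omega)),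
        b0 _ _ (Or.inr (by omega))]
      simp [quatAt])
  rw [← hs₂] at a1 b1
  obtain ⟨a2, b2⟩ := exec_contractComp ω hc₂.1 k hc₂.2.1 2 e2
    (fun t i => (quatAt (s.real 5 k) i * quatAt (s.real 1 (i + sz k * t)) k).imJ)
    (fun t i s' hv ht => by
      rw [← he2]
      simp only [RExpr.eval] at hv ht ⊢
      rw [hv 0 (by norm_num), hv 1 (by norm_num), hv 2 (by norm_num), hv 3 (by norm_num),
        ht 0 (by norm_num), ht 1 (by norm_num), ht 2 (by norm_num), ht 3 (by norm_num)]
      simp only [hc₂.2.2]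
      rw [b1 _ _ (Or.inr (by omega)), b1 _ _ (Or.inr (by omega)), b1 _ _ (Or.inr (by omega)),
        b1 _ _ (Or.inr (by omega)),
        b0 _ _ (Or.inr (by omega)), b0 _ _ (Or.inr (by omega)), b0 _ _ (Or.inr (by omega)),
        b0 _ _ (Or.inr (by omega))]
      simp [quatAt])
  rw [← hs₃] at a2 b2
  obtain ⟨a3, b3⟩ := exec_contractComp ω hc₃.1 k hc₃.2.1 3 e3
    (fun t i => (quatAt (s.real 5 k) i * quatAt (s.real 1 (i + sz k * t)) k).imK)
    (fun t i s' hv ht => by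
      rw [← he3]
      simp only [RExpr.eval] at hv ht ⊢
      rw [hv 0 (by norm_num), hv 1 (by norm_num), hv 2 (by norm_num), hv 3 (by norm_num),
        ht 0 (by norm_num), ht 1 (by norm_num), ht 2 (by norm_num), ht 3 (by norm_num)]
      simp only [hc₃.2.2]
      rw [b2 _ _ (Or.inr (by omega)), b2 _ _ (Or.inr (by omega)), b2 _ _ (Or.inr (by omega)),
        b2 _ _ (Or.inr (by omega)),
        b1 _ _ (Or.inr (by omega)), b1 _ _ (Or.inr (by omega)), b1 _ _ (Or.inr (by omega)),
        b1 _ _ (Or.inr (by omega)),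
        b0 _ _ (Or.inr (by omega)), b0 _ _ (Or.inr (by omega)), b0 _ _ (Or.inr (by omega)),
        b0 _ _ (Or.inr (by omega))]
      simp [quatAt])
  refine ⟨fun t ht => ?_, fun x y hxy => ?_⟩
  · ext
    · rw [CQuat.sum_re, ← a0 t ht]
      simp only [quatAt]
      rw [b3 _ _ (Or.inr (by omega)), b2 _ _ (Or.inr (by omega)), b1 _ _ (Or.inr (by omega))]
      rfl
    · rw [CQuat.sum_imI, ← a1 t ht]
      simp only [quatAt]
      rw [b3 _ _ (Or.inr (by omega)), b2 _ _ (Or.inr (by omega))]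
    · rw [CQuat.sum_imJ, ← a2 t ht]
      simp only [quatAt]
      rw [b3 _ _ (Or.inr (by omega))]
    · rw [CQuat.sum_imK, ← a3 t ht]
      rfl
  · rw [b3 _ _ (by omega), b2 _ _ (by omega), b1 _ _ (by omega), b0 _ _ (by omega)]

end Alg
end RealRAM

/-! ### Correctness of the linear algebra routines -/

/-- The matrix with the entries `f p q`. -/
def matOf (M N : ℕ) (f : ℕ → ℕ → ℝ) : Matrix (Fin M) (Fin N) ℝ := .of fun p q => f p q

/-- The vector with the entries `f p`. -/
def vecOf (N : ℕ) (f : ℕ → ℝ) : Fin N → ℝ := fun p => f p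

/-- Subtract from an orthogonal projection the projection to the image of the vector `c`. -/
def projUpdate {N : ℕ} (Q : Matrix (Fin N) (Fin N) ℝ) (c : Fin N → ℝ) :
    Matrix (Fin N) (Fin N) ℝ :=
  .of fun p q => Q p q - Q.mulVec c p * Q.mulVec c q / (Q.mulVec c ⬝ᵥ Q.mulVec c)

/-- The orthogonal projection to the complement of the first `t` columns of `S`. -/
def projMat {N : ℕ} (S : Matrix (Fin N) (Fin N) ℝ) : ℕ → Matrix (Fin N) (Fin N) ℝ
  | 0 => 1
  | t + 1 => if h : t < N then projUpdate (projMat S t) fun l => S l ⟨t, h⟩ else projMat S t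

/-- With truncated subtraction, `(p - q) + (q - p)` is the distance of `p` and `q`, so `1` minus it
vanishes as soon as they differ. -/
theorem cast_delta (p q : ℕ) : ((1 - (p - q + (q - p)) : ℕ) : ℝ) = if p = q then 1 else 0 := by
  split_ifs with h
  · subst h; simp
  · rw [Nat.sub_eq_zero_of_le (by omega)]; simp

namespace RealRAM
namespace Alg

variable {m tot : ℕ} {sz : ℕ → ℕ} {s : Store}

theorem eval_samp (h : Format m tot sz s) : samp.eval s = m := by
  simp [NExpr.eval, h.ord]

theorem eval_dim_left (h : Format m tot sz s) : (dim left).eval s = 4 * sz m := by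
  simp [NExpr.eval, h.ord, h.size]

theorem eval_dim_right (h : Format m tot sz s) : (dim right).eval s = 4 * sz (m + 1) := by
  simp [NExpr.eval, h.ord, h.size]

theorem _root_.RealRAM.FillState.format {a p q : ℕ} {s' : Store} (h' : FillState s a p q s')
    (h : Format m tot sz s) : Format m tot sz s' :=
  h.of_nat_eq fun b hb => h'.nat b (by omega) (by omega) (by omega)

/-- A real coordinate `p = 4 i + a` splits into entry `i` and unit `a`. As there is no integer
division, these are looked up in arrays `4` and `5`. -/
theorem exec_bilinear (ω : ℕ → ℝ) (h : Format m tot sz s) :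
    ∀ p < 4 * sz m, ∀ q < 4 * sz (m + 1), (exec ω bilinear s).real 8 p q =
      ∑ c ∈ Finset.range 4, s.real 1 (s.nat 4 p + sz m * s.nat 4 q) (4 * m + c) *
        s.real 6 c (4 * s.nat 5 p + s.nat 5 q) := by
  refine (exec_fill ω 8 (dim left) (dim right) P Q (.const 4) _ s (4 * sz m)
    (fun _ => 4 * sz (m + 1)) (fun _ _ => 4) (fun p _ => p) (fun _ q => q)
    (fun p q c => s.real 1 (s.nat 4 p + sz m * s.nat 4 q) (4 * m + c) *
        s.real 6 c (4 * s.nat 5 p + s.nat 5 q)) (by norm_num) (eval_dim_left h)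
    (fun p _ q s' h' => eval_dim_right (h'.format h))
    (fun p _ q _ s' h' => ⟨rfl, h'.nat_p, h'.nat_q⟩)
    (fun p hp q hq p' hp' q' hq' h1 h2 => ⟨h1, h2⟩)
    (fun p hp q hq t _ s' h' ht hu => ?_)).1
  have h'' := h'.format h
  simp [NExpr.eval, RExpr.eval, h'.nat_p, h'.nat_q, ht, h''.ord, h''.size, h'.nat, h'.real]

theorem exec_gram (ω : ℕ → ℝ) (h : Format m tot sz s) :
    matOf (4 * sz (m + 1)) (4 * sz (m + 1)) ((exec ω gram s).real 9) =
      (matOf (4 * sz m) (4 * sz (m + 1)) (s.real 8)).transpose *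
        matOf (4 * sz m) (4 * sz (m + 1)) (s.real 8) := by
  have key := (exec_fill ω 9 (dim right) (dim right) P Q (dim left)
    (.mul (.arr 8 T P) (.arr 8 T Q)) s (4 * sz (m + 1))
    (fun _ => 4 * sz (m + 1)) (fun _ _ => 4 * sz m) (fun p _ => p) (fun _ q => q)
    (fun p q l => s.real 8 l p * s.real 8 l q) (by norm_num) (eval_dim_right h)
    (fun p _ q s' h' => eval_dim_right (h'.format h))
    (fun p _ q _ s' h' => ⟨eval_dim_left (h'.format h), h'.nat_p, h'.nat_q⟩)
    (fun p hp q hq p' hp' q' hq' h1 h2 => ⟨h1, h2⟩)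
    (fun p hp q hq t _ s' h' ht hu => by
      simp [NExpr.eval, RExpr.eval, h'.nat_p, h'.nat_q, ht, h'.real])).1
  ext p q
  simp only [matOf, Matrix.of_apply, Matrix.mul_apply, Matrix.transpose_apply]
  rw [gram, key p p.2 q q.2, Finset.sum_range]

/-- Power `k` occupies the columns from `k` times the dimension up to the next multiple. Each new
power is written to a fresh range of columns, so all earlier powers remain available for the traces.
-/
theorem exec_powers (ω : ℕ → ℝ) (h : Format m tot sz s) :
    ∀ k ≤ 4 * sz (m + 1), matOf (4 * sz (m + 1)) (4 * sz (m + 1))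
      (fun p q => (exec ω powers s).real 10 p (4 * sz (m + 1) * k + q)) =
        matOf (4 * sz (m + 1)) (4 * sz (m + 1)) (s.real 9) ^ k := by
  unfold powers
  rw [exec]
  set s₁ := exec ω (fill 10 (dim right) (dim right) P Q (.const 1) (delta P Q)) s with hs₁
  have hn₁ : ∀ a, a ≠ 10 → a ≠ 11 → a ≠ 12 → s₁.nat a = s.nat a := fun a h1 h2 h3 =>
    exec_nat_of_notMem _ _ _ _ (by simp [fill, accumulate, Prog.natWrites, h1, h2, h3])
  have h₁ : Format m tot sz s₁ := h.of_nat_eq fun a ha => hn₁ a (by omega) (by omega) (by omega)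
  have hr₁ : s₁.real 9 = s.real 9 := exec_real_of_notMem _ _ _ _ (by decide)
  have key₁ := (exec_fill ω 10 (dim right) (dim right) P Q (.const 1) (delta P Q) s (4 * sz (m + 1))
    (fun _ => 4 * sz (m + 1)) (fun _ _ => 1) (fun p _ => p) (fun _ q => q)
    (fun p q _ => if p = q then 1 else 0) (by norm_num) (eval_dim_right h)
    (fun p _ q s' h' => eval_dim_right (h'.format h))
    (fun p _ q _ s' h' => ⟨rfl, h'.nat_p, h'.nat_q⟩)
    (fun p hp q hq p' hp' q' hq' h1 h2 => ⟨h1, h2⟩)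
    (fun p hp q hq t _ s' h' ht hu => by
      rw [← cast_delta]
      simp [NExpr.eval, RExpr.eval, h'.nat_p, h'.nat_q])).1
  rw [← hs₁] at key₁
  have key := loop_induction ω 14 (dim right) powerStep s₁
    (fun t s' => ∀ k ≤ t, matOf (4 * sz (m + 1)) (4 * sz (m + 1))
      (fun p q => s'.real 10 p (4 * sz (m + 1) * k + q)) =
        matOf (4 * sz (m + 1)) (4 * sz (m + 1)) (s.real 9) ^ k) ?_ ?_ (fun _ _ _ _ h => h)
  · rw [eval_dim_right h₁] at key
    exact key
  · intro k hk
    obtain rfl : k = 0 := by omega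
    ext p q
    simp only [matOf, Matrix.of_apply, pow_zero, Matrix.one_apply, Store.tick, mul_zero, zero_add]
    rw [key₁ p p.2 q q.2]
    simp [Fin.ext_iff]
  · intro t ht s₂ hn hr hv hI k hk
    rw [eval_dim_right h₁] at ht
    simp only [powerStep, fill, accumulate, Prog.natWrites, Prog.realWrites, List.nil_append, List.append_nil,
      List.cons_append, List.mem_cons, List.not_mem_nil, or_false, not_or] at hn hr
    have h₂ : Format m tot sz s₂ := h₁.of_nat_eq fun a ha =>
      hn a (by omega) ⟨by omega, by omega, by omega⟩
    have hr9 : s₂.real 9 = s.real 9 := by rw [hr 9 (by norm_num), hr₁]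
    have inj : ∀ k < t + 1, ∀ p < 4 * sz (m + 1), ∀ q < 4 * sz (m + 1),
        4 * sz (m + 1) * (t + 1) + p ≠ 4 * sz (m + 1) * k + q := by
      intro k hk p hp q hq he
      have : 4 * sz (m + 1) * (k + 1) ≤ 4 * sz (m + 1) * (t + 1) :=
        Nat.mul_le_mul_left _ (by omega)
      rw [mul_add, mul_one] at this
      omega
    obtain ⟨f1, f2⟩ := exec_fill ω 10 (dim right) (dim right)
      P (.add (.mul (dim right) (.add J (.const 1))) Q) (dim right)
      (.mul (.arr 10 P (.add (.mul (dim right) J) T)) (.arr 9 T Q)) s₂ (4 * sz (m + 1))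
      (fun _ => 4 * sz (m + 1)) (fun _ _ => 4 * sz (m + 1)) (fun p _ => p)
      (fun _ q => 4 * sz (m + 1) * (t + 1) + q)
      (fun p q l => s₂.real 10 p (4 * sz (m + 1) * t + l) * s.real 9 l q)
      (by norm_num) (eval_dim_right h₂)
      (fun p _ q s' h' => eval_dim_right (h'.format h₂))
      (fun p _ q _ s' h' => by
        have h'' := h'.format h₂
        simp [NExpr.eval, h''.ord, h''.size, h'.nat, hv, h'.nat_p, h'.nat_q])
      (fun p hp q hq p' hp' q' hq' h1 h2 => ⟨h1, by omega⟩)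
      (fun p hp q hq l hl s' h' hl' hu => by
        have h'' := h'.format h₂
        have := hu p (4 * sz (m + 1) * t + l) (fun p' hp' q' hq' _ hc =>
          inj t (by omega) q' hq' l hl hc.2)
        simp [NExpr.eval, RExpr.eval, h''.ord, h''.size, h'.nat, hv, h'.nat_p, h'.nat_q, hl', this,
          h'.real, hr9])
    rcases Nat.le_succ_iff.mp hk with hk' | rfl
    · rw [← hI k hk']
      ext p q
      simp only [matOf, Matrix.of_apply]
      exact f2 _ _ fun p' hp' q' hq' hc => inj k (by omega) q' hq' q q.2 hc.2
    · rw [pow_succ, ← hI t le_rfl]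
      ext p q
      simp only [matOf, Matrix.of_apply, Matrix.mul_apply]
      rw [powerStep, Nat.succ_eq_add_one, f1 p p.2 q q.2, Finset.sum_range]

theorem exec_traces (ω : ℕ → ℝ) (h : Format m tot sz s) :
    ∀ k ≤ 4 * sz (m + 1), (exec ω traces s).real 11 0 k = Matrix.trace (matOf (4 * sz (m + 1))
      (4 * sz (m + 1)) (fun p q => s.real 10 p (4 * sz (m + 1) * k + q))) := by
  have key := (exec_fill ω 11 (.const 1) (.add (dim right) (.const 1)) (.const 0) Q (dim right)
    (.arr 10 T (.add (.mul (dim right) Q) T)) s 1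
    (fun _ => 4 * sz (m + 1) + 1) (fun _ _ => 4 * sz (m + 1)) (fun _ _ => 0) (fun _ q => q)
    (fun p q l => s.real 10 l (4 * sz (m + 1) * q + l)) (by norm_num) rfl
    (fun p _ q s' h' => by
      have h'' := h'.format h
      simp [NExpr.eval, h''.ord, h''.size])
    (fun p _ q _ s' h' => ⟨eval_dim_right (h'.format h), rfl, h'.nat_q⟩)
    (fun p hp q hq p' hp' q' hq' h1 h2 => ⟨by omega, h2⟩)
    (fun p hp q hq t _ s' h' ht hu => by
      have h'' := h'.format h
      simp [NExpr.eval, RExpr.eval, h'.nat_q, ht, h'.real, h''.ord, h''.size])).1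
  intro k hk
  rw [traces, key 0 (by norm_num) k (by omega), Finset.sum_range]
  rfl

/-- Coefficients are produced from the top degree downwards. Each depends only on coefficients of
higher degree, which are never overwritten, so the recursion holds for the final contents of the
array. -/
theorem exec_coeffs (ω : ℕ → ℝ) (h : Format m tot sz s) :
    (exec ω coeffs s).real 12 0 (4 * sz (m + 1)) = 1 ∧
    ∀ k < 4 * sz (m + 1), (exec ω coeffs s).real 12 0 (4 * sz (m + 1) - (k + 1)) =
      (0 - ∑ i ∈ Finset.range (k + 1), (exec ω coeffs s).real 12 0 (4 * sz (m + 1) - k + i) *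
        s.real 11 0 (i + 1)) / (k + 1) := by
  unfold coeffs
  rw [exec]
  set s₁ := exec ω (.setReal 12 (.const 0) (dim right) (.ofNat (.const 1))) s with hs₁
  have h₁ : Format m tot sz s₁ := h.of_nat_eq fun a ha => rfl
  have h12 : s₁.real 12 0 (4 * sz (m + 1)) = 1 := by
    rw [hs₁, exec, eval_dim_right h]
    simp [Store.setReal, Store.tick, NExpr.eval, RExpr.eval]
  have h11 : s₁.real 11 = s.real 11 := exec_real_of_notMem _ _ _ _ (by decide)
  have key := loop_induction ω 14 (dim right) coeffStep s₁
    (fun t s' => s'.real 12 0 (4 * sz (m + 1)) = 1 ∧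
      ∀ k < t, s'.real 12 0 (4 * sz (m + 1) - (k + 1)) =
      (0 - ∑ i ∈ Finset.range (k + 1), s'.real 12 0 (4 * sz (m + 1) - k + i) *
        s.real 11 0 (i + 1)) / (k + 1)) ?_ ?_ (fun _ _ _ _ h => h)
  · rw [eval_dim_right h₁] at key
    exact key
  · exact ⟨h12, fun k hk => absurd hk (Nat.not_lt_zero _)⟩
  rintro t ht s₂ hn hr hv ⟨hI₀, hI⟩
  rw [eval_dim_right h₁] at ht
  simp only [coeffStep, accumulate, Prog.natWrites, Prog.realWrites, List.nil_append, List.append_nil,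
    List.cons_append, List.mem_cons, List.not_mem_nil, or_false, not_or] at hn hr
  have h₂ : Format m tot sz s₂ := h₁.of_nat_eq fun a ha => hn a (by omega) (by omega)
  have hr11 : s₂.real 11 = s.real 11 := by rw [hr 11 (by norm_num), h11]
  have hacc := exec_accumulate ω (.sub (dim right) (.sub (dim right) (.add J (.const 1))))
    (.mul (.arr 12 (.const 0) (.add (.sub (dim right) J) T))
        (.arr 11 (.const 0) (.add T (.const 1)))) s₂
    (fun i => s₂.real 12 0 (4 * sz (m + 1) - t + i) * s.real 11 0 (i + 1))
    (fun i _ s' hn' hr' hi => by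
      have h'' : Format m tot sz s' := h₂.of_nat_eq fun a ha => hn' a (by omega)
      simp [NExpr.eval, RExpr.eval, h''.ord, h''.size, hn', hr', hv, hi, hr11])
  -- The length `t + 1` is written as this double difference in the program so that `NExpr.heads`
  -- sees only the array of sizes and not the loop counter, as `exec_time_le` requires.
  have hle : 4 * sz (m + 1) - (4 * sz (m + 1) - (t + 1)) = t + 1 := by omega
  have hb : (NExpr.sub (dim right) (.sub (dim right) (.add J (.const 1)))).eval s₂ = t + 1 := by
    simp [NExpr.eval, h₂.ord, h₂.size, hv, hle]
  rw [hb] at hacc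
  rw [coeffStep, exec]
  set s₃ := exec ω (accumulate (.sub (dim right) (.sub (dim right) (.add J (.const 1))))
    (.mul (.arr 12 (.const 0) (.add (.sub (dim right) J) T))
        (.arr 11 (.const 0) (.add T (.const 1))))) s₂ with hs₃
  have h₃ : Format m tot sz s₃ := h₂.exec _ _ (by decide)
  have hv₃ : s₃.nat 14 0 = t := by rw [hs₃, exec_nat_of_notMem _ _ _ _ (by decide), hv]
  have hr₃ : s₃.real 12 = s₂.real 12 := exec_real_of_notMem _ _ _ _ (by decide)
  have hfin : ∀ y, (exec ω (.setReal 12 (.const 0) (.sub (dim right) (.add J (.const 1)))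
      (.div (.sub (.ofNat (.const 0)) (cell 20)) (.ofNat (.add J (.const 1))))) s₃).real 12 0 y =
      if y = 4 * sz (m + 1) - (t + 1) then
        (0 - ∑ i ∈ Finset.range (t + 1), s₂.real 12 0 (4 * sz (m + 1) - t + i) *
          s.real 11 0 (i + 1)) / (t + 1) else s₂.real 12 0 y := by
    intro y
    simp [exec, Store.setReal, Store.tick, NExpr.eval, RExpr.eval, h₃.ord, h₃.size, hv₃, hr₃, hacc]
  refine ⟨by rw [hfin, if_neg (by omega), hI₀], fun k hk => ?_⟩
  have hs : ∑ i ∈ Finset.range (k + 1), s₂.real 12 0 (4 * sz (m + 1) - k + i) *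
          s.real 11 0 (i + 1) = ∑ i ∈ Finset.range (k + 1), (exec ω
            (.setReal 12 (.const 0) (.sub (dim right) (.add J (.const 1)))
            (.div (.sub (.ofNat (.const 0)) (cell 20)) (.ofNat (.add J (.const 1)))))
            s₃).real 12 0 (4 * sz (m + 1) - k + i) * s.real 11 0 (i + 1) :=
    Finset.sum_congr rfl fun i _ => by rw [hfin, if_neg (by omega)]
  rw [← hs, hfin]
  split_ifs with hc
  · obtain rfl : k = t := by omega
    rfl
  · exact hI k (by omega)

theorem exec_eigenvalue (ω : ℕ → ℝ) (h : Format m tot sz s) :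
    (exec ω eigenvalue s).real 13 0 0 = largestRoot (4 * sz (m + 1) + 1) (s.real 12 0) := by
  simp [eigenvalue, exec, Store.setReal, Store.tick, NExpr.eval, h.ord, h.size]

/-- Array `15` receives the projected column and array `16` its squared norm. Both are computed
before array `14` changes, so the rank-one correction uses the old projection throughout. -/
theorem exec_projectStep (ω : ℕ → ℝ) (h : Format m tot sz s) (t : ℕ) (hv : s.nat 14 0 = t)
    (ht : t < 4 * sz (m + 1)) (S : Matrix (Fin (4 * sz (m + 1))) (Fin (4 * sz (m + 1))) ℝ)
    (hS : S = s.real 13 0 0 • 1 - matOf _ _ (s.real 9)) :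
    matOf (4 * sz (m + 1)) (4 * sz (m + 1)) ((exec ω projectStep s).real 14) =
      projUpdate (matOf _ _ (s.real 14)) fun l => S l ⟨t, ht⟩ := by
  unfold projectStep
  rw [exec, exec]
  set Q₀ := matOf (4 * sz (m + 1)) (4 * sz (m + 1)) (s.real 14) with hQ₀
  set c : Fin (4 * sz (m + 1)) → ℝ := fun l => S l ⟨t, ht⟩ with hc
  have key₁ := (exec_fill ω 15 (.const 1) (dim right) (.const 0) Q (dim right)
    (.mul (.arr 14 Q T) (.sub (.mul (cell 13) (delta T J)) (.arr 9 T J))) s 1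
    (fun _ => 4 * sz (m + 1)) (fun _ _ => 4 * sz (m + 1)) (fun _ _ => 0) (fun _ q => q)
    (fun _ q l => s.real 14 q l * (s.real 13 0 0 * (if l = t then 1 else 0) - s.real 9 l t))
    (by norm_num) rfl
    (fun p _ q s' h' => eval_dim_right (h'.format h))
    (fun p _ q _ s' h' => ⟨eval_dim_right (h'.format h), rfl, h'.nat_q⟩)
    (fun p hp q hq p' hp' q' hq' h1 h2 => ⟨by omega, h2⟩)
    (fun p hp q hq l _ s' h' hl hu => by
      rw [← cast_delta]
      simp [NExpr.eval, RExpr.eval, h'.nat_q, hl, h'.nat, h'.real, hv])).1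
  set s₁ := exec ω (fill 15 (.const 1) (dim right) (.const 0) Q (dim right)
    (.mul (.arr 14 Q T) (.sub (.mul (cell 13) (delta T J)) (.arr 9 T J)))) s with hs₁
  have hw : ∀ p : Fin (4 * sz (m + 1)), s₁.real 15 0 p = Q₀.mulVec c p := by
    intro p
    rw [key₁ 0 (by norm_num) p p.2, Finset.sum_range]
    simp only [Matrix.mulVec, dotProduct, hQ₀, hc, hS, matOf, Matrix.of_apply, Matrix.sub_apply,
      Matrix.smul_apply, Matrix.one_apply, Fin.ext_iff, smul_eq_mul]
  have h₁ : Format m tot sz s₁ := h.exec _ _ (by decide)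
  have key₂ := (exec_fill ω 16 (.const 1) (.const 1) (.const 0) (.const 0) (dim right)
    (.mul (.arr 15 (.const 0) T) (.arr 15 (.const 0) T)) s₁ 1
    (fun _ => 1) (fun _ _ => 4 * sz (m + 1)) (fun _ _ => 0) (fun _ _ => 0)
    (fun _ _ l => s₁.real 15 0 l * s₁.real 15 0 l)
    (by norm_num) rfl
    (fun p _ q s' h' => rfl)
    (fun p _ q _ s' h' => ⟨eval_dim_right (h'.format h₁), rfl, rfl⟩)
    (fun p hp q hq p' hp' q' hq' h1 h2 => ⟨by omega, by omega⟩)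
    (fun p hp q hq l _ s' h' hl hu => by
      simp [NExpr.eval, RExpr.eval, hl, h'.real])).1
  set s₂ := exec ω (fill 16 (.const 1) (.const 1) (.const 0) (.const 0) (dim right)
    (.mul (.arr 15 (.const 0) T) (.arr 15 (.const 0) T))) s₁ with hs₂
  have h₂ : Format m tot sz s₂ := h₁.exec _ _ (by decide)
  have hww : s₂.real 16 0 0 = Q₀.mulVec c ⬝ᵥ Q₀.mulVec c := by
    rw [key₂ 0 (by norm_num) 0 (by norm_num), Finset.sum_range]
    simp only [hw, dotProduct]
  have h14 : s₂.real 14 = s.real 14 := by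
    rw [hs₂, exec_real_of_notMem _ _ _ _ (by decide), hs₁, exec_real_of_notMem _ _ _ _ (by decide)]
  have hw₂ : ∀ p : Fin (4 * sz (m + 1)), s₂.real 15 0 p = Q₀.mulVec c p := by
    intro p
    rw [hs₂, exec_real_of_notMem _ _ _ _ (by decide), hw]
  have hnn : 0 ≤ Q₀.mulVec c ⬝ᵥ Q₀.mulVec c := Finset.sum_nonneg fun i _ => mul_self_nonneg _
  rw [exec]
  split_ifs with hif
  -- The column already lies in the kernel of the projection. The skipped update agrees with
  -- `projUpdate` because division by zero gives zero.
  · have h0 : Q₀.mulVec c ⬝ᵥ Q₀.mulVec c = 0 := by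
      have : s₂.real 16 0 0 ≤ 0 := by simpa [RExpr.eval, NExpr.eval] using hif
      exact le_antisymm (hww ▸ this) hnn
    ext p q
    simp only [projUpdate, Matrix.of_apply, h0, div_zero, sub_zero]
    simp only [exec, Store.tick, h14, hQ₀]
  · set s₃ := s₂.tick ((cell 16).cost + (RExpr.ofNat (.const 0)).cost + 1) with hs₃
    have h₃ : Format m tot sz s₃ := h₂.of_nat_eq fun _ _ => rfl
    have key₃ := (exec_fill ω 14 (dim right) (dim right) P Q (.const 1)
      (.sub (.arr 14 P Q) (.div (.mul (.arr 15 (.const 0) P) (.arr 15 (.const 0) Q)) (cell 16))) s₃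
      (4 * sz (m + 1)) (fun _ => 4 * sz (m + 1)) (fun _ _ => 1) (fun p _ => p) (fun _ q => q)
      (fun p q _ => s.real 14 p q - s₂.real 15 0 p * s₂.real 15 0 q / s₂.real 16 0 0)
      (by norm_num) (eval_dim_right h₃)
      (fun p _ q s' h' => eval_dim_right (h'.format h₃))
      (fun p _ q _ s' h' => ⟨rfl, h'.nat_p, h'.nat_q⟩)
      (fun p hp q hq p' hp' q' hq' h1 h2 => ⟨h1, h2⟩)
      (fun p hp q hq l _ s' h' hl hu => by
        have := hu p q (fun p' _ q' _ hne hc => by omega)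
        simp [NExpr.eval, RExpr.eval, h'.nat_p, h'.nat_q, h'.real, this]
        simp [hs₃, Store.tick, h14])).1
    ext p q
    simp only [matOf, Matrix.of_apply, projUpdate]
    rw [key₃ p p.2 q q.2]
    simp [hw₂, hww, hQ₀, matOf]

theorem exec_project (ω : ℕ → ℝ) (h : Format m tot sz s) :
    matOf (4 * sz (m + 1)) (4 * sz (m + 1)) ((exec ω project s).real 14) =
      projMat (s.real 13 0 0 • 1 - matOf _ _ (s.real 9)) (4 * sz (m + 1)) := by
  unfold project
  rw [exec]
  set s₁ := exec ω (fill 14 (dim right) (dim right) P Q (.const 1) (delta P Q)) s with hs₁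
  have h₁ : Format m tot sz s₁ := h.exec _ _ (by decide)
  have hr9 : s₁.real 9 = s.real 9 := exec_real_of_notMem _ _ _ _ (by decide)
  have hr13 : s₁.real 13 = s.real 13 := exec_real_of_notMem _ _ _ _ (by decide)
  have key₁ := (exec_fill ω 14 (dim right) (dim right) P Q (.const 1) (delta P Q) s (4 * sz (m + 1))
    (fun _ => 4 * sz (m + 1)) (fun _ _ => 1) (fun p _ => p) (fun _ q => q)
    (fun p q _ => if p = q then 1 else 0) (by norm_num) (eval_dim_right h)
    (fun p _ q s' h' => eval_dim_right (h'.format h))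
    (fun p _ q _ s' h' => ⟨rfl, h'.nat_p, h'.nat_q⟩)
    (fun p hp q hq p' hp' q' hq' h1 h2 => ⟨h1, h2⟩)
    (fun p hp q hq t _ s' h' ht hu => by
      rw [← cast_delta]
      simp [NExpr.eval, RExpr.eval, h'.nat_p, h'.nat_q])).1
  rw [← hs₁] at key₁
  have key := loop_induction ω 14 (dim right) projectStep s₁
    (fun t s' => matOf (4 * sz (m + 1)) (4 * sz (m + 1)) (s'.real 14) =
      projMat (s.real 13 0 0 • 1 - matOf _ _ (s.real 9)) t) ?_ ?_ (fun _ _ _ _ h => h)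
  · rw [eval_dim_right h₁] at key
    exact key
  · ext p q
    simp only [matOf, Matrix.of_apply, Matrix.one_apply, Store.tick, projMat]
    rw [key₁ p p.2 q q.2]
    simp [Fin.ext_iff]
  · intro t ht s₂ hn hr hv hI
    rw [eval_dim_right h₁] at ht
    have h₂ : Format m tot sz s₂ := h₁.of_nat_eq fun a ha => hn a (by omega) (by
      have : projectStep.natWrites = [10, 11, 12, 10, 11, 12, 10, 11, 12] := rfl
      rw [this]; simp; omega)
    rw [exec_projectStep ω h₂ t hv ht _ rfl, hI, projMat, dif_pos ht, hr 9 (by decide),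
      hr 13 (by decide), hr9, hr13]

/-- The loop keeps the last index with positive diagonal entry; any such index would do. -/
theorem exec_pick (ω : ℕ → ℝ) (h : Format m tot sz s)
    (hpos : ∃ j < 4 * sz (m + 1), 0 < s.real 14 j j) :
    (exec ω pick s).nat 6 0 < 4 * sz (m + 1) ∧
      0 < s.real 14 ((exec ω pick s).nat 6 0) ((exec ω pick s).nat 6 0) := by
  unfold pick
  have key := loop_induction ω 14 (dim right) (.ifReal (.arr 14 J J) (.ofNat (.const 0)) .skip
    (.setNat 6 (.const 0) J)) s
    (fun t s' => (∃ j < t, 0 < s.real 14 j j) → s'.nat 6 0 < 4 * sz (m + 1) ∧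
      0 < s.real 14 (s'.nat 6 0) (s'.nat 6 0)) (by simp) ?_
      (fun t s' w k hh hj => by simpa [Store.setNat, Store.tick] using hh hj)
  · rw [eval_dim_right h] at key
    exact key hpos
  · intro t ht s' hn hr hv hI hj
    rw [eval_dim_right h] at ht
    have h14 : s'.real 14 = s.real 14 := hr 14 (by decide)
    rw [exec]
    by_cases hc : s.real 14 t t ≤ 0
    · rw [if_pos (by simpa [RExpr.eval, NExpr.eval, hv, h14] using hc)]
      refine hI ?_
      obtain ⟨j, hj, hj'⟩ := hj
      rcases Nat.lt_succ_iff_lt_or_eq.mp hj with h' | rfl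
      · exact ⟨j, h', hj'⟩
      · exact absurd hj' (not_lt.mpr hc)
    · rw [if_neg (by simpa [RExpr.eval, NExpr.eval, hv, h14] using hc)]
      simp only [exec, Store.setNat, Store.tick, NExpr.eval, hv]
      simpa using ⟨ht, not_le.mp hc⟩

theorem exec_rightVec (ω : ℕ → ℝ) (h : Format m tot sz s) :
    (∀ q < 4 * sz (m + 1), (exec ω rightVec s).real 5 (m + 1) q = s.real 14 q (s.nat 6 0) /
      Real.exp (Real.log (s.real 14 (s.nat 6 0) (s.nat 6 0)) / 2)) ∧
    ∀ x ≠ m + 1, (exec ω rightVec s).real 5 x = s.real 5 x := by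
  unfold rightVec
  obtain ⟨f1, f2⟩ := exec_fill ω 5 (.const 1) (dim right) right Q (.const 1)
    (.div (.arr 14 Q (.arr 6 (.const 0)))
      (sqrt (.arr 14 (.arr 6 (.const 0)) (.arr 6 (.const 0))))) s 1
    (fun _ => 4 * sz (m + 1)) (fun _ _ => 1) (fun _ _ => m + 1) (fun _ q => q)
    (fun _ q _ => s.real 14 q (s.nat 6 0) /
      Real.exp (Real.log (s.real 14 (s.nat 6 0) (s.nat 6 0)) / 2)) (by norm_num) rfl
    (fun p _ q s' h' => eval_dim_right (h'.format h))
    (fun p _ q _ s' h' => by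
      have h'' := h'.format h
      simp [NExpr.eval, h''.ord, h'.nat_q])
    (fun p hp q hq p' hp' q' hq' h1 h2 => ⟨by omega, h2⟩)
    (fun p hp q hq l _ s' h' hl hu => by
      simp [NExpr.eval, RExpr.eval, h'.nat_q, h'.real, h'.nat])
  refine ⟨fun q hq => ?_, fun x hx => ?_⟩
  · simpa using f1 0 (by norm_num) q hq
  · funext y
    exact f2 x y fun p hp q hq hc => hx hc.1.symm

theorem exec_image (ω : ℕ → ℝ) (h : Format m tot sz s) :
    vecOf (4 * sz m) ((exec ω image s).real 17 0) =
      (matOf (4 * sz m) (4 * sz (m + 1)) (s.real 8)).mulVec (vecOf _ (s.real 5 (m + 1))) ∧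
    (exec ω image s).real 18 0 0 = vecOf (4 * sz m) ((exec ω image s).real 17 0) ⬝ᵥ
      vecOf (4 * sz m) ((exec ω image s).real 17 0) := by
  unfold image
  rw [exec]
  have key₁ := (exec_fill ω 17 (.const 1) (dim left) (.const 0) Q (dim right)
    (.mul (.arr 8 Q T) (.arr 5 right T)) s 1
    (fun _ => 4 * sz m) (fun _ _ => 4 * sz (m + 1)) (fun _ _ => 0) (fun _ q => q)
    (fun _ q l => s.real 8 q l * s.real 5 (m + 1) l) (by norm_num) rfl
    (fun p _ q s' h' => eval_dim_left (h'.format h))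
    (fun p _ q _ s' h' => ⟨eval_dim_right (h'.format h), rfl, h'.nat_q⟩)
    (fun p hp q hq p' hp' q' hq' h1 h2 => ⟨by omega, h2⟩)
    (fun p hp q hq l _ s' h' hl hu => by
      have h'' := h'.format h
      simp [NExpr.eval, RExpr.eval, h'.nat_q, h'.real, h''.ord, hl])).1
  set s₁ := exec ω (fill 17 (.const 1) (dim left) (.const 0) Q (dim right)
    (.mul (.arr 8 Q T) (.arr 5 right T))) s with hs₁
  have h₁ : Format m tot sz s₁ := h.exec _ _ (by decide)
  have key₂ := (exec_fill ω 18 (.const 1) (.const 1) (.const 0) (.const 0) (dim left)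
    (.mul (.arr 17 (.const 0) T) (.arr 17 (.const 0) T)) s₁ 1
    (fun _ => 1) (fun _ _ => 4 * sz m) (fun _ _ => 0) (fun _ _ => 0)
    (fun _ _ l => s₁.real 17 0 l * s₁.real 17 0 l)
    (by norm_num) rfl
    (fun p _ q s' h' => rfl)
    (fun p _ q _ s' h' => ⟨eval_dim_left (h'.format h₁), rfl, rfl⟩)
    (fun p hp q hq p' hp' q' hq' h1 h2 => ⟨by omega, by omega⟩)
    (fun p hp q hq l _ s' h' hl hu => by
      simp [NExpr.eval, RExpr.eval, hl, h'.real])).1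
  refine ⟨?_, ?_⟩
  · rw [exec_real_of_notMem _ _ _ _ (by decide)]
    ext q
    rw [vecOf, key₁ 0 (by norm_num) q q.2, Finset.sum_range]
    rfl
  · rw [key₂ 0 (by norm_num) 0 (by norm_num), exec_real_of_notMem _ _ s₁ 17 (by decide),
      Finset.sum_range]
    rfl

theorem exec_leftVec (ω : ℕ → ℝ) (h : Format m tot sz s) :
    (∀ q < 4 * sz m, (exec ω leftVec s).real 5 m q = if s.real 18 0 0 ≤ 0 then
      (if q = 0 then 1 else 0) else s.real 17 0 q / Real.exp (Real.log (s.real 18 0 0) / 2)) ∧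
    ∀ x ≠ m, (exec ω leftVec s).real 5 x = s.real 5 x := by
  unfold leftVec
  have aux : ∀ (s₁ : Store) (f : RExpr) (g : ℕ → ℝ), Format m tot sz s₁ → s₁.real = s.real →
      (∀ q s', FillState s₁ 5 0 q s' → f.eval s' = g q) →
      (∀ q < 4 * sz m, (exec ω (fill 5 (.const 1) (dim left) left Q (.const 1) f) s₁).real 5 m q =
        g q) ∧
      ∀ x ≠ m, (exec ω (fill 5 (.const 1) (dim left) left Q (.const 1) f) s₁).real 5 x =
        s.real 5 x := by
    intro s₁ f g h₁ hr hf
    obtain ⟨f1, f2⟩ := exec_fill ω 5 (.const 1) (dim left) left Q (.const 1) f s₁ 1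
      (fun _ => 4 * sz m) (fun _ _ => 1) (fun _ _ => m) (fun _ q => q)
      (fun _ q _ => g q) (by norm_num) rfl
      (fun p _ q s' h' => eval_dim_left (h'.format h₁))
      (fun p _ q _ s' h' => ⟨rfl, eval_samp (h'.format h₁), h'.nat_q⟩)
      (fun p hp q hq p' hp' q' hq' h1 h2 => ⟨by omega, h2⟩)
      (fun p hp q hq l _ s' h' hl hu => by
        obtain rfl : p = 0 := by omega
        exact hf q s' h')
    refine ⟨fun q hq => ?_, fun x hx => ?_⟩
    · simpa using f1 0 (by norm_num) q hq
    · funext y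
      rw [f2 x y fun p hp q hq hc => hx hc.1.symm, hr]
  rw [exec]
  by_cases hc : s.real 18 0 0 ≤ 0
  · rw [if_pos (by simpa [RExpr.eval, NExpr.eval] using hc)]
    simp only [hc, if_true]
    refine aux _ _ _ (h.of_nat_eq fun _ _ => rfl) rfl fun q s' h' => ?_
    rw [← cast_delta]
    simp [RExpr.eval, NExpr.eval, h'.nat_q]
  · rw [if_neg (by simpa [RExpr.eval, NExpr.eval] using hc)]
    simp only [hc, if_false]
    refine aux _ _ _ (h.of_nat_eq fun _ _ => rfl) rfl fun q s' h' => ?_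
    simp [RExpr.eval, NExpr.eval, h'.nat_q, h'.real]
    simp [Store.tick]

theorem exec_value (ω : ℕ → ℝ) (h : Format m tot sz s) :
    (exec ω value s).real 19 0 0 =
      vecOf (4 * sz m) (s.real 5 m) ⬝ᵥ vecOf (4 * sz m) (s.real 17 0) := by
  have key := (exec_fill ω 19 (.const 1) (.const 1) (.const 0) (.const 0) (dim left)
    (.mul (.arr 5 left T) (.arr 17 (.const 0) T)) s 1
    (fun _ => 1) (fun _ _ => 4 * sz m) (fun _ _ => 0) (fun _ _ => 0)
    (fun _ _ l => s.real 5 m l * s.real 17 0 l)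
    (by norm_num) rfl
    (fun p _ q s' h' => rfl)
    (fun p _ q _ s' h' => ⟨eval_dim_left (h'.format h), rfl, rfl⟩)
    (fun p hp q hq p' hp' q' hq' h1 h2 => ⟨by omega, by omega⟩)
    (fun p hp q hq l _ s' h' hl hu => by
      have h'' := h'.format h
      simp [NExpr.eval, RExpr.eval, hl, h'.real, h''.ord])).1
  rw [value, key 0 (by norm_num) 0 (by norm_num), Finset.sum_range]
  rfl

end Alg
end RealRAM

/-! ## The largest eigenvalue from traces of powers -/

theorem Matrix.IsHermitian.trace_pow_eq_sum_eigenvalues {N : ℕ} {A : Matrix (Fin N) (Fin N) ℝ}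
    (hA : A.IsHermitian) (k : ℕ) : (A ^ k).trace = ∑ i, hA.eigenvalues i ^ k := by
  conv_lhs => rw [hA.spectral_theorem, ← map_pow, Unitary.conjStarAlgAut_apply, Matrix.trace_mul_comm,
    ← mul_assoc]
  simp [Matrix.diagonal_pow, Matrix.trace_diagonal]

/-- Newton's identities express `k e_k` through lower elementary symmetric functions and power sums.
The recursion for `b` is the same one with signs absorbed and the division by `k` carried out, so
strong induction identifies the two. -/
theorem newton_coeff_eq_esymm {N : ℕ} (μ : Fin N → ℝ) (b tr : ℕ → ℝ) (h0 : b N = 1)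
    (htr : ∀ k ≤ N, tr k = ∑ i, μ i ^ k)
    (hb : ∀ k < N, b (N - (k + 1)) =
      (0 - ∑ i ∈ Finset.range (k + 1), b (N - k + i) * tr (i + 1)) / (k + 1)) :
    ∀ k ≤ N, b (N - k) = (-1) ^ k * (Finset.univ.val.map μ).esymm k := by
  have hnewton : ∀ k : ℕ, (k : ℝ) * (Finset.univ.val.map μ).esymm k = (-1) ^ (k + 1) *
      ∑ a ∈ Finset.HasAntidiagonal.antidiagonal k with a.1 < k, (-1) ^ a.1 * (Finset.univ.val.map μ).esymm a.1 *
        ∑ i, μ i ^ a.2 := by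
    intro k
    have := congrArg (MvPolynomial.aeval μ) (MvPolynomial.mul_esymm_eq_sum (Fin N) ℝ k)
    simp only [map_mul, map_pow, map_sum, map_neg, map_one, map_natCast, MvPolynomial.psum,
      MvPolynomial.aeval_X, MvPolynomial.aeval_esymm_eq_multiset_esymm] at this
    exact this
  intro k
  induction k using Nat.strong_induction_on with
  | _ k ih =>
    intro hk
    rcases k with _ | k
    · simp only [Nat.sub_zero, h0, pow_zero, one_mul, Multiset.esymm, Multiset.powersetCard_zero_left,
        Multiset.map_singleton, Multiset.prod_zero, Multiset.sum_singleton]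
    · rw [hb k (by omega)]
      have h1 := hnewton (k + 1)
      -- The antidiagonal pairs are `(k - i, i + 1)`. Reversing the order of summation turns one sum
      -- into the other.
      have h2 : ∑ a ∈ Finset.HasAntidiagonal.antidiagonal (k + 1) with a.1 < k + 1,
          (-1 : ℝ) ^ a.1 * (Finset.univ.val.map μ).esymm a.1 * ∑ i, μ i ^ a.2 =
          ∑ i ∈ Finset.range (k + 1), b (N - k + i) * tr (i + 1) := by
        rw [Finset.sum_filter, Finset.Nat.sum_antidiagonal_eq_sum_range_succ_mk,
          Finset.sum_range_succ]
        simp only [lt_self_iff_false, if_false, add_zero]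
        rw [← Finset.sum_range_reflect]
        refine Finset.sum_congr rfl fun i hi => ?_
        rw [Finset.mem_range] at hi
        rw [if_pos (by omega), htr (i + 1) (by omega), show N - k + i = N - (k - i) by omega,
          ih (k - i) (by omega) (by omega)]
        rw [show k + 1 - 1 - i = k - i by omega, show k + 1 - (k - i) = i + 1 by omega]
      rw [h2] at h1
      have hk1 : ((k : ℝ) + 1) ≠ 0 := by positivity
      push_cast at h1
      rw [div_eq_iff hk1]
      have hsq : ((-1 : ℝ) ^ (k + 1)) * (-1) ^ (k + 1) = 1 := by
        rw [← mul_pow]; simp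
      have h3 : ((-1 : ℝ) ^ (k + 1 + 1)) * (-1) ^ (k + 1) = -1 := by
        rw [pow_succ, mul_right_comm, hsq]; ring
      calc _ = ((-1 : ℝ) ^ (k + 1 + 1)) * (-1) ^ (k + 1) *
            ∑ i ∈ Finset.range (k + 1), b (N - k + i) * tr (i + 1) := by rw [h3]; ring
        _ = (-1) ^ (k + 1) * (((k : ℝ) + 1) * (Finset.univ.val.map μ).esymm (k + 1)) := by
            rw [h1]; ring
        _ = _ := by ring

/-- Vieta: the coefficients are the signed elementary symmetric functions of the `μ i`. -/
theorem newton_poly_eq_prod {N : ℕ} (μ : Fin N → ℝ) (b tr : ℕ → ℝ) (h0 : b N = 1)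
    (htr : ∀ k ≤ N, tr k = ∑ i, μ i ^ k)
    (hb : ∀ k < N, b (N - (k + 1)) =
      (0 - ∑ i ∈ Finset.range (k + 1), b (N - k + i) * tr (i + 1)) / (k + 1)) (x : ℝ) :
    ∑ t ∈ Finset.range (N + 1), b t * x ^ t = ∏ i, (x - μ i) := by
  have hc := newton_coeff_eq_esymm μ b tr h0 htr hb
  have := congrArg (Polynomial.eval x)
    (Multiset.prod_X_sub_X_eq_sum_esymm (Finset.univ.val.map μ))
  rw [Polynomial.eval_multiset_prod, Multiset.map_map, Multiset.map_map] at this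
  simp only [Function.comp_def, Polynomial.eval_sub, Polynomial.eval_X, Polynomial.eval_C,
    Multiset.card_map, Finset.card_val, Finset.card_univ, Fintype.card_fin,
    Polynomial.eval_finsetSum, Polynomial.eval_mul, Polynomial.eval_pow, Polynomial.eval_neg,
    Polynomial.eval_one] at this
  rw [show (∏ i, (x - μ i)) = (Multiset.map (fun i => x - μ i) Finset.univ.val).prod from rfl, this,
    ← Finset.sum_range_reflect]
  refine Finset.sum_congr rfl fun j hj => ?_
  rw [Finset.mem_range] at hj
  rw [show N + 1 - 1 - j = N - j by omega, hc j (by omega)]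
  ring

/-- The computed polynomial is the characteristic polynomial, so its largest root is the largest
eigenvalue, and this bounds the Rayleigh quotient by expansion in an eigenbasis. -/
theorem Matrix.IsHermitian.largestRoot_spec {N : ℕ} (hN : 0 < N) {A : Matrix (Fin N) (Fin N) ℝ}
    (hA : A.IsHermitian) (b tr : ℕ → ℝ) (h0 : b N = 1)
    (htr : ∀ k ≤ N, tr k = (A ^ k).trace)
    (hb : ∀ k < N, b (N - (k + 1)) =
      (0 - ∑ i ∈ Finset.range (k + 1), b (N - k + i) * tr (i + 1)) / (k + 1)) :
    (∃ v : Fin N → ℝ, v ≠ 0 ∧ A.mulVec v = RealRAM.largestRoot (N + 1) b • v) ∧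
    ∀ x : Fin N → ℝ, x ⬝ᵥ A.mulVec x ≤ RealRAM.largestRoot (N + 1) b * (x ⬝ᵥ x) := by
  have : Nonempty (Fin N) := ⟨⟨0, hN⟩⟩
  -- The root set is finite, and nonempty since `0 < N`, so the supremum in `largestRoot` is
  -- attained rather than a default value.
  have hset : {x : ℝ | ∑ t ∈ Finset.range (N + 1), b t * x ^ t = 0} =
      Set.range hA.eigenvalues := by
    ext x
    rw [Set.mem_ofPred_eq, newton_poly_eq_prod hA.eigenvalues b tr h0
      (fun k hk => (htr k hk).trans (hA.trace_pow_eq_sum_eigenvalues k)) hb,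
      Finset.prod_eq_zero_iff]
    simp only [Finset.mem_univ, true_and, sub_eq_zero, Set.mem_range, @eq_comm _ x]
  have hfin : (Set.range hA.eigenvalues).Finite := Set.finite_range _
  have hne : (Set.range hA.eigenvalues).Nonempty := Set.range_nonempty _
  set lam := RealRAM.largestRoot (N + 1) b with hlam
  have hlam' : lam = sSup (Set.range hA.eigenvalues) := by rw [hlam, RealRAM.largestRoot, hset]
  have hmem : lam ∈ Set.range hA.eigenvalues := hlam' ▸ hne.csSup_mem hfin
  have hle : ∀ i, hA.eigenvalues i ≤ lam := fun i => hlam' ▸ le_csSup hfin.bddAbove ⟨i, rfl⟩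
  refine ⟨?_, fun x => ?_⟩
  · obtain ⟨j, hj⟩ := hmem
    refine ⟨(hA.eigenvectorBasis j).ofLp, fun h => ?_, ?_⟩
    · exact hA.eigenvectorBasis.orthonormal.ne_zero j (by ext i; simpa using congrFun h i)
    · rw [hA.mulVec_eigenvectorBasis j, hj]
  · have hdot : ∀ y z : Fin N → ℝ, inner ℝ (WithLp.toLp 2 y) (WithLp.toLp 2 z) = y ⬝ᵥ z := by
      intro y z
      rw [EuclideanSpace.inner_eq_star_dotProduct]
      simp [dotProduct_comm]
    have h1 := hA.eigenvectorBasis.sum_inner_mul_inner (WithLp.toLp 2 x) (WithLp.toLp 2 (A.mulVec x))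
    have h2 := hA.eigenvectorBasis.sum_inner_mul_inner (WithLp.toLp 2 x) (WithLp.toLp 2 x)
    rw [hdot] at h1 h2
    rw [← h1, ← h2, Finset.mul_sum]
    refine Finset.sum_le_sum fun i _ => ?_
    have h3 : inner ℝ (hA.eigenvectorBasis i) (WithLp.toLp 2 (A.mulVec x)) =
        hA.eigenvalues i * inner ℝ (hA.eigenvectorBasis i) (WithLp.toLp 2 x) := by
      have e : hA.eigenvectorBasis i = WithLp.toLp 2 (hA.eigenvectorBasis i).ofLp := rfl
      rw [e, hdot, hdot, Matrix.dotProduct_mulVec, ← Matrix.mulVec_transpose]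
      have hAt : A.transpose = A := by rw [← Matrix.conjTranspose_eq_transpose_of_trivial, hA.eq]
      rw [hAt, hA.mulVec_eigenvectorBasis i, smul_dotProduct]
      rfl
    rw [h3, real_inner_comm (hA.eigenvectorBasis i) (WithLp.toLp 2 x)]
    nlinarith [mul_self_nonneg (inner ℝ (hA.eigenvectorBasis i) (WithLp.toLp 2 x)), hle i]

/-! ## The orthogonal projection to the kernel of a symmetric matrix -/

theorem projUpdate_eq {N : ℕ} (Q : Matrix (Fin N) (Fin N) ℝ) (c : Fin N → ℝ) :
    projUpdate Q c = Q - (Q.mulVec c ⬝ᵥ Q.mulVec c)⁻¹ •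
      Matrix.vecMulVec (Q.mulVec c) (Q.mulVec c) := by
  ext p q
  simp [projUpdate, Matrix.vecMulVec_apply, div_eq_inv_mul]

theorem projUpdate_mulVec {N : ℕ} (Q : Matrix (Fin N) (Fin N) ℝ) (c x : Fin N → ℝ) :
    (projUpdate Q c).mulVec x = Q.mulVec x -
      ((Q.mulVec c ⬝ᵥ Q.mulVec c)⁻¹ * (Q.mulVec c ⬝ᵥ x)) • Q.mulVec c := by
  rw [projUpdate_eq, Matrix.sub_mulVec, Matrix.smul_mulVec, Matrix.vecMulVec_mulVec]
  ext i
  simp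
  ring

/-- Symmetric idempotent matrices. -/
structure IsProj {N : ℕ} (Q : Matrix (Fin N) (Fin N) ℝ) : Prop where
  symm : Q.transpose = Q
  idem : ∀ x, Q.mulVec (Q.mulVec x) = Q.mulVec x

theorem dotProduct_mulVec_of_symm {N : ℕ} {Q : Matrix (Fin N) (Fin N) ℝ} (h : Q.transpose = Q)
    (x y : Fin N → ℝ) : Q.mulVec x ⬝ᵥ y = x ⬝ᵥ Q.mulVec y := by
  rw [Matrix.dotProduct_mulVec, ← Matrix.mulVec_transpose, h]

/-- The vector `w = Q c` lies in the range of `Q`, so removing its line from the range leaves an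
orthogonal projection. It kills `c`, since `w ⬝ c = w ⬝ w`, and it fixes every vector of the old
range orthogonal to `c`. -/
theorem IsProj.update {N : ℕ} {Q : Matrix (Fin N) (Fin N) ℝ} (h : IsProj Q) (c : Fin N → ℝ) :
    IsProj (projUpdate Q c) ∧ (projUpdate Q c).mulVec c = 0 ∧
      (∀ x, Q.mulVec x = 0 → (projUpdate Q c).mulVec x = 0) ∧
      ∀ x, Q.mulVec x = x → x ⬝ᵥ c = 0 → (projUpdate Q c).mulVec x = x := by
  set w := Q.mulVec c with hw
  have hQw : Q.mulVec w = w := h.idem c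
  have hwx : ∀ x, w ⬝ᵥ Q.mulVec x = w ⬝ᵥ x := fun x => by
    rw [← dotProduct_mulVec_of_symm h.symm, hQw]
  have hwc : w ⬝ᵥ c = w ⬝ᵥ w := (hwx c).symm
  -- True also for `w = 0`, where the inverse is zero by convention.
  have hww' : ((w ⬝ᵥ w)⁻¹ * (w ⬝ᵥ w)) • w = w := by
    by_cases h0 : w ⬝ᵥ w = 0
    · have : w = 0 := dotProduct_self_eq_zero.mp h0
      simp [this]
    · rw [inv_mul_cancel₀ h0, one_smul]
  refine ⟨⟨?_, fun x => ?_⟩, ?_, fun x hx => ?_, fun x hx hxc => ?_⟩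
  · rw [projUpdate_eq, Matrix.transpose_sub, h.symm, Matrix.transpose_smul,
      Matrix.transpose_vecMulVec]
  · rw [projUpdate_mulVec, projUpdate_mulVec, ← hw, Matrix.mulVec_sub, Matrix.mulVec_smul, h.idem,
      hQw, dotProduct_sub, dotProduct_smul, smul_eq_mul, hwx x]
    have : (w ⬝ᵥ w)⁻¹ * (w ⬝ᵥ x - (w ⬝ᵥ w)⁻¹ * w ⬝ᵥ x * w ⬝ᵥ w) = 0 := by
      by_cases h0 : w ⬝ᵥ w = 0
      · simp [h0]
      · field_simp; ring
    rw [this, zero_smul, sub_zero]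
  · rw [projUpdate_mulVec, ← hw, hwc, hww', sub_self]
  · rw [projUpdate_mulVec, ← hw, ← hwx x, hx, dotProduct_zero, mul_zero, zero_smul, sub_zero]
  · have : w ⬝ᵥ x = 0 := by
      rw [hw, dotProduct_mulVec_of_symm h.symm, hx, dotProduct_comm, hxc]
    rw [projUpdate_mulVec, ← hw, this, mul_zero, zero_smul, sub_zero, hx]

/-- Columns once killed stay killed. A kernel vector of the symmetric matrix `S` is orthogonal to
all its columns and therefore stays fixed. -/
theorem projMat_spec {N : ℕ} (S : Matrix (Fin N) (Fin N) ℝ) (hS : S.transpose = S) (v : Fin N → ℝ)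
    (hv : S.mulVec v = 0) (t : ℕ) :
    IsProj (projMat S t) ∧ (∀ j : Fin N, (j : ℕ) < t → (projMat S t).mulVec (fun l => S l j) = 0) ∧
      (projMat S t).mulVec v = v := by
  induction t with
  | zero => exact ⟨⟨by simp [projMat], by simp [projMat]⟩, by simp, by simp [projMat]⟩
  | succ t ih =>
    obtain ⟨h1, h2, h3⟩ := ih
    rw [projMat]
    split_ifs with ht
    · obtain ⟨u1, u2, u3, u4⟩ := h1.update (fun l => S l ⟨t, ht⟩)
      refine ⟨u1, fun j hj => ?_, u4 v h3 ?_⟩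
      · rcases Nat.lt_succ_iff_lt_or_eq.mp hj with h | h
        · exact u3 _ (h2 j h)
        · obtain rfl : j = ⟨t, ht⟩ := Fin.ext h
          exact u2
      · have := congrFun hv ⟨t, ht⟩
        rw [← hS] at this
        rw [dotProduct_comm]
        exact this
    · exact ⟨h1, fun j hj => h2 j (by omega), h3⟩

/-- All columns of `S` are killed, so `Q S = 0`, and by transposition `S Q = 0`: the columns of `Q`
lie in the kernel of `S`. From `Qᵀ Q = Q` the squared length of a column is its diagonal entry. If
no diagonal entry were positive, `Q` would vanish, although it fixes `v ≠ 0`. -/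
theorem projMat_kernel {N : ℕ} (S : Matrix (Fin N) (Fin N) ℝ) (hS : S.transpose = S)
    (v : Fin N → ℝ) (hv0 : v ≠ 0) (hv : S.mulVec v = 0) :
    (∃ j, 0 < projMat S N j j) ∧ ∀ j, S.mulVec (fun l => projMat S N l j) = 0 ∧
      (fun l => projMat S N l j) ⬝ᵥ (fun l => projMat S N l j) = projMat S N j j := by
  obtain ⟨h1, h2, h3⟩ := projMat_spec S hS v hv N
  set Q := projMat S N with hQ
  have hQS : Q * S = 0 := by
    ext i j
    exact congrFun (h2 j j.2) i
  have hSQ : S * Q = 0 := by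
    have := congrArg Matrix.transpose hQS
    rwa [Matrix.transpose_mul, hS, h1.symm, Matrix.transpose_zero] at this
  have hcol : ∀ j, (fun l => Q l j) ⬝ᵥ (fun l => Q l j) = Q j j := by
    intro j
    have := congrFun (h1.idem (Pi.single j 1)) j
    rw [Matrix.mulVec_single_one] at this
    have e : Q.col j = fun l => Q l j := rfl
    rw [e] at this
    calc _ = (fun l => Q.transpose l j) ⬝ᵥ (fun l => Q l j) := by rw [h1.symm]
      _ = Q j j := this
  refine ⟨?_, fun j => ⟨?_, hcol j⟩⟩
  · by_contra! hcon
    apply hv0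
    have hz : Q = 0 := by
      ext l j
      have h0 : (fun l => Q l j) ⬝ᵥ (fun l => Q l j) = 0 :=
        le_antisymm ((hcol j).trans_le (hcon j)) (Finset.sum_nonneg fun i _ => mul_self_nonneg _)
      exact congrFun (dotProduct_self_eq_zero.mp h0) l
    rw [← h3, hz, Matrix.zero_mulVec]
  · ext i
    exact congrFun (congrFun hSQ i) j

/-! ## The bilinear problem -/

theorem dotProduct_mul_self_le {M : ℕ} (x y : Fin M → ℝ) :
    (x ⬝ᵥ y) * (x ⬝ᵥ y) ≤ (x ⬝ᵥ x) * (y ⬝ᵥ y) := by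
  have := Finset.sum_mul_sq_le_sq_mul_sq Finset.univ x y
  simp only [dotProduct, ← sq]
  exact this

theorem exp_log_half {x : ℝ} (hx : 0 < x) : Real.exp (Real.log x / 2) = Real.sqrt x := by
  rw [Real.sqrt_eq_rpow, Real.rpow_def_of_pos hx]
  congr 1
  ring

/-- By Cauchy–Schwarz and the Rayleigh bound no pair of unit vectors exceeds `√lam`. Since `‖B v‖² =
lam`, the normalized image of `v` attains it. If `B v = 0`, then `lam = 0` and any unit vector
serves as `u`; the first coordinate vector exists because `0 < M`. -/
theorem bilinear_max {M N : ℕ} (hM : 0 < M) (B : Matrix (Fin M) (Fin N) ℝ) (lam : ℝ)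
    (hlam : ∀ x, x ⬝ᵥ (B.transpose * B).mulVec x ≤ lam * (x ⬝ᵥ x)) (v : Fin N → ℝ)
    (hv1 : v ⬝ᵥ v = 1) (hv : (B.transpose * B).mulVec v = lam • v) (u w : Fin M → ℝ)
    (hw : w = B.mulVec v)
    (hu : ∀ q, u q = if w ⬝ᵥ w ≤ 0 then (if (q : ℕ) = 0 then 1 else 0) else
      w q / Real.exp (Real.log (w ⬝ᵥ w) / 2)) :
    u ⬝ᵥ u = 1 ∧ ∀ (u' : Fin M → ℝ) (v' : Fin N → ℝ), u' ⬝ᵥ u' = 1 → v' ⬝ᵥ v' = 1 →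
      u' ⬝ᵥ B.mulVec v' ≤ u ⬝ᵥ w := by
  have hquad : ∀ x, x ⬝ᵥ (B.transpose * B).mulVec x = B.mulVec x ⬝ᵥ B.mulVec x := by
    intro x
    rw [← Matrix.mulVec_mulVec, Matrix.dotProduct_mulVec, Matrix.vecMul_transpose]
  have hww : w ⬝ᵥ w = lam := by
    rw [hw, ← hquad, hv, dotProduct_smul, hv1, smul_eq_mul, mul_one]
  have hnn : 0 ≤ w ⬝ᵥ w := Finset.sum_nonneg fun i _ => mul_self_nonneg _
  have hbound : ∀ (u' : Fin M → ℝ) (v' : Fin N → ℝ), u' ⬝ᵥ u' = 1 → v' ⬝ᵥ v' = 1 →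
      u' ⬝ᵥ B.mulVec v' ≤ Real.sqrt lam := by
    intro u' v' hu' hv'
    apply Real.le_sqrt_of_sq_le
    have h1 := dotProduct_mul_self_le u' (B.mulVec v')
    have h2 := hlam v'
    rw [hquad, hv'] at h2
    rw [hu'] at h1
    rw [sq]
    linarith
  by_cases h0 : w ⬝ᵥ w ≤ 0
  · have hz : w ⬝ᵥ w = 0 := le_antisymm h0 hnn
    have hwz : w = 0 := dotProduct_self_eq_zero.mp hz
    have hlz : lam = 0 := by rw [← hww, hz]
    have hu' : u = Pi.single ⟨0, hM⟩ 1 := by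
      ext q
      rw [hu, if_pos h0, Pi.single_apply]
      simp [Fin.ext_iff]
    refine ⟨by rw [hu']; simp, fun u' v' h1 h2 => ?_⟩
    have := hbound u' v' h1 h2
    rw [hlz, Real.sqrt_zero] at this
    rw [hwz, dotProduct_zero]
    exact this
  · push Not at h0
    have hs : 0 < Real.sqrt (w ⬝ᵥ w) := Real.sqrt_pos.mpr h0
    have hu' : u = (Real.sqrt (w ⬝ᵥ w))⁻¹ • w := by
      ext q
      rw [hu, if_neg (not_le.mpr h0), exp_log_half h0]
      simp [div_eq_inv_mul]
    have hsq : Real.sqrt (w ⬝ᵥ w) * Real.sqrt (w ⬝ᵥ w) = w ⬝ᵥ w := Real.mul_self_sqrt hnn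
    have huw : u ⬝ᵥ w = Real.sqrt (w ⬝ᵥ w) := by
      rw [hu', smul_dotProduct, smul_eq_mul]
      nth_rw 2 [← hsq]
      field_simp
    refine ⟨?_, fun u' v' h1 h2 => ?_⟩
    · nth_rw 2 [hu']
      rw [dotProduct_smul, huw, smul_eq_mul, inv_mul_cancel₀ hs.ne']
    · rw [huw, hww]
      exact hbound u' v' h1 h2

/-! ### Correctness of the exact bilinear solver -/

namespace RealRAM
namespace Alg

variable {m tot : ℕ} {sz : ℕ → ℕ} {s : Store}

/-- The real matrix of the bilinear form left after the contractions. -/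
def bilinearMatrix (m : ℕ) (sz : ℕ → ℕ) (s : Store) :
    Matrix (Fin (4 * sz m)) (Fin (4 * sz (m + 1))) ℝ :=
  matOf _ _ fun p q => ∑ c ∈ Finset.range 4, s.real 1 (s.nat 4 p + sz m * s.nat 4 q) (4 * m + c) *
    s.real 6 c (4 * s.nat 5 p + s.nat 5 q)

/-- The routines are chained by tracking which arrays each leaves alone. The computed `λ` is an
eigenvalue, so `λ - A` has a nonzero kernel vector and `pick` finds a usable column of the
projection. -/
theorem exec_solve (ω : ℕ → ℝ) (h : Format m tot sz s) (hm : 0 < sz m) (hm' : 0 < sz (m + 1)) :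
    vecOf (4 * sz m) ((exec ω solve s).real 5 m) ⬝ᵥ
      vecOf (4 * sz m) ((exec ω solve s).real 5 m) = 1 ∧
    vecOf (4 * sz (m + 1)) ((exec ω solve s).real 5 (m + 1)) ⬝ᵥ
      vecOf (4 * sz (m + 1)) ((exec ω solve s).real 5 (m + 1)) = 1 ∧
    (exec ω solve s).real 19 0 0 = vecOf (4 * sz m) ((exec ω solve s).real 5 m) ⬝ᵥ
      (bilinearMatrix m sz s).mulVec (vecOf (4 * sz (m + 1)) ((exec ω solve s).real 5 (m + 1))) ∧
    (∀ u v, u ⬝ᵥ u = 1 → v ⬝ᵥ v = 1 →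
      u ⬝ᵥ (bilinearMatrix m sz s).mulVec v ≤ (exec ω solve s).real 19 0 0) ∧
    ∀ x, x ≠ m → x ≠ m + 1 → (exec ω solve s).real 5 x = s.real 5 x := by
  rw [solve]
  simp only [exec.eq_2]
  set N := 4 * sz (m + 1) with hN
  set M := 4 * sz m with hM
  set B := bilinearMatrix m sz s with hB
  obtain ⟨s₁, hs₁⟩ : ∃ s', s' = exec ω bilinear s := ⟨_, rfl⟩
  simp only [← hs₁]
  have h₁ : Format m tot sz s₁ := hs₁ ▸ h.exec _ _ (by decide)
  have e₁ : matOf M N (s₁.real 8) = B := by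
    ext p q
    rw [hs₁]
    exact exec_bilinear ω h p p.2 q q.2
  obtain ⟨s₂, hs₂⟩ : ∃ s', s' = exec ω gram s₁ := ⟨_, rfl⟩
  simp only [← hs₂]
  have h₂ : Format m tot sz s₂ := hs₂ ▸ h₁.exec _ _ (by decide)
  have e₂ : matOf N N (s₂.real 9) = B.transpose * B := by
    rw [← e₁, hs₂]; exact exec_gram ω h₁
  set A := B.transpose * B with hA
  obtain ⟨s₃, hs₃⟩ : ∃ s', s' = exec ω powers s₂ := ⟨_, rfl⟩
  simp only [← hs₃]
  have h₃ : Format m tot sz s₃ := hs₃ ▸ h₂.exec _ _ (by decide)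
  have e₃ := exec_powers ω h₂
  rw [← hs₃, ← hN, e₂] at e₃
  obtain ⟨s₄, hs₄⟩ : ∃ s', s' = exec ω traces s₃ := ⟨_, rfl⟩
  simp only [← hs₄]
  have h₄ : Format m tot sz s₄ := hs₄ ▸ h₃.exec _ _ (by decide)
  have e₄ : ∀ k ≤ N, s₄.real 11 0 k = (A ^ k).trace := fun k hk => by
    rw [← e₃ k hk, hs₄]; exact exec_traces ω h₃ k hk
  obtain ⟨s₅, hs₅⟩ : ∃ s', s' = exec ω coeffs s₄ := ⟨_, rfl⟩
  simp only [← hs₅]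
  have h₅ : Format m tot sz s₅ := hs₅ ▸ h₄.exec _ _ (by decide)
  obtain ⟨e₅, e₅'⟩ := exec_coeffs ω h₄
  obtain ⟨s₆, hs₆⟩ : ∃ s', s' = exec ω eigenvalue s₅ := ⟨_, rfl⟩
  simp only [← hs₆]
  have h₆ : Format m tot sz s₆ := hs₆ ▸ h₅.exec _ _ (by decide)
  have e₆ := exec_eigenvalue ω h₅
  obtain ⟨s₇, hs₇⟩ : ∃ s', s' = exec ω project s₆ := ⟨_, rfl⟩
  simp only [← hs₇]
  have h₇ : Format m tot sz s₇ := hs₇ ▸ h₆.exec _ _ (by decide)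
  have e₇ := exec_project ω h₆
  obtain ⟨s₈, hs₈⟩ : ∃ s', s' = exec ω pick s₇ := ⟨_, rfl⟩
  simp only [← hs₈]
  have h₈ : Format m tot sz s₈ := hs₈ ▸ h₇.exec _ _ (by decide)
  obtain ⟨s₉, hs₉⟩ : ∃ s', s' = exec ω rightVec s₈ := ⟨_, rfl⟩
  simp only [← hs₉]
  have h₉ : Format m tot sz s₉ := hs₉ ▸ h₈.exec _ _ (by decide)
  obtain ⟨e₉, e₉'⟩ := exec_rightVec ω h₈
  obtain ⟨sA, hsA⟩ : ∃ s', s' = exec ω image s₉ := ⟨_, rfl⟩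
  simp only [← hsA]
  have hA' : Format m tot sz sA := hsA ▸ h₉.exec _ _ (by decide)
  obtain ⟨eA, eA'⟩ := exec_image ω h₉
  obtain ⟨sB, hsB⟩ : ∃ s', s' = exec ω leftVec sA := ⟨_, rfl⟩
  simp only [← hsB]
  have hB' : Format m tot sz sB := hsB ▸ hA'.exec _ _ (by decide)
  obtain ⟨eB, eB'⟩ := exec_leftVec ω hA'
  have eC := exec_value ω hB'
  simp only [← hs₅, ← hs₆, ← hs₇, ← hs₉, ← hsA, ← hsB, ← hM, ← hN] at e₅ e₅' e₆ e₇ e₉ e₉' eA eA' eB eB' eC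
  -- linear algebra
  have hsymm : A.transpose = A := by rw [hA, Matrix.transpose_mul, Matrix.transpose_transpose]
  have hherm : A.IsHermitian := by
    rw [Matrix.IsHermitian, Matrix.conjTranspose_eq_transpose_of_trivial, hsymm]
  obtain ⟨⟨v₀, hv₀, hv₀'⟩, hray⟩ := hherm.largestRoot_spec (by omega) (s₅.real 12 0) (s₄.real 11 0)
    e₅ e₄ e₅'
  rw [← e₆] at hv₀' hray
  set lam := s₆.real 13 0 0 with hlam
  have hr9 : s₆.real 9 = s₂.real 9 := by
    rw [hs₆, exec_real_of_notMem _ _ _ _ (by decide), hs₅, exec_real_of_notMem _ _ _ _ (by decide),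
      hs₄, exec_real_of_notMem _ _ _ _ (by decide), hs₃, exec_real_of_notMem _ _ _ _ (by decide)]
  rw [hr9, e₂] at e₇
  set S := lam • (1 : Matrix (Fin N) (Fin N) ℝ) - A with hS
  have hSsymm : S.transpose = S := by
    rw [hS, Matrix.transpose_sub, hsymm, Matrix.transpose_smul, Matrix.transpose_one]
  have hSmul : ∀ x, S.mulVec x = lam • x - A.mulVec x := by
    intro x
    rw [hS, Matrix.sub_mulVec, Matrix.smul_mulVec, Matrix.one_mulVec]
  obtain ⟨⟨j₀, hj₀⟩, hker⟩ := projMat_kernel S hSsymm v₀ hv₀ (by rw [hSmul, hv₀', sub_self])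
  have hent : ∀ p q : Fin N, s₇.real 14 p q = projMat S N p q := fun p q => by rw [← e₇]; rfl
  obtain ⟨hj, hjpos⟩ := exec_pick ω h₇ ⟨j₀, j₀.2, by rw [hent]; exact hj₀⟩
  rw [← hs₈] at hj hjpos
  set j := s₈.nat 6 0 with hjdef
  have hr14 : s₈.real 14 = s₇.real 14 := hs₈ ▸ exec_real_of_notMem _ _ _ _ (by decide)
  rw [hr14] at e₉
  set col : Fin N → ℝ := fun l => projMat S N l ⟨j, hj⟩ with hcol
  obtain ⟨hk1, hk2⟩ := hker ⟨j, hj⟩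
  have hjj : s₇.real 14 j j = projMat S N ⟨j, hj⟩ ⟨j, hj⟩ := hent ⟨j, hj⟩ ⟨j, hj⟩
  set v := vecOf N (s₉.real 5 (m + 1)) with hv
  have hvcol : v = (Real.sqrt (s₇.real 14 j j))⁻¹ • col := by
    ext q
    rw [hv, vecOf, e₉ q q.2, exp_log_half hjpos, div_eq_inv_mul]
    simp only [Pi.smul_apply, smul_eq_mul, hcol]
    rw [← hent q ⟨j, hj⟩]
  have hsq : Real.sqrt (s₇.real 14 j j) * Real.sqrt (s₇.real 14 j j) = s₇.real 14 j j :=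
    Real.mul_self_sqrt hjpos.le
  have hspos : 0 < Real.sqrt (s₇.real 14 j j) := Real.sqrt_pos.mpr hjpos
  have hvv : v ⬝ᵥ v = 1 := by
    rw [hvcol, smul_dotProduct, dotProduct_smul, hk2, ← hjj, smul_eq_mul, smul_eq_mul]
    nth_rw 3 [← hsq]
    field_simp
  have hAv : A.mulVec v = lam • v := by
    have : S.mulVec v = 0 := by rw [hvcol, Matrix.mulVec_smul, hk1, smul_zero]
    rw [hSmul, sub_eq_zero] at this
    exact this.symm
  have hr8 : s₉.real 8 = s₁.real 8 := by
    rw [hs₉, exec_real_of_notMem _ _ _ _ (by decide), hs₈, exec_real_of_notMem _ _ _ _ (by decide),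
      hs₇, exec_real_of_notMem _ _ _ _ (by decide), hs₆, exec_real_of_notMem _ _ _ _ (by decide),
      hs₅, exec_real_of_notMem _ _ _ _ (by decide), hs₄, exec_real_of_notMem _ _ _ _ (by decide),
      hs₃, exec_real_of_notMem _ _ _ _ (by decide), hs₂, exec_real_of_notMem _ _ _ _ (by decide)]
  rw [hr8, e₁] at eA
  have hr5 : ∀ t, (exec ω value t).real 5 = t.real 5 := fun t =>
    exec_real_of_notMem _ _ _ _ (by decide)
  have hr5A : sA.real 5 = s₉.real 5 := hsA ▸ exec_real_of_notMem _ _ _ _ (by decide)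
  have hr17 : sB.real 17 = sA.real 17 := hsB ▸ exec_real_of_notMem _ _ _ _ (by decide)
  have hvB : vecOf N (sB.real 5 (m + 1)) = v := by rw [eB' _ (by omega), hr5A]
  obtain ⟨f1, f2⟩ := bilinear_max (by omega) B lam hray v hvv hAv (vecOf M (sB.real 5 m))
    (vecOf M (sA.real 17 0)) eA (fun q => by rw [vecOf, eB q q.2, eA']; rfl)
  rw [hr5, hvB, eC, hr17]
  refine ⟨f1, hvv, by rw [eA], f2, fun x hx hx' => ?_⟩
  rw [eB' x hx, hr5A, e₉' x hx', hs₈, exec_real_of_notMem _ _ _ _ (by decide),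
      hs₇, exec_real_of_notMem _ _ _ _ (by decide), hs₆, exec_real_of_notMem _ _ _ _ (by decide),
      hs₅, exec_real_of_notMem _ _ _ _ (by decide), hs₄, exec_real_of_notMem _ _ _ _ (by decide),
      hs₃, exec_real_of_notMem _ _ _ _ (by decide), hs₂, exec_real_of_notMem _ _ _ _ (by decide),
      hs₁, exec_real_of_notMem _ _ _ _ (by decide)]

end Alg
end RealRAM

/-! ## Multilinear forms by successive contraction -/

/-- Contraction of a tensor with entries `T` in mixed radix order with the first `k` blocks. -/
def contraction (N : ℕ → ℕ) (x : ℕ → ℕ → CQuat) (T : ℕ → CQuat) : ℕ → ℕ → CQuat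
  | 0 => T
  | k + 1 => fun t => ∑ i ∈ Finset.range (N k), x k i * contraction N x T k (i + N k * t)

/-- The entries of a tensor in mixed radix order. -/
def flatten {d : ℕ} {n : Fin d → ℕ} (F : HTensor n) (t : ℕ) : CQuat :=
  if h : t < ∏ k, n k then F (finPiFinEquiv.symm ⟨t, h⟩) else 0

theorem contraction_congr {N : ℕ → ℕ} {x x' : ℕ → ℕ → CQuat} {T : ℕ → CQuat} {k : ℕ}
    (h : ∀ j < k, ∀ i < N j, x j i = x' j i) (t : ℕ) :
    contraction N x T k t = contraction N x' T k t := by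
  induction k generalizing t with
  | zero => rfl
  | succ k ih =>
    simp only [contraction]
    refine Finset.sum_congr rfl fun i hi => ?_
    rw [ih (fun j hj => h j (by omega)), h k (by omega) i (Finset.mem_range.mp hi)]

/-- An index `i + N k * t` with `i < N k` is at least `t`, so contraction never pulls data from
beyond `tot` to smaller indices than it had. -/
theorem contraction_eq_zero {N : ℕ → ℕ} {x : ℕ → ℕ → CQuat} {T : ℕ → CQuat} {tot : ℕ}
    (hT : ∀ t, tot ≤ t → T t = 0) (k : ℕ) (t : ℕ) (ht : tot ≤ t) :
    contraction N x T k t = 0 := by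
  induction k generalizing t with
  | zero => exact hT t ht
  | succ k ih =>
    simp only [contraction]
    refine Finset.sum_eq_zero fun i hi => ?_
    have : 1 ≤ N k := by have := Finset.mem_range.mp hi; omega
    rw [ih _ (by nlinarith), mul_zero]

/-- The recursion peels off the last contraction; peeling off the first instead matches the
induction on the order of the tensor. -/
theorem contraction_succ (N : ℕ → ℕ) (x : ℕ → ℕ → CQuat) (T : ℕ → CQuat) (k t : ℕ) :
    contraction N x T (k + 1) t =
      contraction (fun j => N (j + 1)) (fun j => x (j + 1)) (contraction N x T 1) k t := by
  induction k generalizing t with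
  | zero => rfl
  | succ k ih =>
    rw [contraction]
    conv_rhs => rw [contraction]
    refine Finset.sum_congr rfl fun i hi => ?_
    rw [ih]

/-- The first index is the least significant digit of the mixed radix number, so contracting it
combines consecutive entries. -/
theorem finPiFinEquiv_cons {d : ℕ} {n : Fin (d + 1) → ℕ} (i : Fin (n 0))
    (f : (k : Fin d) → Fin (n k.succ)) :
    ((finPiFinEquiv (Fin.cons i f : (k : Fin (d + 1)) → Fin (n k)) : Fin _) : ℕ) =
      i + n 0 * (finPiFinEquiv f : Fin _) := by
  rw [finPiFinEquiv_apply, finPiFinEquiv_apply, Fin.sum_univ_succ, Finset.mul_sum]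
  congr 1
  · have : ∏ j : Fin ((0 : Fin (d + 1)) : ℕ), n (Fin.castLE (0 : Fin (d + 1)).is_lt.le j) = 1 :=
      Fin.prod_univ_zero _
    rw [this, mul_one, Fin.cons_zero]
  · refine Finset.sum_congr rfl fun k _ => ?_
    have : ∏ j : Fin (k.succ : ℕ), n (Fin.castLE k.succ.is_lt.le j) =
        n 0 * ∏ j : Fin (k : ℕ), n (Fin.castLE k.is_lt.le j).succ :=
      Fin.prod_univ_succ (fun j : Fin ((k : ℕ) + 1) => n (Fin.castLE k.succ.is_lt.le j))
    rw [this, Fin.cons_succ]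
    ring

theorem form_succ {d : ℕ} {n : Fin (d + 1) → ℕ} (F : HTensor n) (x : Blocks n) :
    form F x = form (n := fun k => n k.succ)
      (fun i => ∑ i₀, x 0 i₀ * F (Fin.cons i₀ i)) (fun k => x k.succ) := by
  unfold form
  rw [← (Fin.consEquiv fun k => Fin (n k)).sum_comp, Fintype.sum_prod_type, Finset.sum_comm]
  refine Finset.sum_congr rfl fun i _ => ?_
  rw [Finset.sum_mul]
  refine Finset.sum_congr rfl fun i₀ _ => ?_
  rw [Fin.prod_univ_succ]
  rw [show (Fin.consEquiv fun k => Fin (n k)) (i₀, i) = Fin.cons i₀ i from rfl]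
  simp only [Fin.cons_zero, Fin.cons_succ]
  ring

/-- Summing over the first index gives a tensor of smaller order, whose flattening is one
contraction of `flatten F`. After all `d` contractions only entry `0` matters. -/
theorem form_eq_contraction {d : ℕ} {n : Fin d → ℕ} (F : HTensor n) (x : Blocks n) (N : ℕ → ℕ)
    (X : ℕ → ℕ → CQuat) (hN : ∀ k : Fin d, N k = n k)
    (hX : ∀ (k : Fin d) (i : Fin (n k)), X k i = x k i) :
    form F x = contraction N X (flatten F) d 0 := by
  induction d generalizing N X with
  | zero =>
    simp only [form, contraction, flatten, Finset.univ_unique, Finset.sum_singleton,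
      Finset.univ_eq_empty, Finset.prod_empty, mul_one, Nat.lt_one_iff, dite_true]
    congr 1
    exact Subsingleton.elim _ _
  | succ d ih =>
    rw [form_succ, ih _ _ (fun j => N (j + 1)) (fun j => X (j + 1)) (fun k => hN k.succ)
      (fun k i => hX k.succ i), contraction_succ]
    congr 1
    funext t
    simp only [contraction]
    have h0 : N 0 = n 0 := hN 0
    rw [h0, Finset.sum_range]
    unfold flatten
    by_cases ht : t < ∏ k : Fin d, n k.succ
    · rw [dif_pos ht]
      refine Finset.sum_congr rfl fun i _ => ?_
      have hX0 : X 0 i = x 0 i := hX 0 i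
      rw [hX0]
      have hlt : (i : ℕ) + n 0 * t < ∏ k, n k := by
        rw [Fin.prod_univ_succ]
        have := i.2
        calc (i : ℕ) + n 0 * t < n 0 * (t + 1) := by rw [mul_add]; omega
          _ ≤ _ := Nat.mul_le_mul_left _ ht
      rw [dif_pos hlt]
      congr 2
      rw [Equiv.eq_symm_apply]
      apply Fin.ext
      rw [finPiFinEquiv_cons]
      simp
    -- Out of range, both flattenings vanish, so the identity holds for all indices and the two
    -- sequences are equal as functions.
    · rw [dif_neg ht]
      symm
      refine Finset.sum_eq_zero fun i _ => ?_
      rw [dif_neg, mul_zero]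
      rw [Fin.prod_univ_succ, not_lt]
      have := Nat.mul_le_mul_left (n 0) (not_lt.mp ht)
      omega

theorem sum_range_four_mul {M : Type*} [AddCommMonoid M] (n : ℕ) (f : ℕ → M) :
    ∑ p ∈ Finset.range (4 * n), f p =
      ∑ i ∈ Finset.range n, ∑ a ∈ Finset.range 4, f (4 * i + a) := by
  induction n with
  | zero => simp
  | succ n ih =>
    rw [Finset.sum_range_succ, ← ih, mul_add, mul_one, Finset.sum_range_add]

theorem quatAt_eq (f : ℕ → ℝ) (i : ℕ) : quatAt f i = quatAt (fun a => f (4 * i + a)) 0 := rfl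

theorem quatAt_congr {f g : ℕ → ℝ} {i : ℕ} (h : ∀ a < 4, f (4 * i + a) = g (4 * i + a)) :
    quatAt f i = quatAt g i := by
  have h0 := h 0 (by norm_num)
  simp only [add_zero] at h0
  simp only [quatAt, h0, h 1 (by norm_num), h 2 (by norm_num), h 3 (by norm_num)]

/-! ### From array contents to the multilinear form -/

namespace RealRAM
namespace Alg

variable {m tot : ℕ} {sz : ℕ → ℕ} {s : Store}

/-- `K c (4 a + b)` is the real part of the product of the units number `c`, `a` and `b`. -/
def IsUnitTable (K : ℕ → ℕ → ℝ) : Prop :=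
  ∀ t x y : ℕ → ℝ, ∑ a ∈ Finset.range 4, x a * ∑ b ∈ Finset.range 4,
    (∑ c ∈ Finset.range 4, t c * K c (4 * a + b)) * y b =
      (quatAt y 0 * (quatAt x 0 * quatAt t 0)).re

/-- For each pair of units exactly one third unit gives a product with nonzero real part. Hence
sixteen signs are stored and the other entries rely on the array being zero initially. -/
theorem exec_unitTable (ω : ℕ → ℝ) (h : ∀ i j, s.real 6 i j = 0) :
    IsUnitTable ((exec ω unitTable s).real 6) := by
  intro t x y
  simp only [Finset.sum_range_succ, Finset.sum_range_zero, unitTable, exec, Store.setReal,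
    Store.tick, NExpr.eval, RExpr.eval, quatAt, CQuat.mul_re, CQuat.mul_imI, CQuat.mul_imJ,
    CQuat.mul_imK]
  simp [h]
  ring

/-- The sample number `p` of block `k` after normalization, if the samples start at `D`. -/
def normalized (ω : ℕ → ℝ) (sz : ℕ → ℕ) (D k p : ℕ) : ℝ :=
  ω (D + (∑ j ∈ Finset.range k, 4 * sz j) + p) / Real.exp (Real.log
    (∑ q ∈ Finset.range (4 * sz k), ω (D + (∑ j ∈ Finset.range k, 4 * sz j) + q) ^ 2) / 2)

/-- The last clause makes the routine repeatable: the original tensor in columns `0` to `3` and the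
zero rows beyond `tot` are intact for the next round. -/
theorem exec_contractAll (ω : ℕ → ℝ) (h : Format m tot sz s)
    (hz : ∀ x, tot ≤ x → ∀ y, s.real 1 x y = 0) :
    (exec ω contractAll s).drawn = s.drawn + ∑ j ∈ Finset.range m, 4 * sz j ∧
    (∀ k < m, ∀ p < 4 * sz k,
      (exec ω contractAll s).real 5 k p = normalized ω sz s.drawn k p) ∧
    (∀ t, quatAt ((exec ω contractAll s).real 1 t) m =
      contraction sz (fun k => quatAt (normalized ω sz s.drawn k)) (fun t => quatAt (s.real 1 t) 0)
        m t) ∧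
    (∀ x y, (tot ≤ x ∨ y < 4) → (exec ω contractAll s).real 1 x y = s.real 1 x y) := by
  have hz' : ∀ x, tot ≤ x → ∀ i, quatAt (s.real 1 x) i = 0 := by
    intro x hx i
    simp only [quatAt, hz x hx]
    rfl
  have key := loop_induction ω 13 samp (.seq sampleBlock contractBlock) s
    (fun K s' => s'.drawn = s.drawn + ∑ j ∈ Finset.range K, 4 * sz j ∧
      (∀ k < K, ∀ p < 4 * sz k, s'.real 5 k p = normalized ω sz s.drawn k p) ∧
      (∀ t, quatAt (s'.real 1 t) K =
        contraction sz (fun k => quatAt (normalized ω sz s.drawn k))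
          (fun t => quatAt (s.real 1 t) 0) K t) ∧
      (∀ x y, (tot ≤ x ∨ y < 4) → s'.real 1 x y = s.real 1 x y)) ?_ ?_ (fun _ _ _ _ h => h)
  · rw [eval_samp h] at key
    exact key
  · exact ⟨rfl, fun k hk => absurd hk (Nat.not_lt_zero _), fun t => rfl, fun _ _ _ => rfl⟩
  rintro K hK s' hn hr hv ⟨i1, i2, i3, i4⟩
  have h' : Format m tot sz s' := h.of_nat_eq fun a ha => hn a (by omega) (by
    have : (Prog.seq sampleBlock contractBlock).natWrites =
      [14, 10, 11, 12, 10, 11, 12, 10, 11, 12, 10, 11, 12, 10, 11, 12] := rfl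
    rw [this]; simp; omega)
  obtain ⟨a1, a2, a3⟩ := exec_sampleBlock ω h' K hv
  rw [exec]
  obtain ⟨s₁, hs₁⟩ : ∃ t, t = exec ω sampleBlock s' := ⟨_, rfl⟩
  rw [← hs₁] at a1 a2 a3 ⊢
  have h₁ : Format m tot sz s₁ := hs₁ ▸ h'.exec _ _ (by decide)
  have hv₁ : s₁.nat 13 0 = K := by rw [hs₁, exec_nat_of_notMem _ _ _ _ (by decide), hv]
  have hr₁ : s₁.real 1 = s'.real 1 := by rw [hs₁, exec_real_of_notMem _ _ _ _ (by decide)]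
  obtain ⟨b1, b2⟩ := exec_contractBlock ω h₁ K hv₁
  have hr5 : (exec ω contractBlock s₁).real 5 = s₁.real 5 :=
    exec_real_of_notMem _ _ _ _ (by decide)
  have hnew : ∀ p < 4 * sz K, s₁.real 5 K p = normalized ω sz s.drawn K p := by
    intro p hp
    rw [a2 p hp, i1]
    rfl
  refine ⟨?_, fun k hk p hp => ?_, fun t => ?_, fun x y hxy => ?_⟩
  · rw [exec_drawn_of_gaussFree _ _ _ (by decide), a1, i1, Finset.sum_range_succ, add_assoc]
  · rw [hr5]
    rcases Nat.lt_succ_iff_lt_or_eq.mp hk with hk' | rfl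
    · rw [a3 k (by omega)]
      exact i2 k hk' p hp
    · exact hnew p hp
  · rcases lt_or_ge t tot with ht | ht
    · rw [b1 t ht, contraction]
      refine Finset.sum_congr rfl fun i hi => ?_
      rw [hr₁, i3]
      congr 1
      have := Finset.mem_range.mp hi
      exact quatAt_congr fun a ha => hnew _ (by omega)
    · rw [contraction_eq_zero (fun t ht => hz' t ht 0) _ _ ht, ← hz' t ht (K + 1)]
      refine quatAt_congr fun a ha => ?_
      rw [b2 _ _ (Or.inl ht), hr₁, i4 _ _ (Or.inl ht)]
  · rw [b2 _ _ (by omega), hr₁, i4 _ _ hxy]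

/-- Unfolding the last two contractions gives a double sum of products of three quaternions, and the
unit table expresses their real parts in real coordinates. The size bounds ensure that the quotient
and remainder tables cover all coordinates used. -/
theorem dotProduct_bilinearMatrix (hm : sz m ≤ tot) (hm' : sz (m + 1) ≤ tot)
    (hdiv : ∀ i < tot, ∀ a < 4, s.nat 4 (4 * i + a) = i ∧ s.nat 5 (4 * i + a) = a)
    (hK : IsUnitTable (s.real 6)) (T : ℕ → CQuat) (X : ℕ → ℕ → CQuat)
    (hT : ∀ t, quatAt (s.real 1 t) m = contraction sz X T m t) (x y : ℕ → ℝ)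
    (hx : ∀ i < sz m, X m i = quatAt x i) (hy : ∀ i < sz (m + 1), X (m + 1) i = quatAt y i) :
    vecOf (4 * sz m) x ⬝ᵥ (bilinearMatrix m sz s).mulVec (vecOf (4 * sz (m + 1)) y) =
      (contraction sz X T (m + 2) 0).re := by
  have hsum : vecOf (4 * sz m) x ⬝ᵥ (bilinearMatrix m sz s).mulVec (vecOf (4 * sz (m + 1)) y) =
      ∑ p ∈ Finset.range (4 * sz m), x p * ∑ q ∈ Finset.range (4 * sz (m + 1)),
        (∑ c ∈ Finset.range 4, s.real 1 (s.nat 4 p + sz m * s.nat 4 q) (4 * m + c) *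
          s.real 6 c (4 * s.nat 5 p + s.nat 5 q)) * y q := by
    rw [Finset.sum_range]
    simp only [Finset.sum_range (n := 4 * sz (m + 1))]
    rfl
  rw [hsum]
  rw [sum_range_four_mul]
  simp only [sum_range_four_mul (sz (m + 1))]
  conv_rhs =>
    simp only [contraction, mul_zero, add_zero, CQuat.sum_re, Finset.mul_sum]
    rw [Finset.sum_comm]
  refine Finset.sum_congr rfl fun i hi => ?_
  rw [Finset.mem_range] at hi
  have hswap : ∀ (f : ℕ → ℝ) (g : ℕ → ℕ → ℝ), ∑ a ∈ Finset.range 4, f a *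
      ∑ j ∈ Finset.range (sz (m + 1)), g a j =
      ∑ j ∈ Finset.range (sz (m + 1)), ∑ a ∈ Finset.range 4, f a * g a j := by
    intro f g
    rw [Finset.sum_comm]
    exact Finset.sum_congr rfl fun a _ => Finset.mul_sum _ _ _
  rw [hswap]
  refine Finset.sum_congr rfl fun j hj => ?_
  rw [Finset.mem_range] at hj
  rw [hx i hi, hy j hj, ← hT, quatAt_eq x i, quatAt_eq y j, quatAt_eq (s.real 1 _) m,
    ← hK (fun c => s.real 1 (i + sz m * j) (4 * m + c)) (fun a => x (4 * i + a))
      (fun b => y (4 * j + b))]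
  refine Finset.sum_congr rfl fun a ha => ?_
  rw [Finset.mem_range] at ha
  congr 1
  refine Finset.sum_congr rfl fun b hb => ?_
  rw [Finset.mem_range] at hb
  rw [(hdiv i (by omega) a ha).1, (hdiv i (by omega) a ha).2, (hdiv j (by omega) b hb).1,
    (hdiv j (by omega) b hb).2]

end Alg
end RealRAM

/-! ## Real coordinates of commutative quaternion vectors -/

/-- The real components of a sequence of commutative quaternions. -/
def realParts (f : ℕ → CQuat) (p : ℕ) : ℝ :=
  if p % 4 = 0 then (f (p / 4)).re else if p % 4 = 1 then (f (p / 4)).imI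
  else if p % 4 = 2 then (f (p / 4)).imJ else (f (p / 4)).imK

theorem quatAt_realParts (f : ℕ → CQuat) (i : ℕ) : quatAt (realParts f) i = f i := by
  have h0 : 4 * i / 4 = i := by omega
  have h1 : (4 * i + 1) / 4 = i ∧ (4 * i + 1) % 4 = 1 := by omega
  have h2 : (4 * i + 2) / 4 = i ∧ (4 * i + 2) % 4 = 2 := by omega
  have h3 : (4 * i + 3) / 4 = i ∧ (4 * i + 3) % 4 = 3 := by omega
  simp [quatAt, realParts, h0, h1, h2, h3]

theorem hnorm_quatAt (n : ℕ) (f : ℕ → ℝ) :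
    hnorm (fun i : Fin n => quatAt f i) = Real.sqrt (vecOf (4 * n) f ⬝ᵥ vecOf (4 * n) f) := by
  unfold hnorm
  congr 1
  simp only [dotProduct, vecOf]
  rw [← Finset.sum_range (fun p => f p * f p), sum_range_four_mul, Finset.sum_range]
  refine Finset.sum_congr rfl fun i _ => ?_
  simp [quatAt, Finset.sum_range_succ, sq]

theorem quatAt_mem_hsphere {n : ℕ} {f : ℕ → ℝ} :
    (fun i : Fin n => quatAt f i) ∈ hsphere n ↔ vecOf (4 * n) f ⬝ᵥ vecOf (4 * n) f = 1 := by
  rw [hsphere, Set.mem_ofPred_eq, hnorm_quatAt, Real.sqrt_eq_one]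

/-- Extension of a tuple by zero. -/
def extendBlocks {d : ℕ} {n : Fin d → ℕ} (x : Blocks n) (k i : ℕ) : CQuat :=
  if hk : k < d then if hi : i < n ⟨k, hk⟩ then x ⟨k, hk⟩ ⟨i, hi⟩ else 0 else 0

/-- Extension of the block sizes by zero. -/
def extendSizes {d : ℕ} (n : Fin d → ℕ) (k : ℕ) : ℕ := if hk : k < d then n ⟨k, hk⟩ else 0

theorem extendBlocks_apply {d : ℕ} {n : Fin d → ℕ} (x : Blocks n) (k : Fin d) (i : Fin (n k)) :
    extendBlocks x k i = x k i := by
  simp [extendBlocks]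

theorem extendSizes_apply {d : ℕ} (n : Fin d → ℕ) (k : Fin d) : extendSizes n k = n k := by
  simp [extendSizes]

theorem form_eq_extend {d : ℕ} {n : Fin d → ℕ} (F : HTensor n) (x : Blocks n) :
    form F x = contraction (extendSizes n) (extendBlocks x) (flatten F) d 0 :=
  form_eq_contraction F x _ _ (extendSizes_apply n) (extendBlocks_apply x)

/-! ### Correctness of a round and of the loop over rounds -/

namespace RealRAM
namespace Alg

variable {m : ℕ} {n : Fin (m + 2) → ℕ}

/-- The samples for one round. -/
def samples (n : Fin (m + 2) → ℕ) (ω : ℕ → ℝ) (D : ℕ) : Blocks fun k : Fin m => n (k.castAdd 2) :=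
  fun k i => quatAt (normalized ω (extendSizes n) D k) i

/-- The part of the memory on which the rounds depend. -/
structure Ready (F : HTensor n) (s : Store) : Prop where
  format : Format m (∏ k, n k) (extendSizes n) s
  div : ∀ i < ∏ k, n k, ∀ a < 4, s.nat 4 (4 * i + a) = i ∧ s.nat 5 (4 * i + a) = a
  table : IsUnitTable (s.real 6)
  zero : ∀ x, ∏ k, n k ≤ x → ∀ y, s.real 1 x y = 0
  tensor : ∀ t, quatAt (s.real 1 t) 0 = flatten F t

/-- Only strict improvement overwrites the stored tuple, so a tie keeps the earlier one. -/
theorem exec_update {tot : ℕ} {sz : ℕ → ℕ} {s : Store} (ω : ℕ → ℝ) (h : Format m tot sz s) :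
    (s.real 19 0 0 ≤ s.real 4 0 0 ∧ (exec ω update s).real 4 = s.real 4 ∧
      (exec ω update s).real 2 = s.real 2) ∨
    (s.real 4 0 0 < s.real 19 0 0 ∧ (exec ω update s).real 4 0 0 = s.real 19 0 0 ∧
      ∀ k < m + 2, ∀ p < 4 * sz k, (exec ω update s).real 2 k p = s.real 5 k p) := by
  unfold update
  rw [exec]
  by_cases hc : s.real 19 0 0 ≤ s.real 4 0 0
  · left
    rw [if_pos (by simpa [RExpr.eval, NExpr.eval] using hc)]
    exact ⟨hc, rfl, rfl⟩
  · right
    rw [if_neg (by simpa [RExpr.eval, NExpr.eval] using hc), exec]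
    obtain ⟨s₁, hs₁⟩ : ∃ t, t = exec ω (.setReal 4 (.const 0) (.const 0) (cell 19))
      (s.tick ((cell 19).cost + (cell 4).cost + 1)) := ⟨_, rfl⟩
    rw [← hs₁]
    have h₁ : Format m tot sz s₁ := hs₁ ▸ h.of_nat_eq fun _ _ => rfl
    refine ⟨not_le.mp hc, ?_, ?_⟩
    · rw [exec_real_of_notMem _ _ _ _ (by decide), hs₁]
      simp [exec, Store.setReal, Store.tick, NExpr.eval, RExpr.eval]
    · have hr5 : s₁.real 5 = s.real 5 := by
        rw [hs₁, exec_real_of_notMem _ _ _ _ (by decide)]; rfl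
      have key := (exec_fill ω 2 ord (dim P) P Q (.const 1) (.arr 5 P Q) s₁ (m + 2)
        (fun k => 4 * sz k) (fun _ _ => 1) (fun p _ => p) (fun _ q => q)
        (fun p q _ => s.real 5 p q) (by norm_num) (by simp [NExpr.eval, h₁.ord])
        (fun p _ q s' h' => by simp [NExpr.eval, h'.nat_p, (h'.format h₁).size])
        (fun p _ q _ s' h' => ⟨rfl, h'.nat_p, h'.nat_q⟩)
        (fun p hp q hq p' hp' q' hq' h1 h2 => ⟨h1, h2⟩)
        (fun p hp q hq t _ s' h' ht hu => by
          simp [NExpr.eval, RExpr.eval, h'.nat_p, h'.nat_q, h'.real, hr5])).1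
      intro k hk p hp
      simpa using key k hk p hp

theorem size_le_prod {d : ℕ} {n : Fin d → ℕ} (hn : ∀ k, 1 ≤ n k) (k : Fin d) :
    n k ≤ ∏ k, n k :=
  Finset.single_le_prod' (fun i _ => hn i) (Finset.mem_univ k)

/-- Every competitor with the same first blocks becomes a pair of real unit vectors, so optimality
in `exec_solve` is optimality for the form. The memory that matters is unchanged, so rounds can be
iterated. -/
theorem exec_round (ω : ℕ → ℝ) (F : HTensor n) (hn : ∀ k, 1 ≤ n k) {s : Store} (h : Ready F s) :
    Ready F (exec ω round s) ∧
    (exec ω round s).drawn = s.drawn + ∑ j ∈ Finset.range m, 4 * extendSizes n j ∧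
    ∃ z : Blocks n, IsRoundResult F (samples n ω s.drawn) z ∧
      (((form F z).re ≤ s.real 4 0 0 ∧ (exec ω round s).real 4 = s.real 4 ∧
        (exec ω round s).real 2 = s.real 2) ∨
      (s.real 4 0 0 < (form F z).re ∧ (exec ω round s).real 4 0 0 = (form F z).re ∧
        output n (exec ω round s) = z)) := by
  set sz := extendSizes n with hsz
  have hszl : sz m = n (Fin.natAdd m 0) := extendSizes_apply n (Fin.natAdd m 0)
  have hszr : sz (m + 1) = n (Fin.natAdd m 1) := extendSizes_apply n (Fin.natAdd m 1)
  obtain ⟨c1, c2, c3, c4⟩ := exec_contractAll ω h.format h.zero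
  simp only [h.tensor] at c3
  have hr : (exec ω round s).real 6 = s.real 6 := exec_real_of_notMem _ _ _ _ (by decide)
  have hn4 : (exec ω round s).nat 4 = s.nat 4 := exec_nat_of_notMem _ _ _ _ (by decide)
  have hn5 : (exec ω round s).nat 5 = s.nat 5 := exec_nat_of_notMem _ _ _ _ (by decide)
  have hround : exec ω round s = exec ω update (exec ω solve (exec ω contractAll s)) := rfl
  have hr1 : (exec ω round s).real 1 = (exec ω contractAll s).real 1 := by
    rw [hround, exec_real_of_notMem _ _ _ _ (by decide), exec_real_of_notMem _ _ _ _ (by decide)]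
  have hready : Ready F (exec ω round s) := by
    refine ⟨h.format.exec _ _ (by decide), by rw [hn4, hn5]; exact h.div, hr ▸ h.table, ?_, ?_⟩
    · intro x hx y
      rw [hr1, c4 x y (Or.inl hx), h.zero x hx]
    · intro t
      rw [hr1, ← h.tensor]
      exact quatAt_congr fun a ha => c4 _ _ (Or.inr (by omega))
  have hdrawn : (exec ω round s).drawn =
      s.drawn + ∑ j ∈ Finset.range m, 4 * sz j := by
    rw [hround, exec_drawn_of_gaussFree _ _ _ (by decide),
      exec_drawn_of_gaussFree _ _ _ (by decide), c1]
  refine ⟨hready, hdrawn, ?_⟩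
  obtain ⟨s₁, hs₁⟩ : ∃ t, t = exec ω contractAll s := ⟨_, rfl⟩
  rw [← hs₁] at c1 c2 c3 c4 hround
  have h₁ : Format m (∏ k, n k) sz s₁ := hs₁ ▸ h.format.exec _ _ (by decide)
  have hdiv₁ : ∀ i < ∏ k, n k, ∀ a < 4, s₁.nat 4 (4 * i + a) = i ∧ s₁.nat 5 (4 * i + a) = a := by
    rw [hs₁, exec_nat_of_notMem _ _ _ 4 (by decide), exec_nat_of_notMem _ _ _ 5 (by decide)]
    exact h.div
  have hK₁ : IsUnitTable (s₁.real 6) := by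
    rw [hs₁, exec_real_of_notMem _ _ _ _ (by decide)]
    exact h.table
  have hl := size_le_prod hn (Fin.natAdd m 0)
  have hrr := size_le_prod hn (Fin.natAdd m 1)
  obtain ⟨d1, d2, d3, d4, d5⟩ := exec_solve ω h₁ (by rw [hszl]; exact hn _) (by rw [hszr]; exact hn _)
  obtain ⟨s₂, hs₂⟩ : ∃ t, t = exec ω solve s₁ := ⟨_, rfl⟩
  rw [← hs₂] at d1 d2 d3 d4 d5 hround
  have h₂ : Format m (∏ k, n k) sz s₂ := hs₂ ▸ h₁.exec _ _ (by decide)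
  let z : Blocks n := fun k i => quatAt (s₂.real 5 k) i
  -- The contracted tensor depends on the first `m` blocks only, hence is common to all competitors.
  have hfirst : ∀ x ∈ bilinearFeasible (samples n ω s.drawn), ∀ t,
      quatAt (s₁.real 1 t) m = contraction sz (extendBlocks x) (flatten F) m t := by
    intro x hx t
    rw [c3 t]
    refine contraction_congr (fun j hj i hi => ?_) t
    have hi' : i < n ((⟨j, hj⟩ : Fin m).castAdd 2) :=
      hi.trans_eq (extendSizes_apply n ((⟨j, hj⟩ : Fin m).castAdd 2))
    have := congrFun (hx.1 ⟨j, hj⟩) ⟨i, hi'⟩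
    have e := extendBlocks_apply x ((⟨j, hj⟩ : Fin m).castAdd 2) ⟨i, hi'⟩
    exact (e.trans this).symm
  have hzmem : z ∈ bilinearFeasible (samples n ω s.drawn) := by
    refine ⟨fun k => ?_, fun j => ?_⟩
    · funext i
      simp only [z, samples]
      refine quatAt_congr fun a ha => ?_
      have hi : (i : ℕ) < sz (k : ℕ) :=
        i.2.trans_eq (extendSizes_apply n (k.castAdd 2)).symm
      have hk := k.2
      rw [Fin.val_castAdd, d5 _ (by omega) (by omega)]
      exact c2 k k.2 _ (show 4 * (i : ℕ) + a < 4 * sz k by omega)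
    · rw [show z (Fin.natAdd m j) = fun i : Fin (n (Fin.natAdd m j)) =>
        quatAt (s₂.real 5 ((Fin.natAdd m j : Fin (m + 2)) : ℕ)) i from rfl, quatAt_mem_hsphere]
      fin_cases j
      · have := d1
        rw [hszl] at this
        exact this
      · have := d2
        rw [hszr] at this
        exact this
  have hform : ∀ x ∈ bilinearFeasible (samples n ω s.drawn), (form F x).re =
      vecOf (4 * sz m) (realParts (extendBlocks x m)) ⬝ᵥ (bilinearMatrix m sz s₁).mulVec
        (vecOf (4 * sz (m + 1)) (realParts (extendBlocks x (m + 1)))) := by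
    intro x hx
    rw [form_eq_extend, dotProduct_bilinearMatrix (hszl ▸ hl) (hszr ▸ hrr) hdiv₁ hK₁ _ _
      (hfirst x hx) _ _ (fun i _ => (quatAt_realParts _ i).symm)
      (fun i _ => (quatAt_realParts _ i).symm)]
  have hzform : (form F z).re = s₂.real 19 0 0 := by
    rw [form_eq_extend, d3, dotProduct_bilinearMatrix (hszl ▸ hl) (hszr ▸ hrr) hdiv₁ hK₁
      (flatten F) (extendBlocks z) (hfirst z hzmem) (s₂.real 5 m) (s₂.real 5 (m + 1))]
    · intro i hi
      have := extendBlocks_apply z (Fin.natAdd m 0) ⟨i, hszl ▸ hi⟩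
      exact this
    · intro i hi
      have := extendBlocks_apply z (Fin.natAdd m 1) ⟨i, hszr ▸ hi⟩
      exact this
  have hunit : ∀ x ∈ bilinearFeasible (samples n ω s.drawn), ∀ j : Fin 2,
      vecOf (4 * n (Fin.natAdd m j)) (realParts (extendBlocks x (Fin.natAdd m j : Fin (m + 2)))) ⬝ᵥ
        vecOf (4 * n (Fin.natAdd m j)) (realParts (extendBlocks x (Fin.natAdd m j : Fin (m + 2))))
        = 1 := by
    intro x hx j
    rw [← quatAt_mem_hsphere]
    convert hx.2 j using 1
    funext i
    rw [quatAt_realParts, extendBlocks_apply]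
  refine ⟨z, ⟨hzmem, fun x hx => ?_⟩, ?_⟩
  · simp only [Set.mem_ofPred_eq]
    rw [hzform, hform x hx]
    refine d4 _ _ ?_ ?_
    · have := hunit x hx 0
      rw [← hszl] at this
      exact this
    · have := hunit x hx 1
      rw [← hszr] at this
      exact this
  · have hr4 : s₂.real 4 = s.real 4 := by
      rw [hs₂, exec_real_of_notMem _ _ _ _ (by decide), hs₁,
        exec_real_of_notMem _ _ _ _ (by decide)]
    have hr2 : s₂.real 2 = s.real 2 := by
      rw [hs₂, exec_real_of_notMem _ _ _ _ (by decide), hs₁,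
        exec_real_of_notMem _ _ _ _ (by decide)]
    have := exec_update ω h₂
    rw [← hround, ← hzform, hr4, hr2] at this
    rcases this with ⟨u1, u2, u3⟩ | ⟨u1, u2, u3⟩
    · exact Or.inl ⟨u1, u2, u3⟩
    · refine Or.inr ⟨u1, u2, ?_⟩
      funext k i
      have hi : (i : ℕ) < sz k := i.2.trans_eq (extendSizes_apply n k).symm
      have e : output n (exec ω round s) k i = quatAt ((exec ω round s).real 2 k) i := rfl
      rw [e]
      exact quatAt_congr fun a ha => u3 k k.2 _ (by omega)

/-- The value of an exactly solved bilinear problem is nonnegative. -/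
theorem _root_.IsRoundResult.form_nonneg {F : HTensor n}
    {ξ : Blocks fun k : Fin m => n (k.castAdd 2)} {z : Blocks n} (h : IsRoundResult F ξ z) :
    0 ≤ (form F z).re := by
  let l : Fin (m + 2) := Fin.natAdd m 1
  -- Negating the last block preserves the constraints and changes the sign of the value; maximality
  -- then gives `-v ≤ v`.
  let z' : Blocks n := Function.update z l (fun i => -z l i)
  have hform : form F z' = -form F z := by
    unfold form
    rw [← Finset.sum_neg_distrib]
    refine Finset.sum_congr rfl fun i _ => ?_
    have : ∏ k, z' k (i k) = -∏ k, z k (i k) := by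
      rw [← Finset.mul_prod_erase _ _ (Finset.mem_univ l),
        ← Finset.mul_prod_erase Finset.univ (fun k => z k (i k)) (Finset.mem_univ l)]
      have h1 : z' l (i l) = -z l (i l) := by simp [z']
      have h2 : ∏ k ∈ Finset.univ.erase l, z' k (i k) = ∏ k ∈ Finset.univ.erase l, z k (i k) := by
        refine Finset.prod_congr rfl fun k hk => ?_
        have : k ≠ l := Finset.ne_of_mem_erase hk
        simp [z', this]
      rw [h1, h2, neg_mul]
    rw [this, mul_neg]
  have hmem : z' ∈ bilinearFeasible ξ := by
    refine ⟨fun k => ?_, fun j => ?_⟩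
    · have hne : k.castAdd 2 ≠ l := by
        intro hc
        have := congrArg Fin.val hc
        simp [l] at this
        have := k.2
        omega
      simp only [z', Function.update_of_ne hne]
      exact h.1.1 k
    · by_cases hj : Fin.natAdd m j = l
      · have h1 := h.1.2 j
        rw [hj] at h1 ⊢
        simp only [z', Function.update_self]
        simp only [hsphere, Set.mem_ofPred_eq, hnorm] at h1 ⊢
        rw [← h1]
        simp
      · simp only [z', Function.update_of_ne hj]
        exact h.1.2 j
  have := h.2 hmem
  simp only [Set.mem_ofPred_eq, hform, CQuat.neg_re] at this
  linarith

/-- The stored best value starts at `-1`. Round values are nonnegative, so the first round always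
overwrites it, and from then on the stored tuple is a best one among the rounds so far. -/
theorem exec_rounds (ω : ℕ → ℝ) (F : HTensor n) (hn : ∀ k, 1 ≤ n k) {s : Store} (h : Ready F s)
    (R : ℕ) (hR : s.nat 3 0 = R) (hR0 : 0 < R) (hd : s.drawn = 0) (hb : s.real 4 0 0 = -1) :
    IsAlgorithmResult F
      (fun r : Fin R => samples n ω (r * ∑ j ∈ Finset.range m, 4 * extendSizes n j))
      (output n (exec ω (.loop 15 rounds round) s)) := by
  have key := loop_induction ω 15 rounds round s
    (fun t s' => Ready F s' ∧ s'.drawn = t * ∑ j ∈ Finset.range m, 4 * extendSizes n j ∧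
      ∃ z : ℕ → Blocks n,
        (∀ r < t, IsRoundResult F
          (samples n ω (r * ∑ j ∈ Finset.range m, 4 * extendSizes n j)) (z r)) ∧
        ((t = 0 ∧ s'.real 4 0 0 = -1) ∨ ∃ r < t, output n s' = z r ∧
          s'.real 4 0 0 = (form F (z r)).re ∧ ∀ r' < t, (form F (z r')).re ≤ (form F (z r)).re))
    ?_ ?_ ?_
  · have hRe : rounds.eval s = R := by simp [NExpr.eval, hR]
    rw [hRe] at key
    obtain ⟨-, -, z, hz, hz'⟩ := key
    rcases hz' with ⟨h0, -⟩ | ⟨r, hr, ho, -, hmax⟩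
    · omega
    · exact ⟨fun r => z r, fun r => hz r r.2, ⟨r, hr⟩, ho, fun r' => hmax r' r'.2⟩
  · refine ⟨⟨h.format.of_nat_eq fun _ _ => rfl, h.div, h.table, h.zero, h.tensor⟩,
      by simp [Store.tick, hd], fun _ _ _ => 0, fun r hr => absurd hr (Nat.not_lt_zero _),
      Or.inl ⟨rfl, hb⟩⟩
  · rintro t ht s' hn' hr' hv ⟨hready, hdr, z, hz, hz'⟩
    obtain ⟨g1, g2, z₀, g3, g4⟩ := exec_round ω F hn hready
    rw [hdr] at g3 g2
    refine ⟨g1, by rw [g2]; ring, Function.update z t z₀, fun r hr => ?_, Or.inr ?_⟩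
    · rcases Nat.lt_succ_iff_lt_or_eq.mp hr with h' | rfl
      · rw [Function.update_of_ne h'.ne]; exact hz r h'
      · rw [Function.update_self]; exact g3
    · have hnn := g3.form_nonneg
      rcases g4 with ⟨u1, u2, u3⟩ | ⟨u1, u2, u3⟩
      · rcases hz' with ⟨-, h4⟩ | ⟨r, hr, ho, hv4, hmax⟩
        · rw [h4] at u1; linarith
        · refine ⟨r, by omega, ?_, ?_, fun r' hr' => ?_⟩
          · rw [Function.update_of_ne hr.ne, ← ho]
            funext k i
            simp only [output, u3]
          · rw [u2, Function.update_of_ne hr.ne, hv4]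
          · rw [Function.update_of_ne hr.ne]
            rcases Nat.lt_succ_iff_lt_or_eq.mp hr' with h' | rfl
            · rw [Function.update_of_ne h'.ne]; exact hmax r' h'
            · rw [Function.update_self, ← hv4]; exact u1
      · refine ⟨t, by omega, by rw [Function.update_self, u3], by rw [Function.update_self, u2],
          fun r' hr' => ?_⟩
        rw [Function.update_self]
        rcases Nat.lt_succ_iff_lt_or_eq.mp hr' with h' | rfl
        · rw [Function.update_of_ne h'.ne]
          rcases hz' with ⟨h0, -⟩ | ⟨r, hr, ho, hv4, hmax⟩
          · omega
          · rw [hv4] at u1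
            exact (hmax r' h').trans u1.le
        · rw [Function.update_self]
  · rintro t s' w k ⟨hready, hrest⟩
    refine ⟨⟨hready.format.of_nat_eq fun a ha => ?_, ?_, hready.table, hready.zero, hready.tensor⟩,
      hrest⟩
    · funext i
      have : a ≠ 15 := by omega
      simp [Store.setNat, Store.tick, this]
    · intro i hi a ha
      have := hready.div i hi a ha
      simpa [Store.setNat, Store.tick] using this

end Alg
end RealRAM

/-! ### Initialization and correctness of the whole program -/

namespace RealRAM
namespace Alg

variable {m : ℕ} {n : Fin (m + 2) → ℕ}

theorem exec_product (ω : ℕ → ℝ) {s : Store} {d : ℕ} {sz : ℕ → ℕ} (h0 : s.nat 0 0 = d)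
    (h1 : ∀ k, s.nat 1 k = sz k) :
    (exec ω product s).nat 2 0 = ∏ k ∈ Finset.range d, sz k := by
  unfold product
  rw [exec]
  obtain ⟨s₁, hs₁⟩ : ∃ t, t = exec ω (.setNat 2 (.const 0) (.const 1)) s := ⟨_, rfl⟩
  rw [← hs₁]
  have hn0 : s₁.nat 0 = s.nat 0 := hs₁ ▸ exec_nat_of_notMem _ _ _ _ (by decide)
  have hn1 : s₁.nat 1 = s.nat 1 := hs₁ ▸ exec_nat_of_notMem _ _ _ _ (by decide)
  have he : ord.eval s₁ = d := by simp [NExpr.eval, hn0, h0]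
  have key := loop_induction ω 13 ord (.setNat 2 (.const 0) (.mul total (size K))) s₁
    (fun t s' => s'.nat 2 0 = ∏ k ∈ Finset.range t, sz k)
    (by simp [hs₁, exec, Store.setNat, Store.tick, NExpr.eval]) ?_
    (fun _ _ _ _ h => by simpa [Store.setNat, Store.tick] using h)
  · rwa [he] at key
  · intro t _ s' hn _ hv hI
    have e1 : s'.nat 1 = s.nat 1 := (hn 1 (by decide) (by decide)).trans hn1
    simp [exec, Store.setNat, Store.tick, NExpr.eval, Finset.prod_range_succ, hI, hv, e1, h1]

/-- For `x > 1` the logarithm is positive, so `exp (log · / 2)` really is its square root. -/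
theorem exp_log_mul_log {x : ℕ} (hx : 1 < x) (a : ℝ) :
    Real.exp (Real.log x * a) * Real.exp (Real.log (Real.log x) / 2) =
      (x : ℝ) ^ a * Real.sqrt (Real.log x) := by
  have h1 : (1 : ℝ) < x := by exact_mod_cast hx
  rw [Real.rpow_def_of_pos (by linarith), Real.sqrt_eq_rpow,
    Real.rpow_def_of_pos (Real.log_pos h1)]
  ring_nf

theorem exec_roundsReal (ω : ℕ → ℝ) {s : Store} {m tot : ℕ} {sz : ℕ → ℕ} {ε γ c : ℝ}
    (h : Format m tot sz s) (hε : s.real 0 0 0 = ε) (hγ : s.real 0 0 1 = γ)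
    (hc : s.real 0 0 2 = c) :
    (exec ω roundsReal s).real 3 0 0 = Real.log (1 / ε) * ∏ k ∈ Finset.range m,
      (1 / c * ((sz k : ℝ) ^ (9 / 2 * γ) * Real.sqrt (Real.log (sz k)))) := by
  unfold roundsReal
  rw [exec]
  obtain ⟨s₁, hs₁⟩ : ∃ t, t = exec ω (.setReal 3 (.const 0) (.const 0)
    (.log (.div (.ofNat (.const 1)) (.arr 0 (.const 0) (.const 0))))) s := ⟨_, rfl⟩
  rw [← hs₁]
  have hnat : s₁.nat = s.nat := by rw [hs₁]; rfl
  have hr0 : s₁.real 0 = s.real 0 := hs₁ ▸ exec_real_of_notMem _ _ _ _ (by decide)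
  have he : samp.eval s₁ = m := by simp [NExpr.eval, hnat, h.ord]
  have key := loop_induction ω 13 samp (.ifNat (size K) (.const 1)
    (.setReal 3 (.const 0) (.const 0) (.ofNat (.const 0)))
    (.setReal 3 (.const 0) (.const 0) (.mul (cell 3)
      (.mul (.div (.ofNat (.const 1)) (.arr 0 (.const 0) (.const 2)))
      (.mul (.exp (.mul (.log (.ofNat (size K)))
        (.mul (.div (.ofNat (.const 9)) (.ofNat (.const 2))) (.arr 0 (.const 0) (.const 1)))))
      (sqrt (.log (.ofNat (size K))))))))) s₁
    (fun t s' => s'.real 3 0 0 = Real.log (1 / ε) * ∏ k ∈ Finset.range t,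
      (1 / c * ((sz k : ℝ) ^ (9 / 2 * γ) * Real.sqrt (Real.log (sz k)))))
    (by simp [hs₁, exec, Store.setReal, Store.tick, NExpr.eval, RExpr.eval, hε]) ?_
    (fun _ _ _ _ h => h)
  · rw [he] at key
    exact key
  · intro t _ s' hn hr hv hI
    have e1 : s'.nat 1 = s.nat 1 := (hn 1 (by decide) (by decide)).trans (by rw [hnat])
    have e0 : s'.real 0 = s.real 0 := (hr 0 (by decide)).trans hr0
    have hK : (size K).eval s' = sz t := by simp [NExpr.eval, hv, e1, h.size]
    have hle : (size K).eval s' ≤ (NExpr.const 1).eval s' ↔ sz t ≤ 1 := by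
      rw [hK]; rfl
    rw [exec, Finset.prod_range_succ]
    split
    · rename_i hc1
      have hsz := hle.mp hc1
      -- Here the factor is zero, whereas the machine's square root of `0` would be `exp 0 = 1`;
      -- hence the separate branch.
      have : Real.log (sz t) = 0 := by
        rcases Nat.le_one_iff_eq_zero_or_eq_one.mp hsz with h | h <;> simp [h]
      simp [exec, Store.setReal, Store.tick, NExpr.eval, RExpr.eval, this]
    · rename_i hc1
      have hsz : 1 < sz t := by rw [hle] at hc1; omega
      have := exp_log_mul_log hsz (9 / 2 * γ)
      simp only [exec, Store.setReal, Store.tick, NExpr.eval, RExpr.eval, hI, hv, e0, e1, h.size,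
        hγ, hc, and_self, if_true, Nat.cast_ofNat, Nat.cast_one]
      rw [this]
      ring

theorem exec_roundsNat (ω : ℕ → ℝ) (s : Store) :
    (exec ω roundsNat s).nat 3 0 = max 1 ⌈s.real 3 0 0⌉₊ := by
  unfold roundsNat
  rw [exec]
  have e : (exec ω (.ceil 3 (.const 0) (cell 3)) s).nat 3 0 = ⌈s.real 3 0 0⌉₊ := by
    simp [exec, NExpr.eval, RExpr.eval, Store.setNat, Store.tick]
  generalize exec ω (.ceil 3 (.const 0) (cell 3)) s = s₁ at e
  rw [exec]
  simp only [NExpr.eval, e]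
  split
  · rename_i h
    rw [max_eq_left (by omega)]
    simp [exec, NExpr.eval, Store.setNat, Store.tick]
  · rename_i h
    rw [max_eq_right (by omega)]
    exact e

theorem exec_divisions (ω : ℕ → ℝ) {s : Store} {tot : ℕ} (h : s.nat 2 0 = tot) :
    ∀ i < tot, ∀ a < 4, (exec ω divisions s).nat 4 (4 * i + a) = i ∧
      (exec ω divisions s).nat 5 (4 * i + a) = a := by
  have key := loop_induction ω 13 total (.loop 14 (.const 4)
    (.seq (.setNat 4 (.add (.mul (.const 4) K) J) K)
      (.setNat 5 (.add (.mul (.const 4) K) J) J))) s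
    (fun t s' => ∀ i < t, ∀ a < 4, s'.nat 4 (4 * i + a) = i ∧ s'.nat 5 (4 * i + a) = a)
    (fun i hi => absurd hi (Nat.not_lt_zero _)) ?_
    (fun _ _ _ _ h i hi a ha => by simpa [Store.setNat, Store.tick] using h i hi a ha)
  · have he : total.eval s = tot := by simp [NExpr.eval, h]
    rw [he] at key
    exact key
  · intro t _ s' hn _ hv hI
    have key₂ := loop_induction ω 14 (.const 4) (.seq (.setNat 4 (.add (.mul (.const 4) K) J) K)
        (.setNat 5 (.add (.mul (.const 4) K) J) J)) s'
      (fun b s'' => ∀ i a, a < 4 → (i < t ∨ (i = t ∧ a < b)) →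
        s''.nat 4 (4 * i + a) = i ∧ s''.nat 5 (4 * i + a) = a)
      (fun i a ha hia => hI i (by omega) a ha) ?_
      (fun _ _ _ _ h i a ha hia => by simpa [Store.setNat, Store.tick] using h i a ha hia)
    · exact fun i hi a ha => key₂ i a ha (by simp only [NExpr.eval]; omega)
    · intro b hb s'' hn' _ hv' hI' i a ha hia
      have hb4 : b < 4 := hb
      have e13 : s''.nat 13 = s'.nat 13 := hn' 13 (by decide) (by decide)
      have h13 : s''.nat 13 0 = t := by rw [e13, hv]
      by_cases hc : i = t ∧ a = b
      · obtain ⟨rfl, rfl⟩ := hc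
        simp [exec, Store.setNat, Store.tick, NExpr.eval, h13, hv']
      · have hne : ¬ (4 * i + a = 4 * t + b) := by omega
        have := hI' i a ha (by omega)
        simpa [exec, Store.setNat, Store.tick, NExpr.eval, h13, hv', hne] using this

theorem repetitions_eq (γ c ε : ℝ) (n : Fin (m + 2) → ℕ) :
    repetitions γ c ε n = max 1 ⌈Real.log (1 / ε) * ∏ k ∈ Finset.range m,
      (1 / c * ((extendSizes n k : ℝ) ^ (9 / 2 * γ) *
        Real.sqrt (Real.log (extendSizes n k))))⌉₊ := by
  have : ∀ k : Fin m, extendSizes n k = n (k.castAdd 2) := fun k =>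
    extendSizes_apply n (k.castAdd 2)
  rw [repetitions, Finset.prod_range]
  simp only [this]
  rw [Finset.prod_mul_distrib (f := fun _ => 1 / c), Finset.prod_const, Finset.card_univ,
    Fintype.card_fin, one_div_pow, mul_assoc]

/-- The store after the number of rounds has been determined. -/
def start (ω : ℕ → ℝ) (F : HTensor n) (ε γ c : ℝ) : Store :=
  exec ω roundsNat (exec ω roundsReal (exec ω product (input F ε γ c)))

theorem input_size (F : HTensor n) (ε γ c : ℝ) (k : ℕ) :
    (input F ε γ c).nat 1 k = extendSizes n k := by
  simp [input, extendSizes]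

theorem format_product (ω : ℕ → ℝ) (F : HTensor n) (ε γ c : ℝ) :
    Format m (∏ k, n k) (extendSizes n) (exec ω product (input F ε γ c)) where
  ord := by
    rw [exec_nat_of_notMem _ _ _ _ (by decide)]
    simp [input]
  size k := by
    rw [exec_nat_of_notMem _ _ _ _ (by decide), input_size]
  total := by
    rw [exec_product ω (d := m + 2) (by simp [input]) (input_size F ε γ c), Finset.prod_range]
    exact Finset.prod_congr rfl fun k _ => extendSizes_apply n k

theorem exec_roundsReal_input (ω : ℕ → ℝ) (F : HTensor n) (ε γ c : ℝ) :
    (exec ω roundsReal (exec ω product (input F ε γ c))).real 3 0 0 =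
      Real.log (1 / ε) * ∏ k ∈ Finset.range m,
      (1 / c * ((extendSizes n k : ℝ) ^ (9 / 2 * γ) *
        Real.sqrt (Real.log (extendSizes n k)))) := by
  apply exec_roundsReal ω (format_product ω F ε γ c) <;>
    rw [exec_real_of_notMem _ _ _ _ (by decide)] <;> simp [input]

theorem format_start (ω : ℕ → ℝ) (F : HTensor n) (ε γ c : ℝ) :
    Format m (∏ k, n k) (extendSizes n) (start ω F ε γ c) :=
  ((format_product ω F ε γ c).exec _ _ (by decide)).exec _ _ (by decide)

theorem start_rounds (ω : ℕ → ℝ) (F : HTensor n) (ε γ c : ℝ) :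
    (start ω F ε γ c).nat 3 0 = repetitions γ c ε n := by
  rw [start, exec_roundsNat, exec_roundsReal_input, repetitions_eq]

theorem start_real (ω : ℕ → ℝ) (F : HTensor n) (ε γ c : ℝ) (a : ℕ) (ha : a ≠ 3) :
    (start ω F ε γ c).real a = (input F ε γ c).real a := by
  rw [start, exec_real_of_notMem _ _ _ _ (by simp [roundsNat, Prog.realWrites]),
    exec_real_of_notMem _ _ _ _ (by simp [roundsReal, Prog.realWrites, ha]),
    exec_real_of_notMem _ _ _ _ (by simp [product, Prog.realWrites])]

theorem start_drawn (ω : ℕ → ℝ) (F : HTensor n) (ε γ c : ℝ) :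
    (start ω F ε γ c).drawn = 0 := by
  rw [start, exec_drawn_of_gaussFree _ _ _ (by decide),
    exec_drawn_of_gaussFree _ _ _ (by decide), exec_drawn_of_gaussFree _ _ _ (by decide)]
  rfl

/-- Deterministic: it holds for every sequence `ω`. Each round consumes the same number of variates,
so round `r` starts at `r` times that number. -/
theorem exec_program (ω : ℕ → ℝ) (F : HTensor n) (hn : ∀ k, 1 ≤ n k) (ε γ c : ℝ) :
    IsAlgorithmResult F
      (fun r : Fin (repetitions γ c ε n) =>
        samples n ω (r * ∑ j ∈ Finset.range m, 4 * extendSizes n j))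
      (output n (exec ω program (input F ε γ c))) := by
  have e : exec ω program (input F ε γ c) = exec ω mainPart (start ω F ε γ c) := rfl
  rw [e]
  unfold mainPart
  rw [exec, exec, exec]
  obtain ⟨s, hs⟩ : ∃ t, t = start ω F ε γ c := ⟨_, rfl⟩
  obtain ⟨s₁, hs₁⟩ : ∃ t, t = exec ω divisions s := ⟨_, rfl⟩
  obtain ⟨s₂, hs₂⟩ : ∃ t, t = exec ω unitTable s₁ := ⟨_, rfl⟩
  obtain ⟨s₃, hs₃⟩ : ∃ t, t = exec ω (.setReal 4 (.const 0) (.const 0)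
    (.sub (.ofNat (.const 0)) (.ofNat (.const 1)))) s₂ := ⟨_, rfl⟩
  rw [← hs, ← hs₁, ← hs₂, ← hs₃]
  have hf : Format m (∏ k, n k) (extendSizes n) s := hs ▸ format_start ω F ε γ c
  have hn3 : ∀ a, a ∉ divisions.natWrites → s₃.nat a = s.nat a := by
    intro a ha
    rw [hs₃, exec_nat_of_notMem _ _ _ _ (by simp [Prog.natWrites]), hs₂,
      exec_nat_of_notMem _ _ _ _ (by simp [unitTable, Prog.natWrites]), hs₁,
      exec_nat_of_notMem _ _ _ _ ha]
  have hr1 : s₃.real 1 = (input F ε γ c).real 1 := by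
    rw [hs₃, exec_real_of_notMem _ _ _ _ (by decide), hs₂,
      exec_real_of_notMem _ _ _ _ (by decide), hs₁,
      exec_real_of_notMem _ _ _ _ (by decide), hs, start_real _ _ _ _ _ _ (by decide)]
  have hdiv := exec_divisions ω hf.total
  rw [← hs₁] at hdiv
  refine exec_rounds ω F hn ⟨hf.of_nat_eq fun a ha => hn3 a ?_, ?_, ?_, ?_, ?_⟩ _ ?_ ?_ ?_ ?_
  · interval_cases a <;> decide
  · intro i hi a ha
    rw [hs₃, exec_nat_of_notMem _ _ _ _ (by decide), exec_nat_of_notMem _ _ _ _ (by decide), hs₂,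
      exec_nat_of_notMem _ _ _ _ (by decide), exec_nat_of_notMem _ _ _ _ (by decide)]
    exact hdiv i hi a ha
  · rw [hs₃, exec_real_of_notMem _ _ _ _ (by decide), hs₂]
    refine exec_unitTable ω fun i j => ?_
    rw [hs₁, exec_real_of_notMem _ _ _ _ (by decide), hs, start_real _ _ _ _ _ _ (by decide)]
    simp [input]
  · intro x hx y
    rw [hr1]
    simp [input, not_lt.mpr hx]
  · intro t
    rw [hr1]
    unfold flatten quatAt
    split
    · rename_i ht
      ext <;> simp [input, ht, CQuat.coord]
    · rename_i ht
      ext <;> simp [input, ht]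
  · rw [hn3 3 (by decide), hs, start_rounds]
  · simp [repetitions]
  · rw [hs₃, exec_drawn_of_gaussFree _ _ _ (by decide), hs₂,
      exec_drawn_of_gaussFree _ _ _ (by decide), hs₁,
      exec_drawn_of_gaussFree _ _ _ (by decide), hs, start_drawn]
  · rw [hs₃]
    simp [exec, Store.setReal, Store.tick, NExpr.eval, RExpr.eval]

end Alg
end RealRAM

/-! ### Polynomial running time -/

namespace RealRAM
namespace Alg

variable {m : ℕ} {n : Fin (m + 2) → ℕ}

theorem exec_product_of_ne (ω : ℕ → ℝ) (s : Store) (i : ℕ) (hi : i ≠ 0) :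
    (exec ω product s).nat 2 i = s.nat 2 i := by
  unfold product
  rw [exec]
  refine loop_induction ω 13 ord (.setNat 2 (.const 0) (.mul total (size K))) _
    (fun _ s' => s'.nat 2 i = s.nat 2 i) ?_ ?_
    (fun _ _ _ _ h => by simpa [Store.setNat, Store.tick] using h)
  · simp [exec, Store.setNat, Store.tick, NExpr.eval, hi]
  · intro t _ s' _ _ _ hI
    simp [exec, Store.setNat, Store.tick, NExpr.eval, hI, hi]

theorem exec_roundsNat_of_ne (ω : ℕ → ℝ) (s : Store) (i : ℕ) (hi : i ≠ 0) :
    (exec ω roundsNat s).nat 3 i = s.nat 3 i := by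
  unfold roundsNat
  rw [exec, exec.eq_8]
  split <;> simp [exec, Store.setNat, Store.tick, NExpr.eval, hi]

/-- The only rounding in the program, charged by the value of its result and therefore treated apart
from the syntactic bound. -/
theorem exec_roundsNat_time (ω : ℕ → ℝ) (s : Store) :
    (exec ω roundsNat s).time ≤ s.time + ⌈s.real 3 0 0⌉₊ + 12 := by
  unfold roundsNat
  rw [exec, exec.eq_8]
  split <;> simp [exec, Store.setNat, Store.tick, NExpr.eval, NExpr.cost, RExpr.cost, RExpr.eval] <;>
    omega

/-- One factor of the number of rounds is at most a power of the size. -/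
theorem exists_factor_le (γ c : ℝ) :
    ∃ K : ℕ, ∀ x : ℕ, 1 ≤ x →
      1 / c * ((x : ℝ) ^ (9 / 2 * γ) * Real.sqrt (Real.log x)) ≤ (x : ℝ) ^ K := by
  obtain ⟨K₀, hK₀⟩ := pow_unbounded_of_one_lt (1 / c) (one_lt_two)
  -- For `x ≥ 2` the three summands pay for `1 / c ≤ 2 ^ K₀`, for the real power and for `√(log x) ≤
  -- x`. For `x = 1` the left side is zero.
  refine ⟨K₀ + (⌈9 / 2 * γ⌉₊ + 1), fun x hx => ?_⟩
  rcases hx.eq_or_lt with rfl | hx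
  · simp
  have h1 : (1 : ℝ) ≤ x := by exact_mod_cast hx.le
  have h2 : (2 : ℝ) ≤ x := by exact_mod_cast hx
  rw [pow_add, pow_add, pow_one]
  gcongr
  · exact hK₀.le.trans (by gcongr)
  · rw [← Real.rpow_natCast]
    exact Real.rpow_le_rpow_of_exponent_le h1 (Nat.le_ceil _)
  · rw [Real.sqrt_le_left (by positivity)]
    have := Real.log_le_sub_one_of_pos (show (0 : ℝ) < x by linarith)
    nlinarith

/-- The product of the factors is at most `(∏ n_k) ^ K` with `K` independent of the order, and one
more power pays for `log (1 / ε)`. -/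
theorem exists_repetitions_le (γ c : ℝ) (hc : 0 < c) :
    ∃ K : ℕ, ∀ (m : ℕ) (n : Fin (m + 2) → ℕ), (∀ k, 1 ≤ n k) → ∀ ε : ℝ,
      repetitions γ c ε n ≤ (m + 2 + ∏ k, n k + ⌈Real.log (1 / ε)⌉₊) ^ (K + 1) := by
  obtain ⟨K, hK⟩ := exists_factor_le γ c
  refine ⟨K, fun m n hn ε => ?_⟩
  set N := m + 2 + ∏ k, n k + ⌈Real.log (1 / ε)⌉₊ with hN
  rw [repetitions_eq]
  refine max_le (Nat.one_le_pow _ _ (by omega)) (Nat.ceil_le.mpr ?_)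
  have hfac : ∀ k ∈ Finset.range m, 0 ≤ 1 / c * ((extendSizes n k : ℝ) ^ (9 / 2 * γ) *
      Real.sqrt (Real.log (extendSizes n k))) := fun k _ => by positivity
  have hprod : ∏ k ∈ Finset.range m, (1 / c * ((extendSizes n k : ℝ) ^ (9 / 2 * γ) *
      Real.sqrt (Real.log (extendSizes n k)))) ≤ (N : ℝ) ^ K := by
    calc _ ≤ ∏ k ∈ Finset.range m, ((extendSizes n k : ℝ) ^ K) :=
          Finset.prod_le_prod hfac fun k hk => hK _ (by
            have hk := Finset.mem_range.mp hk
            rw [show extendSizes n k = n ⟨k, by omega⟩ from extendSizes_apply n ⟨k, by omega⟩]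
            exact hn _)
      _ = ((∏ k ∈ Finset.range m, extendSizes n k : ℕ) : ℝ) ^ K := by
          rw [Finset.prod_pow]; push_cast; rfl
      _ ≤ (N : ℝ) ^ K := by
          gcongr
          have h1 : ∏ k ∈ Finset.range m, extendSizes n k ≤
              ∏ k ∈ Finset.range (m + 2), extendSizes n k := by
            refine Finset.prod_le_prod_of_subset_of_one_le' (by
              intro k; simp only [Finset.mem_range]; omega) fun k hk _ => ?_
            have hk := Finset.mem_range.mp hk
            rw [show extendSizes n k = n ⟨k, hk⟩ from extendSizes_apply n ⟨k, hk⟩]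
            exact hn _
          have h2 : ∏ k ∈ Finset.range (m + 2), extendSizes n k = ∏ k, n k := by
            rw [Finset.prod_range]
            exact Finset.prod_congr rfl fun k _ => extendSizes_apply n k
          omega
  have hlog : Real.log (1 / ε) ≤ N := (Nat.le_ceil _).trans (by exact_mod_cast (by omega))
  push_cast
  rw [pow_succ']
  exact mul_le_mul hlog hprod (Finset.prod_nonneg hfac) (by positivity)

theorem exists_time_le (γ c : ℝ) (hc : 0 < c) :
    ∃ p : Polynomial ℕ, ∀ (m : ℕ) (n : Fin (m + 2) → ℕ), (∀ k, 1 ≤ n k) →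
      ∀ (F : HTensor n) (ε : ℝ) (ω : ℕ → ℝ), (exec ω program (input F ε γ c)).time ≤
        p.eval (m + 2 + ∏ k, n k + ⌈Real.log (1 / ε)⌉₊) := by
  obtain ⟨K, hK⟩ := exists_repetitions_le γ c hc
  -- All entries that control loops are at most `N ^ (K + 1)`, where `N` is the input size: sizes
  -- and counts by `N` itself, the number of rounds by `exists_repetitions_le`. The term `X + 12`
  -- pays for the rounding.
  refine ⟨(product.costBound + roundsReal.costBound + Polynomial.X + 12 + mainPart.costBound).comp
    (Polynomial.X ^ (K + 1)), fun m n hn F ε ω => ?_⟩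
  have hR := hK m n hn ε
  obtain ⟨N, hN⟩ : ∃ N, N = m + 2 + ∏ k, n k + ⌈Real.log (1 / ε)⌉₊ := ⟨_, rfl⟩
  rw [← hN] at hR ⊢
  obtain ⟨X, hX⟩ : ∃ X, X = N ^ (K + 1) := ⟨_, rfl⟩
  rw [← hX] at hR
  have hNX : N ≤ X := by rw [hX]; exact Nat.le_self_pow (by omega) _
  simp only [Polynomial.eval_comp, Polynomial.eval_add, Polynomial.eval_pow, Polynomial.eval_X,
    Polynomial.eval_ofNat, ← hX]
  have hsize : ∀ k, extendSizes n k ≤ X := by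
    intro k
    unfold extendSizes
    split
    · have := size_le_prod hn ⟨k, by assumption⟩
      omega
    · omega
  have i0 : ∀ i, (input F ε γ c).nat 0 i ≤ X := by
    intro i
    simp only [input]
    split
    · omega
    · simp
  have i1 : ∀ i, (input F ε γ c).nat 1 i ≤ X := fun i => by rw [input_size]; exact hsize i
  have h1 := exec_time_le ω X product (input F ε γ c) (by decide) (by
    intro a ha
    have : ∀ a ∈ product.heads, a ∉ product.natWrites ∧ a < 2 := by decide
    refine ⟨(this a ha).1, ?_⟩
    have := (this a ha).2
    interval_cases a
    · exact i0
    · exact i1)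
  obtain ⟨s₁, hs₁⟩ : ∃ t, t = exec ω product (input F ε γ c) := ⟨_, rfl⟩
  have h2 := exec_time_le ω X roundsReal s₁ (by decide) (by
    intro a ha
    have : ∀ a ∈ roundsReal.heads, a ∉ roundsReal.natWrites ∧ a < 2 := by decide
    refine ⟨(this a ha).1, ?_⟩
    have := (this a ha).2
    interval_cases a
    · rw [hs₁, exec_nat_of_notMem _ _ _ _ (by decide)]; exact i0
    · rw [hs₁, exec_nat_of_notMem _ _ _ _ (by decide)]; exact i1)
  have h3 := exec_roundsNat_time ω (exec ω roundsReal s₁)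
  rw [hs₁, exec_roundsReal_input] at h3
  rw [repetitions_eq] at hR
  have h3' := (le_max_right _ _).trans hR
  have h4 := exec_time_le ω X mainPart (start ω F ε γ c) (by decide) (by
    intro a ha
    have : ∀ a ∈ mainPart.heads, a ∉ mainPart.natWrites ∧ a < 4 := by decide
    refine ⟨(this a ha).1, fun i => ?_⟩
    have := (this a ha).2
    have hf := format_start ω F ε γ c
    interval_cases a
    · rw [start, exec_nat_of_notMem _ _ _ _ (by decide), exec_nat_of_notMem _ _ _ _ (by decide),
        exec_nat_of_notMem _ _ _ _ (by decide)]
      exact i0 i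
    · rw [hf.size]
      exact hsize i
    · rcases eq_or_ne i 0 with rfl | hi
      · rw [hf.total]; omega
      · rw [start, exec_nat_of_notMem _ _ _ _ (by decide),
          exec_nat_of_notMem _ _ _ _ (by decide), exec_product_of_ne _ _ _ hi]
        simp [input]
    · rcases eq_or_ne i 0 with rfl | hi
      · rw [start_rounds, repetitions_eq]; exact hR
      · rw [start, exec_roundsNat_of_ne _ _ _ hi, exec_nat_of_notMem _ _ _ _ (by decide),
          exec_nat_of_notMem _ _ _ _ (by decide)]
        simp [input])
  have e : exec ω program (input F ε γ c) = exec ω mainPart (start ω F ε γ c) := rfl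
  have e' : start ω F ε γ c = exec ω roundsNat (exec ω roundsReal s₁) := by rw [hs₁]; rfl
  rw [e]
  rw [← hs₁] at h1 h3
  rw [← e'] at h3
  have h0 : (input F ε γ c).time = 0 := rfl
  omega

end Alg
end RealRAM

/-! ## Topology and measurability -/

namespace CQuat

instance : TopologicalSpace CQuat := TopologicalSpace.induced coord inferInstance

theorem measurable_coord : Measurable coord := comap_measurable coord

theorem continuous_coord : Continuous coord := continuous_induced_dom

@[fun_prop] theorem measurable_re : Measurable re := (measurable_pi_apply 0).comp measurable_coord
@[fun_prop] theorem measurable_imI : Measurable imI := (measurable_pi_apply 1).comp measurable_coord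
@[fun_prop] theorem measurable_imJ : Measurable imJ := (measurable_pi_apply 2).comp measurable_coord
@[fun_prop] theorem measurable_imK : Measurable imK := (measurable_pi_apply 3).comp measurable_coord

@[fun_prop] theorem continuous_re : Continuous re := (continuous_apply 0).comp continuous_coord
@[fun_prop] theorem continuous_imI : Continuous imI := (continuous_apply 1).comp continuous_coord
@[fun_prop] theorem continuous_imJ : Continuous imJ := (continuous_apply 2).comp continuous_coord
@[fun_prop] theorem continuous_imK : Continuous imK := (continuous_apply 3).comp continuous_coord

theorem measurable_of_parts {α : Type*} [MeasurableSpace α] {f : α → CQuat}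
    (h0 : Measurable fun x => (f x).re) (h1 : Measurable fun x => (f x).imI)
    (h2 : Measurable fun x => (f x).imJ) (h3 : Measurable fun x => (f x).imK) : Measurable f := by
  rw [measurable_comap_iff, measurable_pi_iff]
  intro a
  fin_cases a
  exacts [h0, h1, h2, h3]

theorem continuous_of_parts {α : Type*} [TopologicalSpace α] {f : α → CQuat}
    (h0 : Continuous fun x => (f x).re) (h1 : Continuous fun x => (f x).imI)
    (h2 : Continuous fun x => (f x).imJ) (h3 : Continuous fun x => (f x).imK) : Continuous f := by
  rw [continuous_induced_rng, continuous_pi_iff]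
  intro a
  fin_cases a
  exacts [h0, h1, h2, h3]

instance : MeasurableAdd₂ CQuat where
  measurable_add := by
    apply measurable_of_parts <;> simp only [add_re, add_imI, add_imJ, add_imK] <;> fun_prop

instance : MeasurableMul₂ CQuat where
  measurable_mul := by
    apply measurable_of_parts <;> simp only [mul_re, mul_imI, mul_imJ, mul_imK] <;> fun_prop

instance : ContinuousAdd CQuat where
  continuous_add := by
    apply continuous_of_parts <;> simp only [add_re, add_imI, add_imJ, add_imK] <;> fun_prop

instance : ContinuousMul CQuat where
  continuous_mul := by
    apply continuous_of_parts <;> simp only [mul_re, mul_imI, mul_imJ, mul_imK] <;> fun_prop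

end CQuat

@[fun_prop]
theorem measurable_hnorm {n : ℕ} : Measurable (hnorm : (Fin n → CQuat) → ℝ) := by
  unfold hnorm
  fun_prop

theorem measurable_form {d : ℕ} {n : Fin d → ℕ} (F : HTensor n) : Measurable (form F) := by
  unfold form
  fun_prop

theorem continuous_form {d : ℕ} {n : Fin d → ℕ} (F : HTensor n) : Continuous (form F) := by
  unfold form
  fun_prop

theorem measurableSet_hsphere (n : ℕ) : MeasurableSet (hsphere n) :=
  measurableSet_eq_fun measurable_hnorm measurable_const

/-- The real components of a commutative quaternion vector. -/
def toRealVec {n : ℕ} (x : Fin n → CQuat) : EuclideanSpace ℝ (Fin 4 × Fin n) :=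
  WithLp.toLp 2 fun p => (x p.2).coord p.1

theorem ofRealVec_toRealVec {n : ℕ} (x : Fin n → CQuat) : ofRealVec (toRealVec x) = x := by
  funext i
  rfl

theorem hnorm_ofRealVec {n : ℕ} (v : EuclideanSpace ℝ (Fin 4 × Fin n)) :
    hnorm (ofRealVec v) = ‖v‖ := by
  rw [hnorm, EuclideanSpace.norm_eq, Fintype.sum_prod_type_right]
  simp [Fin.sum_univ_four, ofRealVec]

theorem norm_toRealVec {n : ℕ} (x : Fin n → CQuat) : ‖toRealVec x‖ = hnorm x := by
  rw [← hnorm_ofRealVec, ofRealVec_toRealVec]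

@[fun_prop]
theorem measurable_ofRealVec {n : ℕ} :
    Measurable (ofRealVec : EuclideanSpace ℝ (Fin 4 × Fin n) → _) := by
  refine measurable_pi_iff.mpr fun i => ?_
  apply CQuat.measurable_of_parts <;> simp only [ofRealVec] <;> fun_prop

theorem continuous_ofRealVec {n : ℕ} :
    Continuous (ofRealVec : EuclideanSpace ℝ (Fin 4 × Fin n) → _) := by
  refine continuous_pi fun i => ?_
  apply CQuat.continuous_of_parts <;> simp only [ofRealVec] <;> fun_prop

theorem image_ofRealVec_sphere (n : ℕ) :
    ofRealVec '' Metric.sphere (0 : EuclideanSpace ℝ (Fin 4 × Fin n)) 1 = hsphere n := by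
  ext x
  simp only [Set.mem_image, mem_sphere_zero_iff_norm, hsphere, Set.mem_ofPred_eq]
  constructor
  · rintro ⟨v, hv, rfl⟩
    rw [hnorm_ofRealVec, hv]
  · intro hx
    exact ⟨toRealVec x, by rw [norm_toRealVec, hx], ofRealVec_toRealVec x⟩

theorem isCompact_hsphere (n : ℕ) : IsCompact (hsphere n) := by
  rw [← image_ofRealVec_sphere]
  exact (isCompact_sphere _ _).image continuous_ofRealVec

theorem hsphere_nonempty {n : ℕ} (hn : 1 ≤ n) : (hsphere n).Nonempty := by
  have : Nonempty (Fin n) := ⟨⟨0, hn⟩⟩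
  rw [← image_ofRealVec_sphere]
  exact (NormedSpace.sphere_nonempty.mpr zero_le_one).image _

/-- The problem has an optimal solution. -/
theorem exists_optimal {d : ℕ} {n : Fin d → ℕ} (hn : ∀ k, 1 ≤ n k) (F : HTensor n) :
    ∃ x ∈ feasible n, (form F x).re = optValue F := by
  have hset : feasible n = Set.univ.pi fun k => hsphere (n k) := by
    ext x; simp [feasible]
  have hc : IsCompact (feasible n) := hset ▸ isCompact_univ_pi fun k => isCompact_hsphere (n k)
  have hne : (feasible n).Nonempty :=
    hset ▸ Set.univ_pi_nonempty_iff.mpr fun k => hsphere_nonempty (hn k)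
  have hcont : ContinuousOn (fun x => (form F x).re) (feasible n) :=
    (CQuat.continuous_re.comp (continuous_form F)).continuousOn
  obtain ⟨x, hx, hmax⟩ := hc.exists_isMaxOn hne hcont
  have hle : ∀ z ∈ feasible n, (form F z).re ≤ (form F x).re := fun z hz => hmax hz
  refine ⟨x, hx, le_antisymm (le_csSup ⟨(form F x).re, ?_⟩ ⟨x, hx, rfl⟩)
    (csSup_le (hne.image _) ?_)⟩
  · rintro _ ⟨z, hz, rfl⟩; exact hle z hz
  · rintro _ ⟨z, hz, rfl⟩; exact hle z hz

/-- The vector representing the real linear form `x ↦ Re (aᵀ x)`. -/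
def dualVec {n : ℕ} (a : Fin n → CQuat) : EuclideanSpace ℝ (Fin 4 × Fin n) :=
  toRealVec fun i => ⟨(a i).re, -(a i).imI, (a i).imJ, -(a i).imK⟩

theorem norm_dualVec {n : ℕ} (a : Fin n → CQuat) : ‖dualVec a‖ = hnorm a := by
  rw [dualVec, norm_toRealVec]
  simp [hnorm]

theorem re_sum_mul_ofRealVec {n : ℕ} (a : Fin n → CQuat) (v : EuclideanSpace ℝ (Fin 4 × Fin n)) :
    (∑ i, a i * ofRealVec v i).re = inner ℝ (dualVec a) v := by
  rw [CQuat.sum_re, PiLp.inner_apply, Fintype.sum_prod_type_right]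
  refine Finset.sum_congr rfl fun i _ => ?_
  simp [Fin.sum_univ_four, ofRealVec, dualVec, toRealVec, CQuat.coord]
  ring

/-! ### Polar coordinates: normalized Gaussian vectors are uniform on the sphere -/

section Polar

variable {E : Type*} [NormedAddCommGroup E] [InnerProductSpace ℝ E] [FiniteDimensional ℝ E]
  [MeasurableSpace E] [BorelSpace E]

/-- Integration of a product of an angular and a radial function. -/
theorem lintegral_angular_mul_radial [Nontrivial E] (f : E → ENNReal) (hf : Measurable f) (g : ℝ → ENNReal)
    (hg : Measurable g) : ∫⁻ v : E, f (‖v‖⁻¹ • v) * g ‖v‖ =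
      (∫⁻ u, f u.1 ∂(volume : Measure E).toSphere) *
        ∫⁻ r, g r.1 ∂(Measure.volumeIoiPow (Module.finrank ℝ E - 1)) := by
  have hF : Measurable fun p : Metric.sphere (0 : E) 1 × Set.Ioi (0 : ℝ) => f p.1 * g p.2 := by
    fun_prop
  rw [← lintegral_prod_mul (by fun_prop) (by fun_prop),
    ← ((volume : Measure E).measurePreserving_homeomorphUnitSphereProd).lintegral_comp hF]
  simp only [homeomorphUnitSphereProd_apply_fst_coe, homeomorphUnitSphereProd_apply_snd_coe]
  rw [lintegral_subtype_comap (measurableSet_singleton _).compl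
    (fun v : E => f (‖v‖⁻¹ • v) * g ‖v‖), restrict_compl_singleton]

/-- The measure with density `exp (-‖v‖ ^ 2 / 2)`. -/
def gaussianWeight (E : Type*) [NormedAddCommGroup E] [InnerProductSpace ℝ E]
    [FiniteDimensional ℝ E] [MeasurableSpace E] [BorelSpace E] : Measure E :=
  (volume : Measure E).withDensity fun v => ENNReal.ofReal (Real.exp (-‖v‖ ^ 2 / 2))


theorem integrable_exp_neg_sq_norm : Integrable fun v : E => Real.exp (-‖v‖ ^ 2 / 2) := by
  have := GaussianFourier.integrable_cexp_neg_mul_sq_norm_add (V := E) (b := 1 / 2)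
    (by norm_num) 0 0
  refine (this.norm).congr (Filter.Eventually.of_forall fun v => ?_)
  simp only [Complex.norm_exp]
  congr 1
  simp [← Complex.ofReal_pow]
  ring

instance isFiniteMeasure_gaussianWeight : IsFiniteMeasure (gaussianWeight E) :=
  isFiniteMeasure_withDensity_ofReal integrable_exp_neg_sq_norm.2

theorem integral_gaussianWeight (f : E → ℂ) :
    ∫ v, f v ∂gaussianWeight E = ∫ v, (Real.exp (-‖v‖ ^ 2 / 2) : ℂ) * f v := by
  rw [gaussianWeight, integral_withDensity_eq_integral_toReal_smul (by fun_prop) (by simp)]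
  refine integral_congr_ae (Filter.Eventually.of_forall fun v => ?_)
  simp [ENNReal.toReal_ofReal (Real.exp_pos _).le]

theorem charFun_gaussianWeight (t : E) : charFun (gaussianWeight E) t =
    (Real.pi / (1 / 2 : ℂ)) ^ (Module.finrank ℝ E / 2 : ℂ) * Complex.exp (-‖t‖ ^ 2 / 2) := by
  have := GaussianFourier.integral_cexp_neg_mul_sq_norm_add (V := E) (b := 1 / 2)
    (by norm_num) Complex.I t
  rw [charFun_apply, integral_gaussianWeight]
  convert this using 1
  · refine integral_congr_ae (Filter.Eventually.of_forall fun v => ?_)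
    simp only
    rw [Complex.ofReal_exp, ← Complex.exp_add, real_inner_comm]
    congr 1
    push_cast
    ring
  · congr 2
    rw [Complex.I_sq]
    ring

/-- Both characteristic functions are multiples of `exp (-‖t‖² / 2)`; the factor is read off at `t =
0`. -/
theorem gaussianWeight_eq_smul :
    gaussianWeight E = gaussianWeight E Set.univ • stdGaussian E := by
  have hfin : IsFiniteMeasure (gaussianWeight E Set.univ • stdGaussian E) :=
    Measure.smul_finite _ (measure_ne_top _ _)
  refine Measure.ext_of_charFun (E := E) ?_
  funext t
  have h0 := charFun_gaussianWeight (0 : E)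
  rw [charFun_zero] at h0
  rw [charFun_apply (μ := gaussianWeight E Set.univ • stdGaussian E), integral_smul_measure,
    ← charFun_apply, charFun_stdGaussian, charFun_gaussianWeight]
  simp only [norm_zero] at h0
  rw [show (gaussianWeight E Set.univ).toReal = (gaussianWeight E).real Set.univ from rfl,
    Complex.real_smul, h0]
  simp

/-- The Gaussian density is radial, so in polar coordinates the angular part is proportional to
surface measure. The radial integral `k` is a common factor; comparing with the whole sphere shows
that it is neither `0` nor `∞` and cancels it. -/
theorem map_stdGaussian_normalize [Nontrivial E] :
    (stdGaussian E).map (fun v => ‖v‖⁻¹ • v) =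
      (ProbabilityTheory.cond (volume : Measure E).toSphere Set.univ).map Subtype.val := by
  have hm : Measurable fun v : E => ‖v‖⁻¹ • v := by fun_prop
  obtain ⟨k, hk⟩ : ∃ k, k = ∫⁻ r, ENNReal.ofReal (Real.exp (-r.1 ^ 2 / 2))
    ∂(Measure.volumeIoiPow (Module.finrank ℝ E - 1)) := ⟨_, rfl⟩
  have hset : ∀ s : Set E, MeasurableSet s → gaussianWeight E Set.univ *
      stdGaussian E ((fun v => ‖v‖⁻¹ • v) ⁻¹' s) =
        (volume : Measure E).toSphere (Subtype.val ⁻¹' s) * k := by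
    intro s hs
    have h1 : gaussianWeight E ((fun v => ‖v‖⁻¹ • v) ⁻¹' s) = gaussianWeight E Set.univ *
      stdGaussian E ((fun v => ‖v‖⁻¹ • v) ⁻¹' s) := by
      conv_lhs => rw [gaussianWeight_eq_smul]
      simp
    have h2 := lintegral_angular_mul_radial (E := E) (s.indicator 1)
      (measurable_one.indicator hs) (fun r => ENNReal.ofReal (Real.exp (-r ^ 2 / 2))) (by fun_prop)
    rw [← h1, gaussianWeight, withDensity_apply _ (hm hs), ← lintegral_indicator (hm hs), hk]
    convert h2 using 1
    · refine lintegral_congr fun v => ?_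
      by_cases hv : ‖v‖⁻¹ • v ∈ s <;> simp [Set.indicator, hv]
    · congr 1
      rw [← lintegral_indicator_one (measurable_subtype_coe hs)]
      rfl
  have huniv := hset Set.univ .univ
  simp only [Set.preimage_univ, measure_univ, mul_one] at huniv
  have hσ0 : (volume : Measure E).toSphere Set.univ ≠ 0 := by
    rw [Measure.measure_univ_ne_zero]
    exact Measure.toSphere_ne_zero _
  have hσt : (volume : Measure E).toSphere Set.univ ≠ ⊤ := measure_ne_top _ _
  have hw0 : gaussianWeight E Set.univ ≠ 0 := by
    intro h0
    have h := charFun_gaussianWeight (0 : E)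
    rw [charFun_zero, measureReal_def, h0] at h
    simp only [ENNReal.toReal_zero, Complex.ofReal_zero, norm_zero, ne_eq, OfNat.ofNat_ne_zero,
      not_false_eq_true, zero_pow, neg_zero, zero_div, Complex.exp_zero, mul_one] at h
    exact absurd ((Complex.cpow_eq_zero_iff _ _).mp h.symm).1 (by simp [Real.pi_ne_zero])
  have hwt : gaussianWeight E Set.univ ≠ ⊤ := measure_ne_top _ _
  ext s hs
  rw [Measure.map_apply hm hs, Measure.map_apply measurable_subtype_coe hs,
    cond_apply .univ, Set.univ_inter]
  have h := hset s hs
  rw [huniv] at h hw0 hwt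
  have hk0 : k ≠ 0 := right_ne_zero_of_mul hw0
  have hkt : k ≠ ⊤ := fun h => hwt (by rw [h, ENNReal.mul_top hσ0])
  rw [mul_right_comm, ENNReal.mul_left_inj hk0 hkt] at h
  rw [← h, ← mul_assoc, ENNReal.inv_mul_cancel hσ0 hσt, one_mul]

end Polar

theorem hasLaw_uniformSphere {n : ℕ} (hn : 1 ≤ n) :
    HasLaw (fun v => ofRealVec (‖v‖⁻¹ • v)) (uniformSphere n)
      (stdGaussian (EuclideanSpace ℝ (Fin 4 × Fin n))) := by
  have : Nonempty (Fin n) := ⟨⟨0, hn⟩⟩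
  have hm : Measurable fun v : EuclideanSpace ℝ (Fin 4 × Fin n) => ‖v‖⁻¹ • v := by fun_prop
  refine ⟨by fun_prop, ?_⟩
  rw [uniformSphere, show (fun v : Metric.sphere (0 : EuclideanSpace ℝ (Fin 4 × Fin n)) 1 =>
    ofRealVec v.1) = ofRealVec ∘ Subtype.val from rfl,
    ← Measure.map_map measurable_ofRealVec measurable_subtype_coe, ← map_stdGaussian_normalize,
    Measure.map_map measurable_ofRealVec hm]
  rfl

theorem isProbabilityMeasure_uniformSphere {n : ℕ} (hn : 1 ≤ n) :
    IsProbabilityMeasure (uniformSphere n) := by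
  rw [← (hasLaw_uniformSphere hn).map_eq]
  exact Measure.isProbabilityMeasure_map (hasLaw_uniformSphere hn).aemeasurable

theorem uniformSphere_hsphere {n : ℕ} (hn : 1 ≤ n) : uniformSphere n (hsphere n) = 1 := by
  have := isProbabilityMeasure_uniformSphere hn
  rw [← prob_compl_eq_zero_iff (measurableSet_hsphere n), uniformSphere,
    Measure.map_apply (by fun_prop) (measurableSet_hsphere n).compl]
  have : (fun v : Metric.sphere (0 : EuclideanSpace ℝ (Fin 4 × Fin n)) 1 => ofRealVec v.1) ⁻¹'
      (hsphere n)ᶜ = ∅ := by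
    ext v
    simp [hsphere, hnorm_ofRealVec]
  rw [this, measure_empty]

/-! ### Independence and uniformity of the samples drawn by the program -/

instance isProbabilityMeasure_normalSequence : IsProbabilityMeasure normalSequence := by
  unfold normalSequence; infer_instance

theorem map_normalSequence {ι : Type*} {f : ι → ℕ} (hf : Function.Injective f) :
    normalSequence.map (fun ω i => ω (f i)) = Measure.infinitePi fun _ => gaussianReal 0 1 :=
  Measure.map_infinitePi_infinitePi_of_inj (P := fun _ => gaussianReal 0 1) hf

/-- Disjoint blocks of standard normal variates are independent. -/
theorem iIndepFun_blocks {ι : Type*} {κ : ι → Type*} {e : (i : ι) → κ i → ℕ}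
    (he : Function.Injective fun p : (i : ι) × κ i => e p.1 p.2) :
    iIndepFun (fun i (ω : ℕ → ℝ) (j : κ i) => ω (e i j)) normalSequence := by
  rw [iIndepFun_iff_map_fun_eq_infinitePi_map (fun i => by fun_prop)]
  have h := Measure.infinitePi_map_piCurry (X := fun (i : ι) (_ : κ i) => ℝ)
    (fun _ _ => gaussianReal 0 1)
  have h2 := map_normalSequence he
  rw [← h2, Measure.map_map (by fun_prop) (by fun_prop)] at h
  have h3 : ∀ i, normalSequence.map (fun ω (j : κ i) => ω (e i j)) =
      Measure.infinitePi fun _ => gaussianReal 0 1 := fun i =>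
    map_normalSequence fun j j' hj => by simpa using @he ⟨i, j⟩ ⟨i, j'⟩ hj
  simp_rw [h3]
  exact h

namespace RealRAM
namespace Alg

variable {m : ℕ} {n : Fin (m + 2) → ℕ}

/-- The number of the variate used for component `a` of entry `i` of block `k` in round `r`. -/
def variate (n : Fin (m + 2) → ℕ) {R : ℕ} (p : Fin R × Fin m)
    (q : Fin 4 × Fin (n (p.2.castAdd 2))) : ℕ :=
  p.1 * (∑ j ∈ Finset.range m, 4 * extendSizes n j) +
    (∑ j ∈ Finset.range (p.2 : ℕ), 4 * extendSizes n j) + (4 * q.2 + q.1)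

/-- Consecutive intervals of lengths `f 0, f 1, …` are disjoint, so a position determines its
interval and its offset there. -/
theorem eq_of_sum_add_eq {f : ℕ → ℕ} {k k' p p' : ℕ} (hp : p < f k) (hp' : p' < f k')
    (h : ∑ j ∈ Finset.range k, f j + p = ∑ j ∈ Finset.range k', f j + p') : k = k' ∧ p = p' := by
  have mono : ∀ {a b : ℕ}, a < b → ∑ j ∈ Finset.range a, f j + f a ≤ ∑ j ∈ Finset.range b, f j :=
    fun {a b} hab => by
      rw [← Finset.sum_range_succ]
      exact Finset.sum_le_sum_of_subset (Finset.range_mono hab)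
  rcases lt_trichotomy k k' with hk | rfl | hk
  · have := mono hk; omega
  · omega
  · have := mono hk; omega

/-- A variate number decodes uniquely into round, block, entry and component. So no variate is used
twice, which is the source of independence. -/
theorem variate_injective (n : Fin (m + 2) → ℕ) (R : ℕ) : Function.Injective
    fun x : (p : Fin R × Fin m) × (Fin 4 × Fin (n (p.2.castAdd 2))) => variate n x.1 x.2 := by
  rintro ⟨⟨r, k⟩, a, i⟩ ⟨⟨r', k'⟩, a', i'⟩ h
  simp only [variate] at h
  have hs : ∀ k : Fin m, extendSizes n k = n (k.castAdd 2) := fun k =>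
    extendSizes_apply n (k.castAdd 2)
  have h1 : 4 * (i : ℕ) + a < 4 * extendSizes n k := by rw [hs]; omega
  have h1' : 4 * (i' : ℕ) + a' < 4 * extendSizes n k' := by rw [hs]; omega
  have lt : ∀ (k : Fin m) (x : ℕ), x < 4 * extendSizes n k →
      ∑ j ∈ Finset.range (k : ℕ), 4 * extendSizes n j + x <
        ∑ j ∈ Finset.range m, 4 * extendSizes n j := by
    intro k x hx
    have : ∑ j ∈ Finset.range ((k : ℕ) + 1), 4 * extendSizes n j ≤
        ∑ j ∈ Finset.range m, 4 * extendSizes n j :=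
      Finset.sum_le_sum_of_subset (Finset.range_mono k.2)
    rw [Finset.sum_range_succ] at this
    omega
  rw [add_assoc, add_assoc] at h
  obtain ⟨hr, hx⟩ := eq_of_sum_add_eq (f := fun _ => ∑ j ∈ Finset.range m, 4 * extendSizes n j)
    (k := r) (k' := r') (lt k _ h1) (lt k' _ h1') (by simpa using h)
  obtain ⟨hk, hi⟩ := eq_of_sum_add_eq (f := fun j => 4 * extendSizes n j) h1 h1' hx
  obtain rfl := Fin.ext hr
  obtain rfl := Fin.ext hk
  obtain rfl : i = i' := Fin.ext (by omega)
  obtain rfl : a = a' := Fin.ext (by omega)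
  rfl

theorem samples_eq {R : ℕ} (ω : ℕ → ℝ) (p : Fin R × Fin m) :
    samples n ω (p.1 * ∑ j ∈ Finset.range m, 4 * extendSizes n j) p.2 =
      (fun v : EuclideanSpace ℝ (Fin 4 × Fin (n (p.2.castAdd 2))) => ofRealVec (‖v‖⁻¹ • v))
        (WithLp.toLp 2 fun q => ω (variate n p q)) := by
  obtain ⟨v, hv⟩ : ∃ v : EuclideanSpace ℝ (Fin 4 × Fin (n (p.2.castAdd 2))),
    v = WithLp.toLp 2 fun q => ω (variate n p q) := ⟨_, rfl⟩
  have hv' : ∀ q, v q = ω (variate n p q) := fun q => by rw [hv]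
  have hs : extendSizes n p.2 = n (p.2.castAdd 2) := extendSizes_apply n (p.2.castAdd 2)
  have hS : ∑ q ∈ Finset.range (4 * extendSizes n p.2),
      ω (p.1 * (∑ j ∈ Finset.range m, 4 * extendSizes n j) +
        (∑ j ∈ Finset.range (p.2 : ℕ), 4 * extendSizes n j) + q) ^ 2 = ‖v‖ ^ 2 := by
    rw [EuclideanSpace.real_norm_sq_eq, Fintype.sum_prod_type_right, hs, sum_range_four_mul,
      Finset.sum_range]
    refine Finset.sum_congr rfl fun i _ => ?_
    simp [hv', variate, Fin.sum_univ_four, Finset.sum_range_succ]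
  have key : ∀ q, normalized ω (extendSizes n) (p.1 * ∑ j ∈ Finset.range m, 4 * extendSizes n j) p.2
      (4 * q.2 + q.1) = (‖v‖⁻¹ • v) q := by
    intro q
    rw [normalized, hS, PiLp.smul_apply, hv', smul_eq_mul, variate, div_eq_mul_inv, mul_comm]
    -- For `v = 0` the machine divides by `1` and the normalization multiplies by `0`, but both
    -- yield the zero vector.
    rcases eq_or_ne v 0 with h0 | h0
    · have : ω (variate n p q) = 0 := by rw [← hv', h0]; rfl
      rw [variate] at this
      rw [this, mul_zero, mul_zero]
    · have : 0 < ‖v‖ := norm_pos_iff.mpr h0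
      rw [Real.log_pow, Nat.cast_ofNat, mul_div_cancel_left₀ _ two_ne_zero, Real.exp_log this]
  rw [← hv]
  funext i
  simp only [samples, quatAt, ofRealVec]
  ext
  · exact key (0, i)
  · exact key (1, i)
  · exact key (2, i)
  · exact key (3, i)

theorem isUniformSample_samples (hn : ∀ k, 1 ≤ n k) (R : ℕ) :
    IsUniformSample normalSequence fun ω (r : Fin R) =>
      samples n ω (r * ∑ j ∈ Finset.range m, 4 * extendSizes n j) := by
  have hm : ∀ N : ℕ, Measurable fun f : Fin 4 × Fin N → ℝ =>
      (fun v : EuclideanSpace ℝ (Fin 4 × Fin N) => ofRealVec (‖v‖⁻¹ • v)) (WithLp.toLp 2 f) :=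
    fun N => by fun_prop
  constructor
  · intro r k
    have hinj : Function.Injective (variate n (r, k)) := fun q q' h => by
      simpa using @variate_injective m n R ⟨(r, k), q⟩ ⟨(r, k), q'⟩ h
    have h1 : HasLaw (fun (ω : ℕ → ℝ) q => ω (variate n (r, k) q))
        (Measure.pi fun _ => gaussianReal 0 1) normalSequence :=
      ⟨(measurable_pi_lambda _ fun _ => measurable_pi_apply _).aemeasurable, by
        rw [map_normalSequence hinj, Measure.infinitePi_eq_pi]⟩
    have h2 : HasLaw (WithLp.toLp 2) (stdGaussian (EuclideanSpace ℝ (Fin 4 × Fin (n (k.castAdd 2)))))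
        (Measure.pi fun _ => gaussianReal 0 1) :=
      ⟨by fun_prop, map_pi_eq_stdGaussian⟩
    refine ((hasLaw_uniformSphere (hn _)).comp (h2.comp h1)).congr ?_
    exact Filter.Eventually.of_forall fun ω => samples_eq ω (r, k)
  · have := (iIndepFun_blocks (variate_injective n R)).comp _
      (fun p => hm (n (p.2.castAdd 2)))
    convert this using 2 with p
    funext ω
    exact samples_eq ω p

end Alg
end RealRAM

/-! ### Spherical caps and admissible constants -/

/-- A lower bound for the Gaussian tail. -/
theorem le_gaussianReal_Ici {s : ℝ} (hs : 0 ≤ s) :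
    Real.exp (-(s + 1) ^ 2 / 2) / Real.sqrt (2 * Real.pi) ≤ (gaussianReal 0 1).real (Set.Ici s) := by
  have h : ENNReal.ofReal (Real.exp (-(s + 1) ^ 2 / 2) / Real.sqrt (2 * Real.pi)) ≤
      gaussianReal 0 1 (Set.Ici s) := by
    -- On the unit interval to the right of `s` the density is at least its value at the right end.
    calc _ = ∫⁻ _ in Set.Icc s (s + 1),
          ENNReal.ofReal (Real.exp (-(s + 1) ^ 2 / 2) / Real.sqrt (2 * Real.pi)) := by
          simp
      _ ≤ ∫⁻ x in Set.Icc s (s + 1), gaussianPDF 0 1 x := by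
          refine setLIntegral_mono (measurable_gaussianPDF 0 1) fun x hx => ?_
          rw [gaussianPDF, gaussianPDFReal]
          refine ENNReal.ofReal_le_ofReal ?_
          rw [div_eq_inv_mul]
          simp only [NNReal.coe_one, mul_one, sub_zero]
          gcongr
          · exact hs.trans hx.1
          · exact hx.2
      _ ≤ ∫⁻ x in Set.Ici s, gaussianPDF 0 1 x := lintegral_mono_set fun x hx => hx.1
      _ = _ := (gaussianReal_apply 0 one_ne_zero _).symm
  rw [measureReal_def]
  exact (ENNReal.ofReal_le_iff_le_toReal (measure_ne_top _ _)).mp h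

theorem integral_sq_gaussianReal : ∫ x, x ^ 2 ∂gaussianReal 0 1 = 1 := by
  have := variance_id_gaussianReal (μ := 0) (v := 1)
  rw [variance_eq_integral aemeasurable_id] at this
  simpa using this

theorem integrable_sq_gaussianReal : Integrable (fun x : ℝ => x ^ 2) (gaussianReal 0 1) :=
  (IsGaussian.memLp_two_id (μ := gaussianReal 0 1)).integrable_sq

/-- One coordinate is large while the others are not. -/
theorem le_pi_gaussianReal {ι : Type*} [Fintype ι] [DecidableEq ι] (i₀ : ι) {M s : ℝ} (hM : 0 < M)
    (hs : 0 ≤ s) (hd : 5 * (Fintype.card ι : ℝ) ≤ 4 * M) :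
    1 / 5 * (Real.exp (-(s + 1) ^ 2 / 2) / Real.sqrt (2 * Real.pi)) ≤
      (Measure.pi fun _ : ι => gaussianReal 0 1).real
        {x | s ≤ x i₀ ∧ ∑ i ∈ Finset.univ.erase i₀, x i ^ 2 ≤ M} := by
  set μ := Measure.pi fun _ : ι => gaussianReal 0 1 with hμ
  have hind : IndepFun (fun x : ι → ℝ => x i₀)
      (fun x => ∑ i ∈ Finset.univ.erase i₀, x i ^ 2) μ := by
    have h1 : iIndepFun (fun (i : ι) (x : ι → ℝ) => x i) μ :=
      iIndepFun_pi (X := fun _ x => x) (fun _ => aemeasurable_id)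
    have h2 := h1.indepFun_finset {i₀} (Finset.univ.erase i₀) (by simp) (fun i => by fun_prop)
    have hφ : Measurable fun y : ({i₀} : Finset ι) → ℝ => y ⟨i₀, by simp⟩ := by fun_prop
    have hψ : Measurable fun y : {i // i ∈ Finset.univ.erase i₀} → ℝ => ∑ i, y i ^ 2 := by
      fun_prop
    have h3 := h2.comp hφ hψ
    have e : (fun x : ι → ℝ => ∑ i ∈ Finset.univ.erase i₀, x i ^ 2) =
        (fun y : {i // i ∈ Finset.univ.erase i₀} → ℝ => ∑ i, y i ^ 2) ∘ fun x i => x i :=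
      funext fun x => (Finset.sum_coe_sort (Finset.univ.erase i₀) (fun i => x i ^ 2)).symm
    rw [e]
    exact h3
  have hint : ∀ i : ι, Integrable (fun x : ι → ℝ => x i ^ 2) μ := fun i =>
    integrable_comp_eval (μ := fun _ : ι => gaussianReal 0 1) (i := i)
      integrable_sq_gaussianReal
  have hone : ∀ i : ι, ∫ x : ι → ℝ, x i ^ 2 ∂μ = 1 := fun i => by
    exact (integral_comp_eval (μ := fun _ : ι => gaussianReal 0 1) (i := i) (f := fun y : ℝ => y ^ 2)
      (by fun_prop)).trans integral_sq_gaussianReal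
  -- The expected sum of squares is at most the dimension, hence at most `4 M / 5`, so it reaches
  -- `M` with probability at most `4 / 5`.
  have hmarkov := mul_meas_ge_le_integral_of_nonneg
    (f := fun x : ι → ℝ => ∑ i ∈ Finset.univ.erase i₀, x i ^ 2) (μ := μ)
    (Filter.Eventually.of_forall fun x => Finset.sum_nonneg fun i _ => sq_nonneg _)
    (integrable_finsetSum _ fun i _ => hint i) M
  rw [integral_finsetSum _ fun i _ => hint i, Finset.sum_congr rfl fun i _ => hone i,
    Finset.sum_const, nsmul_eq_mul, mul_one] at hmarkov
  have hcard : ((Finset.univ.erase i₀).card : ℝ) ≤ Fintype.card ι := by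
    exact_mod_cast Finset.card_le_univ _
  have hW : 1 / 5 ≤ μ.real {x : ι → ℝ | ∑ i ∈ Finset.univ.erase i₀, x i ^ 2 ≤ M} := by
    have hms : MeasurableSet {x : ι → ℝ | M ≤ ∑ i ∈ Finset.univ.erase i₀, x i ^ 2} :=
      measurableSet_le measurable_const (by fun_prop)
    have h1 : μ.real {x : ι → ℝ | M ≤ ∑ i ∈ Finset.univ.erase i₀, x i ^ 2} ≤ 4 / 5 := by
      by_contra! hc
      nlinarith
    have h2 := probReal_compl_eq_one_sub (μ := μ) hms
    have h3 : μ.real {x : ι → ℝ | M ≤ ∑ i ∈ Finset.univ.erase i₀, x i ^ 2}ᶜ ≤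
        μ.real {x : ι → ℝ | ∑ i ∈ Finset.univ.erase i₀, x i ^ 2 ≤ M} :=
      measureReal_mono fun x hx => (not_le.mp (show ¬ M ≤ _ from hx)).le
    linarith
  have hX : (gaussianReal 0 1).real (Set.Ici s) = μ.real {x : ι → ℝ | s ≤ x i₀} := by
    rw [measureReal_def, measureReal_def, ← (measurePreserving_eval (fun _ : ι => gaussianReal 0 1) i₀).measure_preimage
      measurableSet_Ici.nullMeasurableSet]
    rfl
  have hprod := hind.measure_inter_preimage_eq_mul (Set.Ici s) (Set.Iic M) measurableSet_Ici
    measurableSet_Iic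
  have hset : {x : ι → ℝ | s ≤ x i₀ ∧ ∑ i ∈ Finset.univ.erase i₀, x i ^ 2 ≤ M} =
      (fun x : ι → ℝ => x i₀) ⁻¹' Set.Ici s ∩
        (fun x => ∑ i ∈ Finset.univ.erase i₀, x i ^ 2) ⁻¹' Set.Iic M := rfl
  rw [hset, measureReal_def, hprod, ENNReal.toReal_mul]
  refine mul_comm (1 / 5 : ℝ) _ ▸ mul_le_mul ?_ hW (by norm_num) ENNReal.toReal_nonneg
  exact (le_gaussianReal_Ici hs).trans hX.le

/-- A lower bound for the measure of a cone. -/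
theorem le_stdGaussian_cone {E : Type*} [NormedAddCommGroup E] [InnerProductSpace ℝ E]
    [FiniteDimensional ℝ E] [MeasurableSpace E] [BorelSpace E] {b : E} (hb : ‖b‖ = 1) {M s t : ℝ}
    (hM : 0 < M) (hs : 0 < s) (ht : 0 ≤ t) (hd : 5 * (Module.finrank ℝ E : ℝ) ≤ 4 * M)
    (hst : t ^ 2 * M ≤ (1 - t ^ 2) * s ^ 2) (ht1 : t ≤ 1) :
    1 / 5 * (Real.exp (-(s + 1) ^ 2 / 2) / Real.sqrt (2 * Real.pi)) ≤
      (stdGaussian E).real {v | v ≠ 0 ∧ t * ‖v‖ ≤ inner ℝ b v} := by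
  classical
  have horth : Orthonormal ℝ ((↑) : ({b} : Set E) → E) := by
    refine ⟨fun i => by rw [Set.mem_singleton_iff.mp i.2, hb], fun i j hij => ?_⟩
    exact absurd (Subtype.ext (i.2.trans j.2.symm)) hij
  obtain ⟨u, B, hbu, hB⟩ := horth.exists_orthonormalBasis_extension
  have hbu' : b ∈ u := hbu rfl
  let i₀ : u := ⟨b, hbu'⟩
  have hB₀ : B i₀ = b := by rw [hB]
  have hmeas : MeasurableSet {v : E | v ≠ 0 ∧ t * ‖v‖ ≤ inner ℝ b v} := by
    have h : MeasurableSet {v : E | t * ‖v‖ ≤ inner ℝ b v} :=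
      measurableSet_le (by fun_prop) (by fun_prop)
    exact (measurableSet_singleton 0).compl.inter h
  have hcard : Fintype.card u = Module.finrank ℝ E := (Module.finrank_eq_card_basis B.toBasis).symm
  refine (le_pi_gaussianReal i₀ hM hs.le (by rw [hcard]; exact hd)).trans ?_
  rw [stdGaussian_eq_map_pi_orthonormalBasis B, map_measureReal_apply (by fun_prop) hmeas]
  refine measureReal_mono fun x hx => ?_
  obtain ⟨h1, h2⟩ := hx
  simp only [Set.mem_preimage, Set.mem_ofPred_eq]
  have e1 : inner ℝ b (∑ i, x i • B i) = x i₀ := by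
    rw [← hB₀, inner_sum]
    simp [inner_smul_right, orthonormal_iff_ite.mp B.orthonormal]
  have e2 : ‖∑ i, x i • B i‖ ^ 2 = ∑ i, x i ^ 2 := by
    rw [← B.sum_sq_norm_inner_right]
    refine Finset.sum_congr rfl fun i _ => ?_
    rw [inner_sum]
    simp [inner_smul_right, orthonormal_iff_ite.mp B.orthonormal]
  rw [e1]
  refine ⟨fun h0 => ?_, ?_⟩
  · rw [h0, inner_zero_right] at e1
    linarith
  -- With `x₀` the first coordinate and the other squares summing to at most `M`, `t² ‖v‖² ≤ t² x₀²
  -- + t² M ≤ t² x₀² + (1 - t²) s² ≤ x₀²`.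
  refine le_of_sq_le_sq ?_ (hs.le.trans h1)
  rw [mul_pow, e2, ← Finset.add_sum_erase _ _ (Finset.mem_univ i₀)]
  have h3 : s ^ 2 ≤ x i₀ ^ 2 := by gcongr
  have h4 : t ^ 2 ≤ 1 := pow_le_one₀ ht ht1
  nlinarith [mul_le_mul_of_nonneg_left h2 (sq_nonneg t),
    mul_le_mul_of_nonneg_left h3 (sub_nonneg.mpr h4)]

/-- A lower bound for the measure of a spherical cap. -/
theorem le_uniformSphere_cap {n : ℕ} (hn : 1 ≤ n) (a : Fin n → CQuat) {s t : ℝ}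
    (hs : 0 < s) (ht : 0 ≤ t) (ht1 : t ≤ 1) (hst : t ^ 2 * (5 * n) ≤ (1 - t ^ 2) * s ^ 2) :
    ENNReal.ofReal (1 / 5 * (Real.exp (-(s + 1) ^ 2 / 2) / Real.sqrt (2 * Real.pi))) ≤
      uniformSphere n {x | t * hnorm a ≤ (∑ i, a i * x i).re} := by
  have hlaw := hasLaw_uniformSphere hn
  have hmeas : MeasurableSet {x : Fin n → CQuat | t * hnorm a ≤ (∑ i, a i * x i).re} :=
    measurableSet_le (by fun_prop) (by fun_prop)
  have hdim : Module.finrank ℝ (EuclideanSpace ℝ (Fin 4 × Fin n)) = 4 * n := by simp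
  have hn' : (1 : ℝ) ≤ n := by exact_mod_cast hn
  have : Nonempty (Fin n) := ⟨⟨0, hn⟩⟩
  obtain ⟨b, hb, hab⟩ : ∃ b : EuclideanSpace ℝ (Fin 4 × Fin n), ‖b‖ = 1 ∧
      dualVec a = hnorm a • b := by
    rcases eq_or_ne (dualVec a) 0 with h0 | h0
    · obtain ⟨b, hb⟩ := NormedSpace.sphere_nonempty (E := EuclideanSpace ℝ (Fin 4 × Fin n)) (x := 0)
        |>.mpr zero_le_one
      refine ⟨b, by simpa using hb, ?_⟩
      rw [← norm_dualVec, h0, norm_zero, zero_smul]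
    · have h1 : ‖dualVec a‖ ≠ 0 := norm_ne_zero_iff.mpr h0
      refine ⟨‖dualVec a‖⁻¹ • dualVec a, by rw [norm_smul, norm_inv, norm_norm, inv_mul_cancel₀ h1], ?_⟩
      rw [← norm_dualVec, smul_smul, mul_inv_cancel₀ h1, one_smul]
  -- The real dimension is `4 n`, so `M = 5 n` is the least value satisfying the Markov condition.
  have key := le_stdGaussian_cone hb (M := 5 * n) (by linarith) hs ht
    (by rw [hdim]; push_cast; linarith) hst ht1
  rw [← hlaw.map_eq, Measure.map_apply_of_aemeasurable hlaw.aemeasurable hmeas]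
  refine (ENNReal.ofReal_le_ofReal key).trans ?_
  rw [ofReal_measureReal]
  refine measure_mono fun v hv => ?_
  simp only [Set.mem_ofPred_eq, Set.mem_preimage] at hv ⊢
  rw [re_sum_mul_ofRealVec, hab, inner_smul_left, inner_smul_right, mul_comm t]
  simp only [conj_trivial]
  refine mul_le_mul_of_nonneg_left ?_ (Real.sqrt_nonneg _)
  have : 0 < ‖v‖ := norm_pos_iff.mpr hv.1
  rw [le_inv_mul_iff₀ this, mul_comm]
  exact hv.2

/-- A lower bound for the measure of the cap in the definition of admissible constants. -/
def capBound (γ : ℝ) (n : ℕ) : ℝ :=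
  1 / 5 * (Real.exp (-(Real.sqrt (5 * (γ * Real.log n) / (1 - γ * Real.log n / n)) + 1) ^ 2 / 2) /
    Real.sqrt (2 * Real.pi))

theorem capBound_pos (γ : ℝ) (n : ℕ) : 0 < capBound γ n := by
  have := Real.pi_pos
  unfold capBound
  positivity

theorem capBound_le {γ : ℝ} (hγ : 0 < γ) {n : ℕ} (hn : 2 ≤ n) (h : γ * Real.log n < n)
    (a : Fin n → CQuat) : ENNReal.ofReal (capBound γ n) ≤
      uniformSphere n {x | Real.sqrt (γ * Real.log n / n) * hnorm a ≤ (∑ i, a i * x i).re} := by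
  have hn' : (2 : ℝ) ≤ n := by exact_mod_cast hn
  have hn0 : (0 : ℝ) < n := by linarith
  have hL : 0 < γ * Real.log n := mul_pos hγ (Real.log_pos (by linarith))
  have ht : γ * Real.log n / n < 1 := (div_lt_one hn0).mpr h
  have ht0 : 0 < γ * Real.log n / n := by positivity
  refine le_uniformSphere_cap (by omega) a (Real.sqrt_pos.mpr ?_) (Real.sqrt_nonneg _) ?_ ?_
  · exact div_pos (by linarith) (by linarith)
  · exact Real.sqrt_le_iff.mpr ⟨zero_le_one, by rw [one_pow]; exact ht.le⟩
  · rw [Real.sq_sqrt ht0.le, Real.sq_sqrt (div_pos (by linarith) (by linarith)).le,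
      mul_div_cancel₀ _ (by linarith)]
    -- The threshold in `capBound` is chosen so that both sides equal `5 γ log n`.
    apply le_of_eq
    field_simp

theorem exists_pos_le_of_eventually {r : ℕ → ℝ} (hr : ∀ n, 0 < r n) {c : ℝ} (hc : 0 < c)
    (h : ∀ᶠ n in Filter.atTop, c ≤ r n) : ∃ c', 0 < c' ∧ ∀ n, c' ≤ r n := by
  obtain ⟨N, hN⟩ := Filter.eventually_atTop.mp h
  obtain ⟨i, -, hi⟩ := (Finset.range (N + 1)).exists_min_image r ⟨0, by simp⟩
  refine ⟨min c (r i), lt_min hc (hr i), fun n => ?_⟩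
  rcases le_total N n with hn | hn
  · exact (min_le_left _ _).trans (hN n hn)
  · exact (min_le_right _ _).trans (hi n (by simp; omega))

/-- For every exponent there is an admissible constant. -/
theorem exists_admissibleConstant {γ : ℝ} (hγ : 0 < γ) : ∃ c, AdmissibleConstant γ c := by
  have hpi := Real.pi_pos
  let w : ℕ → ℝ := fun n => (n : ℝ) ^ (9 / 2 * γ) * Real.sqrt (Real.log n)
  have hw : ∀ n : ℕ, 2 ≤ n → 0 < w n := fun n hn => by
    have hn' : (2 : ℝ) ≤ n := by exact_mod_cast hn
    have := Real.log_pos (show (1 : ℝ) < n by linarith)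
    positivity
  suffices h : ∃ c, 0 < c ∧ ∀ n : ℕ, c ≤ if 2 ≤ n then capBound γ n * w n else 1 by
    obtain ⟨c, hc, h⟩ := h
    refine ⟨c, hc, fun n hn hγn a =>
      le_trans (ENNReal.ofReal_le_ofReal ?_) (capBound_le hγ hn hγn a)⟩
    have := h n
    rw [if_pos hn] at this
    rwa [div_le_iff₀ (hw n hn)]
  refine exists_pos_le_of_eventually (c := Real.exp (-3) / (10 * Real.sqrt (2 * Real.pi)))
    (fun n => ?_) (by positivity) ?_
  · split
    · exact mul_pos (capBound_pos γ n) (hw n (by assumption))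
    · norm_num
  · have hlim : Filter.Tendsto (fun n : ℕ => Real.log n / (n : ℝ)) Filter.atTop (nhds 0) := by
      have := (Real.isLittleO_log_id_atTop.tendsto_div_nhds_zero).comp tendsto_natCast_atTop_atTop
      exact this
    -- This makes `t² = γ log n / n` less than `1 / 3`, so the squared threshold is at most `(15 /
    -- 2) γ log n`.
    have hev := hlim.eventually_lt_const (show (0 : ℝ) < 1 / (3 * γ) by positivity)
    filter_upwards [hev, Filter.eventually_ge_atTop 2] with n hn hn2
    rw [if_pos hn2]
    have hn' : (2 : ℝ) ≤ n := by exact_mod_cast hn2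
    have hn0 : (0 : ℝ) < n := by linarith
    have hL2 : 1 / 4 ≤ Real.log n := by
      have := Real.log_two_gt_d9
      have := Real.log_le_log two_pos hn'
      linarith
    have hL : 0 < γ * Real.log n := mul_pos hγ (by linarith)
    have hu : γ * Real.log n / n < 1 / 3 := by
      rw [lt_div_iff₀ (by positivity)] at hn
      rw [mul_div_assoc]
      linarith
    obtain ⟨x, hx⟩ : ∃ x, x = Real.sqrt (5 * (γ * Real.log n) / (1 - γ * Real.log n / n)) :=
      ⟨_, rfl⟩
    have hx0 : 0 ≤ x := hx ▸ Real.sqrt_nonneg _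
    have hx2 : x ^ 2 ≤ 15 / 2 * (γ * Real.log n) := by
      rw [hx, Real.sq_sqrt (div_pos (by linarith) (by linarith)).le, div_le_iff₀ (by linarith)]
      nlinarith
    -- From `(x - 5)² ≥ 0` one has `(x + 1)² / 2 ≤ (3 / 5) x² + 3`, and `3 / 5` of `15 / 2` is the
    -- exponent `9 / 2`.
    have hexp : -3 - 9 / 2 * γ * Real.log n ≤ -(x + 1) ^ 2 / 2 := by
      nlinarith [sq_nonneg (x - 5)]
    have hsq : 1 / 2 ≤ Real.sqrt (Real.log n) := by
      refine Real.le_sqrt_of_sq_le ?_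
      linarith
    have hrpow : (n : ℝ) ^ (9 / 2 * γ) = Real.exp (9 / 2 * γ * Real.log n) := by
      rw [Real.rpow_def_of_pos hn0, mul_comm]
    have h1 : Real.exp (-3) ≤ Real.exp (-(x + 1) ^ 2 / 2) * (n : ℝ) ^ (9 / 2 * γ) := by
      rw [hrpow, ← Real.exp_add]
      exact Real.exp_le_exp.mpr (by linarith)
    have hpos : 0 < Real.sqrt (2 * Real.pi) := by positivity
    simp only [capBound, w, ← hx]
    calc _ = Real.exp (-3) * (1 / 2) / (5 * Real.sqrt (2 * Real.pi)) := by field_simp; norm_num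
      _ ≤ Real.exp (-(x + 1) ^ 2 / 2) * (n : ℝ) ^ (9 / 2 * γ) * Real.sqrt (Real.log n) /
          (5 * Real.sqrt (2 * Real.pi)) := by gcongr
      _ = _ := by field_simp

/-! ### Success probability of one round and of all rounds -/

/-- If for each coordinate the function loses at most a factor `t k` against the value at the
coordinate of a reference point with probability at least `θ k`, then it loses at most the product
of these factors with probability at least the product of these probabilities. -/
theorem prod_le_pi_measure {ι : Type*} [Fintype ι] [DecidableEq ι] {X : ι → Type*}
    [∀ i, MeasurableSpace (X i)] (ν : ∀ i, Measure (X i)) [∀ i, SigmaFinite (ν i)]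
    {φ : (∀ i, X i) → ℝ} (hφ : Measurable φ) (x : ∀ i, X i) {t : ι → ℝ} (ht : ∀ i, 0 ≤ t i)
    {θ : ι → ENNReal}
    (h : ∀ i z, θ i ≤ ν i {v | t i * φ (Function.update z i (x i)) ≤ φ (Function.update z i v)}) :
    ∏ i, θ i ≤ Measure.pi ν {z | (∏ i, t i) * φ x ≤ φ z} := by
  have hms : ∀ c : ℝ, MeasurableSet {z | c ≤ φ z} := fun c => measurableSet_le measurable_const hφ
  have key : ∀ s : Finset ι, ∏ i ∈ s, θ i ≤
      lmarginal ν s ({z | (∏ i ∈ s, t i) * φ x ≤ φ z}.indicator 1) x := by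
    intro s
    induction s using Finset.induction_on with
    | empty => simp
    | insert i s hi ih =>
      rw [lmarginal_insert' _ (measurable_one.indicator (hms _)) hi, Finset.prod_insert hi]
      -- Where the coordinates in `s` already satisfy the bound, the hypothesis for coordinate `i`
      -- supplies at least the mass `θ i` in its fibre. Here the fibre still carries `x i` at `i`,
      -- which is the reference value in `h`.
      refine (mul_le_mul_right ih (θ i)).trans ?_
      rw [lmarginal, lmarginal, ← lintegral_const_mul]
      · refine lintegral_mono fun y => ?_
        have hz : Function.updateFinset x s y i = x i := by simp [Function.updateFinset, hi]
        generalize Function.updateFinset x s y = z at hz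
        by_cases hc : (∏ i ∈ s, t i) * φ x ≤ φ z
        · rw [Set.indicator_of_mem (by exact hc), Pi.one_apply, mul_one]
          refine (h i z).trans ?_
          have hm : MeasurableSet {v | t i * φ (Function.update z i (x i)) ≤
              φ (Function.update z i v)} :=
            measurableSet_le measurable_const (hφ.comp (measurable_update z))
          rw [← lintegral_indicator_one hm]
          refine lintegral_mono (Set.indicator_le fun v hv => ?_)
          have hv' : t i * φ (Function.update z i (x i)) ≤ φ (Function.update z i v) := hv
          rw [← hz, Function.update_eq_self] at hv'
          rw [Set.indicator_of_mem]
          · simp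
          · rw [Finset.prod_insert hi, Set.mem_ofPred_eq, mul_assoc]
            exact (mul_le_mul_of_nonneg_left hc (ht i)).trans hv'
        · rw [Set.indicator_of_notMem (by exact hc), mul_zero]
          exact zero_le
      · exact (measurable_one.indicator (hms _)).comp measurable_updateFinset
  have := key Finset.univ
  rwa [lmarginal_univ, lintegral_indicator_one (hms _)] at this

/-- The form is linear in each block. -/
theorem exists_form_update {d : ℕ} {n : Fin d → ℕ} (F : HTensor n) (x : Blocks n) (k : Fin d) :
    ∃ a : Fin (n k) → CQuat, ∀ v, form F (Function.update x k v) = ∑ i, a i * v i := by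
  refine ⟨fun i => ∑ I, if I k = i then F I * ∏ l ∈ Finset.univ.erase k, x l (I l) else 0,
    fun v => ?_⟩
  simp only [Finset.sum_mul, ite_mul, zero_mul]
  rw [Finset.sum_comm]
  refine Finset.sum_congr rfl fun I _ => ?_
  rw [Finset.sum_ite_eq, if_pos (Finset.mem_univ _), ← Finset.mul_prod_erase _ _ (Finset.mem_univ k),
    Function.update_self, mul_assoc, mul_comm (v (I k))]
  congr 2
  refine Finset.prod_congr rfl fun l hl => ?_
  rw [Function.update_of_ne (Finset.ne_of_mem_erase hl)]

theorem re_sum_mul_le {n : ℕ} (a x : Fin n → CQuat) :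
    (∑ i, a i * x i).re ≤ hnorm a * hnorm x := by
  conv_lhs => rw [← ofRealVec_toRealVec x]
  rw [re_sum_mul_ofRealVec, ← norm_dualVec, ← norm_toRealVec x]
  exact real_inner_le_norm _ _

/-- A tuple with given first blocks and the last two blocks of `x`. -/
def joinBlocks {m : ℕ} {n : Fin (m + 2) → ℕ} (x : Blocks n)
    (z : Blocks fun k : Fin m => n (k.castAdd 2)) : Blocks n :=
  Fin.addCases z fun j => x (Fin.natAdd m j)

section

variable {m : ℕ} {n : Fin (m + 2) → ℕ}

@[simp]
theorem joinBlocks_castAdd (x : Blocks n) (z : Blocks fun k : Fin m => n (k.castAdd 2)) (k : Fin m) :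
    joinBlocks x z (k.castAdd 2) = z k := Fin.addCases_left k

@[simp]
theorem joinBlocks_natAdd (x : Blocks n) (z : Blocks fun k : Fin m => n (k.castAdd 2)) (j : Fin 2) :
    joinBlocks x z (Fin.natAdd m j) = x (Fin.natAdd m j) := Fin.addCases_right j

theorem joinBlocks_self (x : Blocks n) : joinBlocks x (fun k => x (k.castAdd 2)) = x := by
  funext k
  refine Fin.addCases (fun k => ?_) (fun j => ?_) k <;> simp

theorem joinBlocks_update (x : Blocks n) (z : Blocks fun k : Fin m => n (k.castAdd 2)) (k : Fin m)
    (v : Fin (n (k.castAdd 2)) → CQuat) :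
    joinBlocks x (Function.update z k v) = Function.update (joinBlocks x z) (k.castAdd 2) v := by
  funext l
  refine Fin.addCases (fun l => ?_) (fun j => ?_) l
  · rw [joinBlocks_castAdd]
    rcases eq_or_ne l k with rfl | h
    · simp
    · rw [Function.update_of_ne h, Function.update_of_ne, joinBlocks_castAdd]
      exact fun h' => h (Fin.castAdd_injective m 2 h')
  · rw [joinBlocks_natAdd, Function.update_of_ne, joinBlocks_natAdd]
    intro h'
    have := congrArg Fin.val h'
    simp at this
    omega

theorem measurable_joinBlocks (x : Blocks n) : Measurable (joinBlocks x) := by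
  refine measurable_pi_iff.mpr fun k => ?_
  refine Fin.addCases (fun k => ?_) (fun j => ?_) k
  · simp only [joinBlocks_castAdd]; fun_prop
  · simp only [joinBlocks_natAdd]; fun_prop

theorem ratio_eq {γ : ℝ} (hγ : 0 < γ) (n : Fin (m + 2) → ℕ) : ratio γ n =
    ∏ k : Fin m, Real.sqrt (γ * Real.log (n (k.castAdd 2)) / (n (k.castAdd 2) : ℝ)) := by
  simp only [mul_div_assoc, Real.sqrt_mul hγ.le]
  rw [Finset.prod_mul_distrib, Finset.prod_const, Finset.card_univ, Fintype.card_fin, ratio,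
    Real.sqrt_eq_rpow, ← Real.rpow_mul_natCast hγ.le]
  congr 2
  ring

/-- The lower bound for the success probability of one round. -/
def successBound (γ c : ℝ) {m : ℕ} (n : Fin (m + 2) → ℕ) : ℝ :=
  ∏ k : Fin m, c / ((n (k.castAdd 2) : ℝ) ^ (9 / 2 * γ) * Real.sqrt (Real.log (n (k.castAdd 2))))

/-- One round is successful with probability at least `successBound`. -/
theorem successBound_le {γ c : ℝ} (hγ : 0 < γ) (hc : AdmissibleConstant γ c)
    (hn : ∀ k, 1 ≤ n k) (hn2 : ∀ k : Fin m, 2 ≤ n (k.castAdd 2))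
    (hγn : ∀ k : Fin m, γ * Real.log (n (k.castAdd 2)) < n (k.castAdd 2)) (F : HTensor n)
    {x : Blocks n} (hx : x ∈ feasible n) :
    ENNReal.ofReal (successBound γ c n) ≤
      (Measure.pi fun k : Fin m => uniformSphere (n (k.castAdd 2)))
        {z | ratio γ n * (form F x).re ≤ (form F (joinBlocks x z)).re} := by
  have : ∀ k, IsProbabilityMeasure (uniformSphere (n k)) := fun k =>
    isProbabilityMeasure_uniformSphere (hn k)
  have hc0 := hc.1
  rw [successBound, ENNReal.ofReal_prod_of_nonneg (fun k _ => by positivity), ratio_eq hγ]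
  have := prod_le_pi_measure (fun k : Fin m => uniformSphere (n (k.castAdd 2)))
    (φ := fun z => (form F (joinBlocks x z)).re)
    (CQuat.measurable_re.comp ((measurable_form F).comp (measurable_joinBlocks x)))
    (fun k => x (k.castAdd 2)) (t := fun k : Fin m =>
      Real.sqrt (γ * Real.log (n (k.castAdd 2)) / (n (k.castAdd 2) : ℝ)))
    (fun k => Real.sqrt_nonneg _) (θ := fun k : Fin m => ENNReal.ofReal
      (c / ((n (k.castAdd 2) : ℝ) ^ (9 / 2 * γ) * Real.sqrt (Real.log (n (k.castAdd 2)))))) ?_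
  · simpa only [joinBlocks_self] using this
  · intro k z
    obtain ⟨a, ha⟩ := exists_form_update F (joinBlocks x z) (k.castAdd 2)
    simp only [joinBlocks_update, ha]
    refine (hc.2 _ (hn2 k) (hγn k) a).trans (measure_mono fun v hv => ?_)
    simp only [Set.mem_ofPred_eq] at hv ⊢
    -- Admissibility compares with `‖a‖`, and the reference value `Re (aᵀ x)` at the unit vector is
    -- no larger.
    refine le_trans (mul_le_mul_of_nonneg_left ?_ (Real.sqrt_nonneg _)) hv
    have h1 := re_sum_mul_le a (x (k.castAdd 2))
    have h2 : hnorm (x (k.castAdd 2)) = 1 := hx (k.castAdd 2)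
    rwa [h2, mul_one] at h1

/-- The expression rounded up in `repetitions` is `log (1 / ε)` divided by the success bound, and `1
- θ ≤ exp (-θ)`. -/
theorem one_sub_successBound_pow_le {γ c ε : ℝ} (hε : 0 < ε) (hc : 0 < c)
    (hn2 : ∀ k : Fin m, 2 ≤ n (k.castAdd 2)) (h1 : successBound γ c n ≤ 1) :
    (1 - successBound γ c n) ^ repetitions γ c ε n ≤ ε := by
  have hfac : ∀ k : Fin m, 0 < (n (k.castAdd 2) : ℝ) ^ (9 / 2 * γ) *
      Real.sqrt (Real.log (n (k.castAdd 2))) := fun k => by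
    have hk : (2 : ℝ) ≤ n (k.castAdd 2) := by exact_mod_cast hn2 k
    have := Real.log_pos (show (1 : ℝ) < n (k.castAdd 2) by linarith)
    positivity
  have hpos : 0 < successBound γ c n := Finset.prod_pos fun k _ => div_pos hc (hfac k)
  have hR : Real.log (1 / ε) ≤ successBound γ c n * repetitions γ c ε n := by
    have h2 : Real.log (1 / ε) * (1 / c ^ m) * ∏ k : Fin m, ((n (k.castAdd 2) : ℝ) ^ (9 / 2 * γ) *
        Real.sqrt (Real.log (n (k.castAdd 2)))) ≤ repetitions γ c ε n :=
      (Nat.le_ceil _).trans (by exact_mod_cast le_max_right _ _)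
    have h3 : successBound γ c n * (Real.log (1 / ε) * (1 / c ^ m) *
        ∏ k : Fin m, ((n (k.castAdd 2) : ℝ) ^ (9 / 2 * γ) *
        Real.sqrt (Real.log (n (k.castAdd 2))))) = Real.log (1 / ε) := by
      rw [successBound, Finset.prod_div_distrib, Finset.prod_const, Finset.card_univ,
        Fintype.card_fin]
      have h4 := (Finset.prod_pos fun (k : Fin m) (_ : k ∈ Finset.univ) => hfac k).ne'
      have h5 := (pow_pos hc m).ne'
      generalize ∏ k : Fin m, ((n (k.castAdd 2) : ℝ) ^ (9 / 2 * γ) *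
        Real.sqrt (Real.log (n (k.castAdd 2)))) = w at h4 ⊢
      field_simp
    rw [← h3]
    exact mul_le_mul_of_nonneg_left h2 hpos.le
  calc (1 - successBound γ c n) ^ repetitions γ c ε n
      ≤ Real.exp (-successBound γ c n) ^ repetitions γ c ε n :=
        pow_le_pow_left₀ (by linarith) (Real.one_sub_le_exp_neg _) _
    _ = Real.exp (-(successBound γ c n * repetitions γ c ε n)) := by
        rw [← Real.exp_nat_mul]; ring_nf
    _ ≤ Real.exp (-Real.log (1 / ε)) := Real.exp_le_exp.mpr (by linarith)
    _ = ε := by rw [one_div, Real.log_inv, neg_neg, Real.exp_log hε]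

/-! ### The probabilistic guarantee and the main theorem -/

/-- The joint law of the samples of all rounds. -/
theorem IsUniformSample.hasLaw {Ω : Type*} [MeasurableSpace Ω] {P : Measure Ω}
    [IsProbabilityMeasure P] {m : ℕ} {n : Fin m → ℕ} {R : ℕ} (hn : ∀ k, 1 ≤ n k)
    {ξ : Ω → Fin R → Blocks n} (h : IsUniformSample P ξ) :
    HasLaw ξ (Measure.pi fun _ => Measure.pi fun k => uniformSphere (n k)) P := by
  have : ∀ k, IsProbabilityMeasure (uniformSphere (n k)) := fun k =>
    isProbabilityMeasure_uniformSphere (hn k)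
  have h1 := h.2.precomp (Equiv.sigmaEquivProd (Fin R) (Fin m)).injective
  have h2 := h1.hasLaw_pi (μ := fun p => uniformSphere (n p.2)) fun p => h.1 p.1 p.2
  have h3 : HasLaw (MeasurableEquiv.piCurry fun (_ : Fin R) (k : Fin m) => Fin (n k) → CQuat)
      (Measure.infinitePi fun _ : Fin R => Measure.infinitePi fun k => uniformSphere (n k))
      (Measure.infinitePi fun p : (_ : Fin R) × Fin m => uniformSphere (n p.2)) :=
    ⟨by fun_prop, Measure.infinitePi_map_piCurry (X := fun (_ : Fin R) (k : Fin m) =>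
      Fin (n k) → CQuat) fun _ k => uniformSphere (n k)⟩
  simp only [Measure.infinitePi_eq_pi] at h3
  exact h3.comp h2

/-- The guarantee of the randomized algorithm. -/
theorem le_measure_isAlgorithmResult {γ c ε : ℝ} (hγ : 0 < γ) (hc : AdmissibleConstant γ c)
    (hn : ∀ k, 1 ≤ n k)
    (hγn : ∀ k : Fin m, γ * Real.log (n (k.castAdd 2)) < n (k.castAdd 2)) (F : HTensor n)
    (hε : 0 < ε) {Ω : Type*} [MeasurableSpace Ω] (P : Measure Ω) [IsProbabilityMeasure P]
    (ξ : Ω → Fin (repetitions γ c ε n) → Blocks fun k : Fin m => n (k.castAdd 2))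
    (y : Ω → Blocks n) (hξ : IsUniformSample P ξ) (hy : ∀ ω, IsAlgorithmResult F (ξ ω) (y ω)) :
    ENNReal.ofReal (1 - ε) ≤
      P {ω | y ω ∈ feasible n ∧ ratio γ n * optValue F ≤ (form F (y ω)).re} := by
  have hprob : ∀ k, IsProbabilityMeasure (uniformSphere (n k)) := fun k =>
    isProbabilityMeasure_uniformSphere (hn k)
  have hlaw := hξ.hasLaw fun k => hn (k.castAdd 2)
  obtain ⟨x, hx, hopt⟩ := exists_optimal hn F
  obtain ⟨ν, hν⟩ : ∃ ν, ν = Measure.pi fun k : Fin m => uniformSphere (n (k.castAdd 2)) := ⟨_, rfl⟩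
  have hνp : IsProbabilityMeasure ν := hν ▸ inferInstance
  rw [← hν] at hlaw
  let R := repetitions γ c ε n
  -- The samples are only known through their law, so feasibility of the first blocks holds almost
  -- surely.
  have hsph : ∀ᵐ z ∂(Measure.pi fun _ : Fin R => ν), ∀ r k, z r k ∈ hsphere (n (k.castAdd 2)) := by
    rw [ae_all_iff]
    intro r
    rw [ae_all_iff]
    intro k
    have h1 : ∀ᵐ v ∂uniformSphere (n (k.castAdd 2)), v ∈ hsphere (n (k.castAdd 2)) := by
      rw [ae_iff]
      exact (prob_compl_eq_zero_iff (measurableSet_hsphere _)).mpr (uniformSphere_hsphere (hn _))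
    have h2 : ∀ᵐ w ∂ν, w k ∈ hsphere (n (k.castAdd 2)) := by
      rw [hν]
      exact (measurePreserving_eval (fun k : Fin m =>
        uniformSphere (n (k.castAdd 2))) k).quasiMeasurePreserving.ae h1
    exact (measurePreserving_eval (fun _ : Fin R => ν) r).quasiMeasurePreserving.ae h2
  have hsph' : ∀ᵐ ω ∂P, ∀ r k, ξ ω r k ∈ hsphere (n (k.castAdd 2)) :=
    ae_of_ae_map hlaw.aemeasurable (by rw [hlaw.map_eq]; exact hsph)
  -- the value of the result is at least the value of each tuple completed by the optimal solution
  have hresult : ∀ ω, (∀ r k, ξ ω r k ∈ hsphere (n (k.castAdd 2))) → y ω ∈ feasible n ∧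
      0 ≤ (form F (y ω)).re ∧ ∀ r, (form F (joinBlocks x (ξ ω r))).re ≤ (form F (y ω)).re := by
    intro ω hω
    obtain ⟨z, hz, r, hyz, hmax⟩ := hy ω
    rw [hyz]
    refine ⟨fun k => ?_, (hz r).form_nonneg, fun r' => le_trans ?_ (hmax r')⟩
    · refine Fin.addCases (fun k => ?_) (fun j => (hz r).1.2 j) k
      rw [(hz r).1.1 k]
      exact hω r k
    -- The last two blocks of the optimal tuple compete in the bilinear problem of round `r'`.
    · exact (hz r').2 ⟨fun k => joinBlocks_castAdd _ _ k, fun j => by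
        rw [joinBlocks_natAdd]; exact hx _⟩
  by_cases hn2 : ∀ k : Fin m, 2 ≤ n (k.castAdd 2)
  · obtain ⟨good, hgood⟩ : ∃ s : Set (Blocks fun k : Fin m => n (k.castAdd 2)),
      s = {z | ratio γ n * (form F x).re ≤ (form F (joinBlocks x z)).re} := ⟨_, rfl⟩
    have hgm : MeasurableSet good := hgood ▸ measurableSet_le measurable_const
      (CQuat.measurable_re.comp ((measurable_form F).comp (measurable_joinBlocks x)))
    have hθ := successBound_le hγ hc hn hn2 hγn F hx
    rw [← hν, ← hgood] at hθ
    have hθ' : successBound γ c n ≤ ν.real good :=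
      (ENNReal.ofReal_le_iff_le_toReal (measure_ne_top _ _)).mp hθ
    -- The rounds are independent, so the probability that none is good is a power.
    have hbad : (Measure.pi fun _ : Fin R => ν) (Set.univ.pi fun _ => goodᶜ) ≤ ENNReal.ofReal ε := by
      rw [Measure.pi_pi, Finset.prod_const, Finset.card_univ, Fintype.card_fin,
        ← ofReal_measureReal, probReal_compl_eq_one_sub hgm, ← ENNReal.ofReal_pow
        (sub_nonneg.mpr measureReal_le_one)]
      refine ENNReal.ofReal_le_ofReal (le_trans ?_ (one_sub_successBound_pow_le hε hc.1 hn2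
        (hθ'.trans measureReal_le_one)))
      exact pow_le_pow_left₀ (sub_nonneg.mpr measureReal_le_one) (by linarith) _
    have hbm : MeasurableSet (Set.univ.pi fun _ : Fin R => goodᶜ) :=
      MeasurableSet.univ_pi fun _ => hgm.compl
    have h1 : ENNReal.ofReal (1 - ε) ≤
        (Measure.pi fun _ : Fin R => ν) (Set.univ.pi fun _ : Fin R => goodᶜ)ᶜ := by
      rw [prob_compl_eq_one_sub hbm, ENNReal.ofReal_sub _ hε.le, ENNReal.ofReal_one]
      exact tsub_le_tsub_left hbad 1
    refine h1.trans ?_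
    rw [← hlaw.map_eq, Measure.map_apply_of_aemeasurable hlaw.aemeasurable hbm.compl]
    refine measure_mono_ae ?_
    filter_upwards [hsph'] with ω hω hωb
    obtain ⟨h2, -, h3⟩ := hresult ω hω
    refine ⟨h2, ?_⟩
    have : ∃ r, ξ ω r ∈ good := by
      by_contra! hcon
      exact hωb fun r _ => hcon r
    obtain ⟨r, hr⟩ := this
    rw [hgood] at hr
    rw [← hopt]
    exact le_trans hr (h3 r)
  · push Not at hn2
    obtain ⟨k, hk⟩ := hn2
    -- Admissibility says nothing for size one, but then `log 1 = 0` makes the ratio zero and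
    -- nonnegativity suffices.
    have hk1 : n (k.castAdd 2) = 1 := by have := hn (k.castAdd 2); omega
    have hr : ratio γ n = 0 := by
      rw [ratio, Finset.prod_eq_zero (Finset.mem_univ k) (by simp [hk1]), mul_zero]
    calc ENNReal.ofReal (1 - ε) ≤ P Set.univ := by
          rw [measure_univ]
          exact ENNReal.ofReal_le_one.mpr (by linarith)
      _ ≤ _ := by
          refine measure_mono_ae ?_
          filter_upwards [hsph'] with ω hω _
          obtain ⟨h2, h3, -⟩ := hresult ω hω
          exact ⟨h2, by rw [hr, zero_mul]; exact h3⟩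

end

end

theorem mainTheorem1 :
    ∃ A : RealRAM.Prog, ∀ γ : ℝ, 0 < γ →
      (∃ c, AdmissibleConstant γ c) ∧
      ∀ c, AdmissibleConstant γ c → ∃ p : Polynomial ℕ,
        ∀ (m : ℕ) (n : Fin (m + 2) → ℕ), (∀ k, 1 ≤ n k) →
          (∀ k : Fin m, γ * Real.log (n (k.castAdd 2)) < n (k.castAdd 2)) →
          ∀ (F : HTensor n) (ε : ℝ), 0 < ε →
            -- the guarantee of the algorithm, whichever exact bilinear solver is used
            (∀ (Ω : Type*) [MeasurableSpace Ω] (P : Measure Ω) [IsProbabilityMeasure P]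
              (ξ : Ω → Fin (repetitions γ c ε n) → Blocks fun k : Fin m => n (k.castAdd 2))
              (y : Ω → Blocks n),
              IsUniformSample P ξ → (∀ ω, IsAlgorithmResult F (ξ ω) (y ω)) →
              ENNReal.ofReal (1 - ε) ≤
                P {ω | y ω ∈ feasible n ∧ ratio γ n * optValue F ≤ (form F (y ω)).re}) ∧
            -- the program `A` carries out the algorithm,
            (∃ ξ : (ℕ → ℝ) → Fin (repetitions γ c ε n) → Blocks fun k : Fin m => n (k.castAdd 2),
              IsUniformSample normalSequence ξ ∧
              ∀ ω, IsAlgorithmResult F (ξ ω)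
                (RealRAM.output n (RealRAM.exec ω A (RealRAM.input F ε γ c)))) ∧
            -- in polynomial time,
            (∀ ω, (RealRAM.exec ω A (RealRAM.input F ε γ c)).time ≤
              p.eval (m + 2 + ∏ k, n k + ⌈Real.log (1 / ε)⌉₊)) ∧
            -- and succeeds with the required probability
            ENNReal.ofReal (1 - ε) ≤ normalSequence {ω |
              RealRAM.output n (RealRAM.exec ω A (RealRAM.input F ε γ c)) ∈ feasible n ∧
              ratio γ n * optValue F ≤
                (form F (RealRAM.output n
                  (RealRAM.exec ω A (RealRAM.input F ε γ c)))).re} := by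
  refine ⟨RealRAM.Alg.program, fun γ hγ => ⟨exists_admissibleConstant hγ, fun c hc => ?_⟩⟩
  obtain ⟨p, hp⟩ := RealRAM.Alg.exists_time_le γ c hc.1
  refine ⟨p, fun m n hn hγn F ε hε => ?_⟩
  have hξ := RealRAM.Alg.isUniformSample_samples hn (repetitions γ c ε n)
  have hy := fun ω => RealRAM.Alg.exec_program ω F hn ε γ c
  exact ⟨fun Ω _ P _ ξ y => le_measure_isAlgorithmResult hγ hc hn hγn F hε P ξ y,
    ⟨_, hξ, hy⟩, hp m n hn F ε,
    le_measure_isAlgorithmResult hγ hc hn hγn F hε normalSequence _ _ hξ hy⟩
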